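/- Let $\mathcal H$ be a separable complex Hilbert space, $\mathcal N\subset\mathcal B(\mathcal H)$ a von Neumann algebra with a faithful normal semifinite trace $\tau$, $\mathcal D$ a (possibly unbounded) self-adjoint operator on $\mathcal H$ affiliated with $\mathcal N$, and $p\ge 1$ a real number. For $s>0$ and $T\in\mathcal N_+$ put $\varphi_s(T)=\tau\big((1+\mathcal D^2)^{-s/4}T(1+\mathcal D^2)^{-s/4}\big)\in[0,\infty]$. Let $\mathcal B_2(\mathcal D,p)$ be the set of all $T\in\mathcal N$ with $\varphi_s(T^*T)<\infty$ and $\varphi_s(TT^*)<\infty$ for all $s>p$, with the norms $$\mathcal Q_n(T)=\big(\|T\|^2+\varphi_{p+1/n}(T^*T)+\varphi_{p+1/n}(TT^*)\big)^{1/2},\qquad n=1,2,\dots$$ Let $\mathcal B_2(\mathcal D,p)^2$ be the linear span of the products $RS$ with $R,S\in\mathcal B_2(\mathcal D,p)$, with the norms $$\mathcal P_n(T)=\inf\Big\{\sum_{i=1}^k\mathcal Q_n(R_i)\mathcal Q_n(S_i)\ :\ T=\sum_{i=1}^kR_iS_i,\ R_i,S_i\in\mathcal B_2(\mathcal D,p)\Big\},$$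 and let $\mathcal B_1(\mathcal D,p)\subset\mathcal N$ be its completion for the norms $\mathcal P_n$, $n\ge1$ (realised in $\mathcal N$ by sending a sequence that is Cauchy for all $\mathcal P_n$ to its limit in operator norm), with the norms $\mathcal P_n$ extended by continuity. Let $\delta$ be the derivation $\delta(T)=[|\mathcal D|,T]$; its domain consists of the bounded operators $T$ that map $\mathrm{dom}\,|\mathcal D|$ into itself and for which $|\mathcal D|T-T|\mathcal D|$ is bounded on $\mathrm{dom}\,|\mathcal D|$, and $\delta(T)$ is the bounded extension. For $l\in\mathbb N_0\cup\{\infty\}$ let $\mathcal B_1^l(\mathcal D,p)$ be the set of all $T$ such that $\delta^j(T)$ is defined and belongs to $\mathcal B_1(\mathcal D,p)$ for every finite $j\le l$, topologised by the norms $\mathcal P_{n,k}(T)=\sum_{j=0}^k\mathcal P_n(\delta^j(T))$, $n\ge1$, $k$ finite, $k\le l$. In particular $\mathcal B_1^0(\mathcal D,p)=\mathcal B_1(\mathcal D,p)$. By a Fréchet $*$-algebra we mean a complex $*$-algebra with a complete Hausdorff topology defined by countably many seminorms that are submultiplicative up to constant factors, with continuous product and involution. Then: 1. $\mathcal B_2(\mathcal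 D,p)$ with the norms $\mathcal Q_n$ is a $*$-subalgebra of $\mathcal N$ and a Fréchet $*$-algebra. 2. For every $l\in\mathbb N_0\cup\{\infty\}$, $\mathcal B_1^l(\mathcal D,p)$ is a $*$-subalgebra of $\mathcal N$ and a Fréchet $*$-algebra. 3. For every $l\in\mathbb N_0\cup\{\infty\}$ and every $m$, the matrix algebra $M_m(\mathcal B_1^l(\mathcal D,p))$ with its entrywise topology is a Fréchet $*$-algebra, and it is stable under the holomorphic functional calculus: if $X\in M_m(\mathcal B_1^l(\mathcal D,p))$ and $f$ is holomorphic in a neighbourhood of the spectrum of $X$, with $f(0)=0$ unless $\mathrm{Id}_{\mathcal N}\in\mathcal B_1^l(\mathcal D,p)$, then $f(X)=\frac1{2\pi i}\int_\Gamma f(z)(z-X)^{-1}\,dz$, where $\Gamma$ is a positively oriented contour in that neighbourhood surrounding the spectrum of $X$, belongs to $M_m(\mathcal B_1^l(\mathcal D,p))$. -/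

import Mathlib

open Filter Topology MeasureTheory
open scoped ENNReal NNReal InnerProductSpace

noncomputable section

namespace WeightIntegration

/-! ### Unbounded self-adjoint operators: affiliation, resolvent powers, modulus -/

section Unbounded

variable {H : Type*} [NormedAddCommGroup H] [InnerProductSpace ℂ H]

/-- `b = (1 + D²)⁻¹`: the operator `b` maps `H` into `dom D²` and `(1 + D²) b x = x` for all `x`. -/
def IsInvOneAddSq (D : H →ₗ.[ℂ] H) (b : H →L[ℂ] H) : Prop :=
  ∀ x : H, ∃ (h : b x ∈ D.domain) (h' : D ⟨b x, h⟩ ∈ D.domain), b x + D ⟨D ⟨b x, h⟩, h'⟩ = x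

open Classical in
/-- The bounded operator `(1 + D²)⁻¹`; it exists for every self-adjoint `D`,
see `isInvOneAddSq_invOneAddSq`. -/
def invOneAddSq (D : H →ₗ.[ℂ] H) : H →L[ℂ] H :=
  if h : ∃ b, IsInvOneAddSq D b then h.choose else 0

variable [CompleteSpace H]

theorem exists_isInvOneAddSq {D : H →ₗ.[ℂ] H} (hD : IsSelfAdjoint D) :
    ∃ b, IsInvOneAddSq D b := by
  let e := WithLp.prodContinuousLinearEquiv 2 ℂ H H
  let G : Submodule ℂ (WithLp 2 (H × H)) := D.graph.comap (e : WithLp 2 (H × H) →ₗ[ℂ] H × H)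
  have hG : IsClosed (G : Set (WithLp 2 (H × H))) :=
    (hD.isClosed : IsClosed (D.graph : Set (H × H))).preimage e.continuous
  have : CompleteSpace G := hG.completeSpace_coe
  refine ⟨(ContinuousLinearMap.fst ℂ H H).comp ((e : WithLp 2 (H × H) →L[ℂ] H × H).comp
    (G.starProjection.comp ((e.symm : H × H →L[ℂ] WithLp 2 (H × H)).comp
      (ContinuousLinearMap.inl ℂ H H)))), fun x => ?_⟩
  have h1 : G.starProjection (e.symm (x, 0)) ∈ G := Submodule.starProjection_apply_mem _ _
  have h2 := Submodule.sub_starProjection_mem_orthogonal (K := G) (e.symm (x, 0))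
  set y := G.starProjection (e.symm (x, 0)) with hy
  have h1' : e y ∈ D.graph := h1
  obtain ⟨u, hu1, hu2⟩ := D.mem_graph_iff.1 h1'
  have h3 : ∀ w : D.domain, ⟪x - (e y).1, (w : H)⟫_ℂ = ⟪(e y).2, D w⟫_ℂ := by
    intro w
    have hw : e.symm ((w : H), D w) ∈ G := by
      change e (e.symm ((w : H), D w)) ∈ D.graph
      rw [e.apply_symm_apply]
      exact D.mem_graph w
    have h4 := Submodule.inner_left_of_mem_orthogonal hw h2
    rw [WithLp.prod_inner_apply] at h4
    have h5 : ⟪x - (e y).1, (w : H)⟫_ℂ + ⟪0 - (e y).2, D w⟫_ℂ = 0 := h4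
    rw [zero_sub, inner_neg_left] at h5
    exact eq_of_sub_eq_zero (by rw [sub_eq_add_neg]; exact h5)
  have h6 : ((e y).2, x - (e y).1) ∈ D.adjoint.graph := by
    have hm := LinearPMap.mem_adjoint_domain_of_exists (T := D) (e y).2 ⟨_, h3⟩
    exact (LinearPMap.mem_graph_iff _).2
      ⟨⟨_, hm⟩, rfl, LinearPMap.adjoint_apply_eq hD.dense_domain _ h3⟩
  rw [LinearPMap.isSelfAdjoint_def.1 hD] at h6
  obtain ⟨v, hv1, hv2⟩ := D.mem_graph_iff.1 h6
  change (v : H) = (e y).2 at hv1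
  change D v = x - (e y).1 at hv2
  have hdom : (e y).1 ∈ D.domain := hu1 ▸ u.2
  have hDu : D ⟨(e y).1, hdom⟩ = (e y).2 := by
    rw [← hu2]; congr 1; exact Subtype.ext hu1.symm
  have hdom' : D ⟨(e y).1, hdom⟩ ∈ D.domain := by
    rw [hDu]; exact hv1 ▸ v.2
  refine ⟨hdom, hdom', ?_⟩
  have hDD : D ⟨D ⟨(e y).1, hdom⟩, hdom'⟩ = x - (e y).1 := by
    rw [← hv2]; congr 1; exact Subtype.ext (hDu.trans hv1.symm)
  change (e y).1 + D ⟨D ⟨(e y).1, hdom⟩, hdom'⟩ = x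
  rw [hDD]; abel

theorem isInvOneAddSq_invOneAddSq {D : H →ₗ.[ℂ] H} (hD : IsSelfAdjoint D) :
    IsInvOneAddSq D (invOneAddSq D) := by
  rw [invOneAddSq, dif_pos (exists_isInvOneAddSq hD)]
  exact (exists_isInvOneAddSq hD).choose_spec

/-- `(1 + D²)^(-r)`, for `r > 0`, as the power `b^r` of the bounded operator `b = (1 + D²)⁻¹`
(continuous functional calculus). -/
def resPow (D : H →ₗ.[ℂ] H) (r : ℝ) : H →L[ℂ] H :=
  cfc (fun x : ℝ => x ^ r) (invOneAddSq D)

/-- The unbounded operator `|D|`. With `b = (1 + D²)⁻¹` one has `|D| = (1 - b)^(1/2) b^(-1/2)`,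
because `t = (1 - 1/(1+t²))^(1/2) (1/(1+t²))^(-1/2)` for `t ≥ 0`: the domain of `|D|` is the range
of `b^(1/2)` (which is `dom D`), and `|D| (b^(1/2) y) = (1 - b)^(1/2) y`. -/
def absOp (D : H →ₗ.[ℂ] H) : H →ₗ.[ℂ] H :=
  (LinearMap.range ((resPow D (1 / 2)).prod
    (cfc (fun x : ℝ => Real.sqrt (1 - x)) (invOneAddSq D))).toLinearMap).toLinearPMap

/-- `D` is affiliated with the von Neumann algebra `N`: every unitary of the commutant of `N`
maps `dom D` into itself and commutes there with `D`. -/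
def IsAffiliated (N : VonNeumannAlgebra H) (D : H →ₗ.[ℂ] H) : Prop :=
  ∀ u ∈ N.commutant, u ∈ unitary (H →L[ℂ] H) →
    ∀ x : D.domain, ∃ h : u x ∈ D.domain, D ⟨u x, h⟩ = u (D x)

/-- `S = δ(T) = [|D|, T]`: the operator `T` preserves `dom |D|`, and the commutator
`|D| T - T |D|` is on `dom |D|` the restriction of the bounded operator `S`. -/
def IsDelta (D : H →ₗ.[ℂ] H) (T S : H →L[ℂ] H) : Prop :=
  ∀ x : (absOp D).domain, ∃ h : T x ∈ (absOp D).domain,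
    absOp D ⟨T x, h⟩ - T (absOp D x) = S x

/-- The domain of the derivation `δ = [|D|, ·]`. -/
def deltaDomain (D : H →ₗ.[ℂ] H) : Set (H →L[ℂ] H) := {T | ∃ S, IsDelta D T S}

open Classical in
/-- The derivation `δ(T) = [|D|, T]` for `T` in its domain. -/
def delta (D : H →ₗ.[ℂ] H) (T : H →L[ℂ] H) : H →L[ℂ] H :=
  if h : ∃ S, IsDelta D T S then h.choose else 0

end Unbounded

/-! ### Traces and weights -/

section Weights

variable {H : Type*} [NormedAddCommGroup H] [InnerProductSpace ℂ H] [CompleteSpace H]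

/-- `τ` is a faithful normal semifinite trace on (the positive cone of) the von Neumann
algebra `N`. The values of the function `τ` outside the positive cone of `N` play no role. -/
structure IsFaithfulNormalSemifiniteTrace (N : VonNeumannAlgebra H)
    (τ : (H →L[ℂ] H) → ℝ≥0∞) : Prop where
  add : ∀ S ∈ N, ∀ T ∈ N, 0 ≤ S → 0 ≤ T → τ (S + T) = τ S + τ T
  smul : ∀ (r : ℝ≥0), ∀ T ∈ N, 0 ≤ T → τ ((r : ℂ) • T) = r * τ T
  trace : ∀ T ∈ N, τ (star T * T) = τ (T * star T)
  faithful : ∀ T ∈ N, 0 ≤ T → τ T = 0 → T = 0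
  normal : ∀ (A : Set (H →L[ℂ] H)) (T : H →L[ℂ] H), (∀ S ∈ A, S ∈ N ∧ 0 ≤ S) →
    A.Nonempty → DirectedOn (· ≤ ·) A → IsLUB A T → τ T = ⨆ S ∈ A, τ S
  semifinite : ∀ T ∈ N, 0 ≤ T → T ≠ 0 → ∃ S ∈ N, 0 ≤ S ∧ S ≤ T ∧ S ≠ 0 ∧ τ S < ∞

/-- The weight `φ_s(T) = τ((1 + D²)^(-s/4) T (1 + D²)^(-s/4))` on the positive cone of `N`. -/
def weight (τ : (H →L[ℂ] H) → ℝ≥0∞) (D : H →ₗ.[ℂ] H) (s : ℝ) (T : H →L[ℂ] H) : ℝ≥0∞ :=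
  τ (resPow D (s / 4) * T * resPow D (s / 4))

/-- The half domain of the weight `φ_s`. -/
def halfDomain (N : VonNeumannAlgebra H) (τ : (H →L[ℂ] H) → ℝ≥0∞) (D : H →ₗ.[ℂ] H) (s : ℝ) :
    Set (H →L[ℂ] H) :=
  {T | T ∈ N ∧ weight τ D s (star T * T) < ∞}

/-- The algebra `B₂(D, p)` of square-integrable elements. -/
def B2 (N : VonNeumannAlgebra H) (τ : (H →L[ℂ] H) → ℝ≥0∞) (D : H →ₗ.[ℂ] H) (p : ℝ) :
    Set (H →L[ℂ] H) :=
  {T | ∀ s : ℝ, p < s → T ∈ halfDomain N τ D s ∧ star T ∈ halfDomain N τ D s}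

/-- The norm `Q_n(T) = (‖T‖² + φ_{p+1/n}(|T|²) + φ_{p+1/n}(|T*|²))^(1/2)` on `B₂(D, p)`,
`n = 1, 2, …`. -/
def normQ (τ : (H →L[ℂ] H) → ℝ≥0∞) (D : H →ₗ.[ℂ] H) (p : ℝ) (n : ℕ+) (T : H →L[ℂ] H) : ℝ :=
  Real.sqrt (‖T‖ ^ 2 + (weight τ D (p + 1 / (n : ℝ)) (star T * T)).toReal
    + (weight τ D (p + 1 / (n : ℝ)) (T * star T)).toReal)

/-- `B₂(D, p)²`, the linear span of the products of two elements of `B₂(D, p)`. -/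
def B2Sq (N : VonNeumannAlgebra H) (τ : (H →L[ℂ] H) → ℝ≥0∞) (D : H →ₗ.[ℂ] H) (p : ℝ) :
    Submodule ℂ (H →L[ℂ] H) :=
  Submodule.span ℂ {T | ∃ R ∈ B2 N τ D p, ∃ S ∈ B2 N τ D p, T = R * S}

/-- The norm `P_n` on `B₂(D, p)²`: the infimum of `∑ Q_n(R_i) Q_n(S_i)` over all finite
representations `T = ∑ R_i S_i` with `R_i, S_i ∈ B₂(D, p)`. -/
def normPSq (N : VonNeumannAlgebra H) (τ : (H →L[ℂ] H) → ℝ≥0∞) (D : H →ₗ.[ℂ] H) (p : ℝ)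
    (n : ℕ+) (T : H →L[ℂ] H) : ℝ :=
  sInf {c : ℝ | ∃ (k : ℕ) (R S : Fin k → (H →L[ℂ] H)),
    (∀ i, R i ∈ B2 N τ D p) ∧ (∀ i, S i ∈ B2 N τ D p) ∧ T = ∑ i, R i * S i ∧
    c = ∑ i, normQ τ D p n (R i) * normQ τ D p n (S i)}

/-- The sequence `u` in `B₂(D, p)²` is Cauchy for all the norms `P_n`, and the point of the
completion that it represents is the operator `T` (`P_n` dominates the operator norm, so `u`
converges in operator norm). -/
structure Represents (N : VonNeumannAlgebra H) (τ : (H →L[ℂ] H) → ℝ≥0∞) (D : H →ₗ.[ℂ] H)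
    (p : ℝ) (u : ℕ → (H →L[ℂ] H)) (T : H →L[ℂ] H) : Prop where
  mem : ∀ k, u k ∈ B2Sq N τ D p
  cauchy : ∀ n : ℕ+, ∀ ε > 0, ∃ K : ℕ, ∀ i ≥ K, ∀ j ≥ K, normPSq N τ D p n (u i - u j) < ε
  tendsto : Tendsto u atTop (𝓝 T)

/-- The algebra `B₁(D, p)` of integrable elements: the completion of `B₂(D, p)²` for the norms
`P_n`, as a subspace of `N`. -/
def B1 (N : VonNeumannAlgebra H) (τ : (H →L[ℂ] H) → ℝ≥0∞) (D : H →ₗ.[ℂ] H) (p : ℝ) :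
    Set (H →L[ℂ] H) :=
  {T | ∃ u, Represents N τ D p u T}

/-- The norm `P_n` on the completion `B₁(D, p)`: the limit of `P_n(u_k)` for a Cauchy sequence
`u` that represents `T`. -/
def normP (N : VonNeumannAlgebra H) (τ : (H →L[ℂ] H) → ℝ≥0∞) (D : H →ₗ.[ℂ] H) (p : ℝ)
    (n : ℕ+) (T : H →L[ℂ] H) : ℝ :=
  sInf {c : ℝ | ∃ u, Represents N τ D p u T ∧
    Tendsto (fun k => normPSq N τ D p n (u k)) atTop (𝓝 c)}

/-- `B₁^l(D, p)`, `l ∈ ℕ ∪ {∞}`: the operators `T` such that `δ^j(T)` is defined and belongs to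
`B₁(D, p)` for all finite `j ≤ l`. -/
def B1Smooth (N : VonNeumannAlgebra H) (τ : (H →L[ℂ] H) → ℝ≥0∞) (D : H →ₗ.[ℂ] H) (p : ℝ)
    (l : ℕ∞) : Set (H →L[ℂ] H) :=
  {T | (∀ j : ℕ, (j : ℕ∞) < l → (delta D)^[j] T ∈ deltaDomain D) ∧
    ∀ j : ℕ, (j : ℕ∞) ≤ l → (delta D)^[j] T ∈ B1 N τ D p}

/-- The norm `P_{n,l}(T) = ∑_{j ≤ l} P_n(δ^j(T))`. -/
def normPSmooth (N : VonNeumannAlgebra H) (τ : (H →L[ℂ] H) → ℝ≥0∞) (D : H →ₗ.[ℂ] H) (p : ℝ)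
    (n : ℕ+) (l : ℕ) (T : H →L[ℂ] H) : ℝ :=
  ∑ j ∈ Finset.range (l + 1), normP N τ D p n ((delta D)^[j] T)

/-- The index set of the norms `P_{n,j}`, `n ≥ 1`, `0 ≤ j ≤ l`, that define the topology of
`B₁^l(D, p)`. -/
abbrev SmoothIndex (l : ℕ∞) : Type := ℕ+ × {j : ℕ // (j : ℕ∞) ≤ l}

instance (l : ℕ∞) : Nonempty (SmoothIndex l) := ⟨(1, ⟨0, by simp⟩)⟩

end Weights

/-! ### Fréchet `*`-algebras -/

/-- The real functions `q i` on the complex `*`-algebra `A` are seminorms whose topology makes `A`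
a Fréchet `*`-algebra: a complete Hausdorff locally convex space, defined by countably many
seminorms that are submultiplicative up to constants, with continuous product and involution. -/
def IsFrechetStarAlgebra (A : Type*) [NonUnitalRing A] [StarRing A] [Module ℂ A]
    {ι : Type*} [Nonempty ι] (q : ι → A → ℝ) : Prop :=
  Countable ι ∧ ∃ (s : SeminormFamily ℂ A ι) (_ : UniformSpace A),
    (∀ i x, s i x = q i x) ∧ IsUniformAddGroup A ∧ WithSeminorms s ∧ T2Space A ∧
    CompleteSpace A ∧ ContinuousMul A ∧ ContinuousStar A ∧
    ∀ i, ∃ C : ℝ, ∀ x y : A, q i (x * y) ≤ C * q i x * q i y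

/-- The subset `B` of the complex `*`-algebra `R` is a `*`-subalgebra (with or without unit), and
it is a Fréchet `*`-algebra for the topology of the seminorms `q i`. -/
def IsFrechetStarSubalgebra {R : Type*} [Ring R] [StarRing R] [Algebra ℂ R] (B : Set R)
    {ι : Type*} [Nonempty ι] (q : ι → R → ℝ) : Prop :=
  ∃ A : NonUnitalStarSubalgebra ℂ R, (A : Set R) = B ∧
    IsFrechetStarAlgebra A (fun i (x : A) => q i (x : R))

/-- `M_m(B)`: the matrices with entries in `B`. -/
def matricesOver {R : Type*} (B : Set R) (m : ℕ) : Set (Matrix (Fin m) (Fin m) R) :=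
  {M | ∀ i j, M i j ∈ B}

/-- The seminorms `M ↦ ∑ q(M_ij)` of the entrywise topology on a matrix algebra. -/
def matrixSeminorm {R ι : Type*} (q : ι → R → ℝ) (m : ℕ) (i : ι)
    (M : Matrix (Fin m) (Fin m) R) : ℝ :=
  ∑ a, ∑ b, q i (M a b)

/-! ### Holomorphic functional calculus -/

/-- The point `z₀ + h (a + i b)` of the square grid with mesh `h` through `z₀`. -/
def gridPoint (z₀ : ℂ) (h : ℝ) (a b : ℤ) : ℂ := z₀ + h * (a + b * Complex.I)

/-- The closed grid square with lower left corner `z₀ + h (a + i b)`. -/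
def gridSquare (z₀ : ℂ) (h : ℝ) (c : ℤ × ℤ) : Set ℂ :=
  {z | (gridPoint z₀ h c.1 c.2).re ≤ z.re ∧ z.re ≤ (gridPoint z₀ h (c.1 + 1) c.2).re ∧
    (gridPoint z₀ h c.1 c.2).im ≤ z.im ∧ z.im ≤ (gridPoint z₀ h c.1 (c.2 + 1)).im}

/-- The compact polygonal region formed by finitely many grid squares. -/
def gridRegion (z₀ : ℂ) (h : ℝ) (F : Finset (ℤ × ℤ)) : Set ℂ := ⋃ c ∈ F, gridSquare z₀ h c

/-- The integral of `g` along the oriented segment from `z` to `w`. -/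
def segmentIntegral {E : Type*} [NormedAddCommGroup E] [NormedSpace ℂ E] (g : ℂ → E)
    (z w : ℂ) : E :=
  (w - z) • ∫ t in (0 : ℝ)..1, g (z + t * (w - z))

open Classical in
/-- The integral of `g` along the positively oriented boundary of the region formed by the grid
squares in `F`: the edges that belong to exactly one square of `F` are run through
counterclockwise as seen from that square. -/
def boundaryIntegral {E : Type*} [NormedAddCommGroup E] [NormedSpace ℂ E] (g : ℂ → E)
    (z₀ : ℂ) (h : ℝ) (F : Finset (ℤ × ℤ)) : E :=
  ∑ c ∈ F,
    ((if (c.1, c.2 - 1) ∈ F then 0 else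
        segmentIntegral g (gridPoint z₀ h c.1 c.2) (gridPoint z₀ h (c.1 + 1) c.2)) +
      (if (c.1 + 1, c.2) ∈ F then 0 else
        segmentIntegral g (gridPoint z₀ h (c.1 + 1) c.2) (gridPoint z₀ h (c.1 + 1) (c.2 + 1))) +
      (if (c.1, c.2 + 1) ∈ F then 0 else
        segmentIntegral g (gridPoint z₀ h (c.1 + 1) (c.2 + 1)) (gridPoint z₀ h c.1 (c.2 + 1))) +
      (if (c.1 - 1, c.2) ∈ F then 0 else
        segmentIntegral g (gridPoint z₀ h c.1 (c.2 + 1)) (gridPoint z₀ h c.1 c.2)))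

/-- The boundary of the grid region surrounds `K` inside `U`. -/
def Surrounds (K U : Set ℂ) (z₀ : ℂ) (h : ℝ) (F : Finset (ℤ × ℤ)) : Prop :=
  0 < h ∧ K ⊆ interior (gridRegion z₀ h F) ∧ gridRegion z₀ h F ⊆ U

/-- Contours as above exist around every compact set inside every neighbourhood of it. -/
theorem exists_surrounds {K U : Set ℂ} (hK : IsCompact K) (hU : IsOpen U) (hKU : K ⊆ U) :
    ∃ (z₀ : ℂ) (h : ℝ) (F : Finset (ℤ × ℤ)), Surrounds K U z₀ h F := by
  classical
  obtain ⟨δ, hδ, hsub⟩ := hK.exists_thickening_subset_open hU hKU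
  obtain ⟨M, hM⟩ := hK.isBounded.exists_norm_le
  have hh : 0 < δ / 4 := by linarith
  generalize hhd : δ / 4 = h at hh
  have hre : ∀ a b : ℤ, (gridPoint 0 h a b).re = h * a := by intro a b; simp [gridPoint]
  have him : ∀ a b : ℤ, (gridPoint 0 h a b).im = h * b := by intro a b; simp [gridPoint]
  let L : ℤ := ⌈(M + δ) / h⌉ + 1
  have hL : M + δ ≤ h * ((L : ℝ) - 1) := by
    have h1 := Int.le_ceil ((M + δ) / h)
    have h2 : ((L : ℝ) - 1) = (⌈(M + δ) / h⌉ : ℝ) := by simp [L]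
    rw [h2]
    rwa [div_le_iff₀' hh] at h1
  refine ⟨0, h, (Finset.Icc (-L) L ×ˢ Finset.Icc (-L) L).filter
    (fun c => (gridSquare 0 h c ∩ Metric.thickening (δ / 2) K).Nonempty), hh, ?_, ?_⟩
  · have hKt : K ⊆ Metric.thickening (δ / 2) K := Metric.self_subset_thickening (by linarith) K
    refine hKt.trans (interior_maximal ?_ Metric.isOpen_thickening)
    intro w hw
    obtain ⟨z, hz, hwz⟩ := Metric.mem_thickening_iff.1 hw
    have hwn : ‖w‖ ≤ M + δ := by
      have h1 := hM z hz
      have h2 : ‖w‖ ≤ ‖z‖ + ‖w - z‖ := norm_le_norm_add_norm_sub' w z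
      rw [dist_eq_norm] at hwz
      linarith
    have hwre := (Complex.abs_re_le_norm w).trans hwn
    have hwim := (Complex.abs_im_le_norm w).trans hwn
    have key : ∀ t : ℝ, |t| ≤ M + δ → h * (⌊t / h⌋ : ℝ) ≤ t ∧ t ≤ h * (⌊t / h⌋ + 1 : ℝ) ∧
        ⌊t / h⌋ ∈ Finset.Icc (-L) L := by
      intro t ht
      have h1 := Int.floor_le (t / h)
      have h2 := (Int.lt_floor_add_one (t / h)).le
      rw [le_div_iff₀' hh] at h1
      rw [div_le_iff₀' hh] at h2
      obtain ⟨h3, h4⟩ := abs_le.1 ht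
      refine ⟨h1, h2, Finset.mem_Icc.2 ⟨?_, ?_⟩⟩
      · have h5 : h * (-((L : ℝ) - 1)) ≤ h * (⌊t / h⌋ + 1 : ℝ) := by linarith
        have h6 := le_of_mul_le_mul_left h5 hh
        have h7 : (-(L : ℝ)) ≤ (⌊t / h⌋ : ℝ) := by linarith
        exact_mod_cast h7
      · have h5 : h * (⌊t / h⌋ : ℝ) ≤ h * ((L : ℝ) - 1) := by linarith
        have h6 := le_of_mul_le_mul_left h5 hh
        have h7 : (⌊t / h⌋ : ℝ) ≤ (L : ℝ) := by linarith
        exact_mod_cast h7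
    obtain ⟨r1, r2, r3⟩ := key _ hwre
    obtain ⟨i1, i2, i3⟩ := key _ hwim
    have hsq : w ∈ gridSquare 0 h (⌊w.re / h⌋, ⌊w.im / h⌋) := by
      refine ⟨?_, ?_, ?_, ?_⟩
      · rw [hre]; exact r1
      · rw [hre]; push_cast; exact r2
      · rw [him]; exact i1
      · rw [him]; push_cast; exact i2
    refine Set.mem_iUnion₂.2 ⟨(⌊w.re / h⌋, ⌊w.im / h⌋), ?_, hsq⟩
    exact Finset.mem_filter.2 ⟨Finset.mem_product.2 ⟨r3, i3⟩, ⟨w, hsq, hw⟩⟩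
  · intro w hw
    obtain ⟨c, hc, hwc⟩ := Set.mem_iUnion₂.1 hw
    obtain ⟨v, hvc, hv⟩ := (Finset.mem_filter.1 hc).2
    obtain ⟨z, hz, hvz⟩ := Metric.mem_thickening_iff.1 hv
    refine hsub (Metric.mem_thickening_iff.2 ⟨z, hz, ?_⟩)
    obtain ⟨w1, w2, w3, w4⟩ := hwc
    obtain ⟨v1, v2, v3, v4⟩ := hvc
    rw [hre] at w1 w2 v1 v2
    rw [him] at w3 w4 v3 v4
    push_cast at w2 w4 v2 v4
    have hwv : dist w v ≤ 2 * h := by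
      rw [dist_eq_norm]
      refine (Complex.norm_le_abs_re_add_abs_im _).trans ?_
      rw [Complex.sub_re, Complex.sub_im]
      have h1 : |w.re - v.re| ≤ h := abs_le.2 ⟨by linarith, by linarith⟩
      have h2 : |w.im - v.im| ≤ h := abs_le.2 ⟨by linarith, by linarith⟩
      linarith
    have := dist_triangle w v z
    linarith

/-- `Y = f(X)` in the sense of the holomorphic functional calculus of the algebra of
`m × m`-matrices over a Banach algebra `R`: the function `f` is holomorphic on the open
neighbourhood `U` of the spectrum of `X`, and `Y` is the (entrywise) integral
`(2πi)⁻¹ ∫_Γ f(z) (z - X)⁻¹ dz` over a positively oriented contour `Γ` that surrounds the spectrum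
inside `U`. -/
def IsHolomorphicFunctionOf {R : Type*} [NormedRing R] [NormedAlgebra ℂ R] {m : ℕ}
    (f : ℂ → ℂ) (U : Set ℂ) (X Y : Matrix (Fin m) (Fin m) R) : Prop :=
  IsOpen U ∧ DifferentiableOn ℂ f U ∧ ∃ (z₀ : ℂ) (h : ℝ) (F : Finset (ℤ × ℤ)),
    Surrounds (spectrum ℂ X) U z₀ h F ∧
    ∀ i j, Y i j = (2 * Real.pi * Complex.I : ℂ)⁻¹ •
      boundaryIntegral (fun z => f z • resolvent X z i j) z₀ h F

/-- `M_m(B)` is stable under the holomorphic functional calculus of `M_m(R)`: if `X ∈ M_m(B)` and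
`f` is holomorphic in a neighbourhood of the spectrum of `X`, with `f(0) = 0` when `B` does not
contain the unit of `R`, then `f(X) ∈ M_m(B)`. -/
def StableHolomorphic {R : Type*} [NormedRing R] [NormedAlgebra ℂ R] (B : Set R) (m : ℕ) : Prop :=
  ∀ (X Y : Matrix (Fin m) (Fin m) R) (f : ℂ → ℂ) (U : Set ℂ), X ∈ matricesOver B m →
    IsHolomorphicFunctionOf f U X Y → ((1 : R) ∈ B ∨ f 0 = 0) → Y ∈ matricesOver B m

end WeightIntegration

end

/-!
Everything rests on two facts: multiplication by `N` from the middle preserves the algebras, and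
the unbounded commutator with `|D|` can be written as an identity between bounded operators.

*Square-integrable elements.* With `b = (1 + D²)⁻¹` and `c = b^(s/4) ∈ N`, the number
`φ_s(T* T) = τ((T c)* (T c))` is the square of an `L²`-norm of `T c`. It satisfies the triangle
inequality, `φ_s((X T)* (X T)) ≤ ‖X‖² φ_s(T* T)`, it decreases in `s` because `b ≤ 1`, and it is
lower semicontinuous for the operator norm because `τ` is normal. Hence `Q_n` is a norm, `B₂` is
complete, and `B₂ N B₂ ⊆ B₂` with `Q_n(R X S) ≤ ‖X‖ Q_n(R) Q_n(S)` for `X ∈ N`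
(`normQ_mul_mul_le`, `frechetData_B2`).

*Integrable elements.* The seminorms `P_n` on `B₂²` dominate the operator norm and satisfy
`P_n(S X T) ≤ ‖X‖ P_n(S) P_n(T)` for `X ∈ N` (`isProjective`). So `B₁ N B₁ ⊆ B₁`. The injectivity of
the map from the completion to `N` is not needed: an operator that is the limit of several Cauchy
sequences gets the infimum of their norms, and the space so obtained is a quotient of the completion
by a closed subspace, in which absolutely convergent series converge (`exists_limit_B1`).

*Derivatives.* For `K = (1 + ε |D|)⁻¹` the relation `S = [|D|, T]` is equivalent to the identity
`T K - K T = ε K S K` between bounded operators (`isDelta_iff`). It gives at once that `δ` is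
linear, is a derivation, is compatible with adjoints and is closed; and, for `ε` so small that the
perturbations `X + ε δ(X) K` and `X - ε K δ(X)` of an invertible matrix `X` remain invertible, that
`X⁻¹` is in the domain of `δ` with `δ(X⁻¹) = -X⁻¹ δ(X) X⁻¹`.

*Functional calculus.* Resolvents of matrices over `N` have entries in `N` by the double commutant
property. If `1 ∉ B₁`, then `0` is in the spectrum of every matrix `X` over `B₁`, since an
invertible `X` would give `1 = X X⁻² X`, with entries in `B₁ N B₁`. So `0` lies inside the contour,
and in `f(z) (z - X)⁻¹ = f(z)/z + f(z)/z² X + X (f(z)/z² (z - X)⁻¹) X` the first term has the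
integral `0` by Cauchy's theorem, while the other two have integrals with entries in `B₁`. For the
derivatives, `f` applied to the block matrix `[[X, δ(X)], [0, X]]` has the off-diagonal block
`δ(f(X))`, so an induction on `l`, in which the size of the matrix doubles at each step, settles
`B₁ˡ` for finite `l` (`IsProjective.boundaryIntegral_resolvent_mem_B1Smooth`), and `B₁^∞` is the
intersection of these.
-/

open Filter Topology MeasureTheory
open scoped ENNReal NNReal InnerProductSpace

namespace WeightIntegration

/-! ### Fréchet `*`-algebras presented by seminorm inequalities -/

section Frechet

variable {R : Type*} [Ring R] [StarRing R] [Algebra ℂ R]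

/-- The inequalities and the sequential completeness that make a subset `B` of the complex
`*`-algebra `R` a Fréchet `*`-subalgebra for the functions `q i`. Only the values of `q i` on `B`
matter. -/
structure FrechetData (B : Set R) {ι : Type*} (q : ι → R → ℝ) : Prop where
  zero_mem : (0 : R) ∈ B
  add_mem : ∀ x ∈ B, ∀ y ∈ B, x + y ∈ B
  smul_mem : ∀ (c : ℂ), ∀ x ∈ B, c • x ∈ B
  mul_mem : ∀ x ∈ B, ∀ y ∈ B, x * y ∈ B
  star_mem : ∀ x ∈ B, star x ∈ B
  q_add : ∀ i, ∀ x ∈ B, ∀ y ∈ B, q i (x + y) ≤ q i x + q i y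
  q_smul : ∀ i, ∀ (c : ℂ), ∀ x ∈ B, q i (c • x) = ‖c‖ * q i x
  q_star : ∀ i, ∀ x ∈ B, q i (star x) ≤ q i x
  q_mul : ∀ i, ∃ C : ℝ, ∀ x ∈ B, ∀ y ∈ B, q i (x * y) ≤ C * q i x * q i y
  sep : ∀ x ∈ B, (∀ i, q i x = 0) → x = 0
  complete : ∀ u : ℕ → R, (∀ k, u k ∈ B) →
    (∀ i, ∀ ε > 0, ∃ K, ∀ a ≥ K, ∀ b ≥ K, q i (u a - u b) < ε) →
    ∃ x ∈ B, ∀ i, ∀ ε > 0, ∃ K, ∀ a ≥ K, q i (u a - x) < ε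

namespace FrechetData

variable {B : Set R} {ι : Type*} {q : ι → R → ℝ}

theorem neg_mem (h : FrechetData B q) {x : R} (hx : x ∈ B) : -x ∈ B := by
  simpa using h.smul_mem (-1) x hx

theorem sub_mem (h : FrechetData B q) {x y : R} (hx : x ∈ B) (hy : y ∈ B) : x - y ∈ B := by
  rw [sub_eq_add_neg]; exact h.add_mem _ hx _ (h.neg_mem hy)

theorem q_zero (h : FrechetData B q) (i : ι) : q i 0 = 0 := by
  simpa using h.q_smul i 0 0 h.zero_mem

theorem q_neg (h : FrechetData B q) (i : ι) {x : R} (hx : x ∈ B) : q i (-x) = q i x := by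
  simpa using h.q_smul i (-1) x hx

theorem q_nonneg (h : FrechetData B q) (i : ι) {x : R} (hx : x ∈ B) : 0 ≤ q i x := by
  have h1 := h.q_add i x hx (-x) (h.neg_mem hx)
  rw [h.q_neg i hx, add_neg_cancel, h.q_zero] at h1
  linarith

theorem sum_mem (h : FrechetData B q) {κ : Type*} (s : Finset κ) {f : κ → R}
    (hf : ∀ k ∈ s, f k ∈ B) : ∑ k ∈ s, f k ∈ B :=
  Finset.sum_induction f (· ∈ B) (fun a b ha hb => h.add_mem a ha b hb) h.zero_mem hf

theorem q_sum (h : FrechetData B q) (i : ι) {κ : Type*} (s : Finset κ) {f : κ → R}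
    (hf : ∀ k ∈ s, f k ∈ B) : q i (∑ k ∈ s, f k) ≤ ∑ k ∈ s, q i (f k) := by
  classical
  induction s using Finset.induction_on with
  | empty => simp [h.q_zero]
  | insert a s ha ih =>
    rw [Finset.sum_insert ha, Finset.sum_insert ha]
    have h1 := ih fun k hk => hf k (Finset.mem_insert_of_mem hk)
    have h2 := h.q_add i _ (hf a (Finset.mem_insert_self a s)) _
      (h.sum_mem s fun k hk => hf k (Finset.mem_insert_of_mem hk))
    linarith

theorem exists_nonneg_mul_bound (h : FrechetData B q) (i : ι) :
    ∃ C : ℝ, 0 ≤ C ∧ ∀ x ∈ B, ∀ y ∈ B, q i (x * y) ≤ C * q i x * q i y := by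
  obtain ⟨C, hC⟩ := h.q_mul i
  refine ⟨|C|, abs_nonneg C, fun x hx y hy => (hC x hx y hy).trans ?_⟩
  have h1 := h.q_nonneg i hx
  have h2 := h.q_nonneg i hy
  gcongr
  exact le_abs_self C

/-- The `*`-subalgebra with carrier `B`. -/
noncomputable def subalgebra (h : FrechetData B q) : NonUnitalStarSubalgebra ℂ R where
  carrier := B
  zero_mem' := h.zero_mem
  add_mem' := fun ha hb => h.add_mem _ ha _ hb
  mul_mem' := fun ha hb => h.mul_mem _ ha _ hb
  smul_mem' := fun c x hx => h.smul_mem c x hx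
  star_mem' := fun ha => h.star_mem _ ha

/-- The functions `q i` as seminorms on the `*`-subalgebra `B`. -/
noncomputable def seminorms (h : FrechetData B q) : SeminormFamily ℂ h.subalgebra ι := fun i =>
  Seminorm.of (fun x => q i (x : R)) (fun x y => h.q_add i _ x.2 _ y.2)
    (fun c x => h.q_smul i c _ x.2)

theorem isFrechetStarSubalgebra [Nonempty ι] [Countable ι] (h : FrechetData B q) :
    IsFrechetStarSubalgebra B q := by
  refine ⟨h.subalgebra, rfl, inferInstance, h.seminorms, ?_⟩
  let A := h.subalgebra
  let s := h.seminorms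
  have hs : ∀ i (x : A), s i x = q i (x : R) := fun i x => rfl
  let t : TopologicalSpace A := s.moduleFilterBasis.topology
  have hw : WithSeminorms s := ⟨rfl⟩
  have htag : IsTopologicalAddGroup A := hw.topologicalAddGroup
  let U : UniformSpace A := IsTopologicalAddGroup.rightUniformSpace A
  have hua : IsUniformAddGroup A := isUniformAddGroup_of_addCommGroup
  have hT1 : T1Space A := hw.T1_of_separating fun x hx => by
    by_contra! hc
    exact hx (Subtype.ext (h.sep x x.2 hc))
  have hfc : FirstCountableTopology A := hw.firstCountableTopology
  have hcg : (uniformity A).IsCountablyGenerated := IsUniformAddGroup.uniformity_countably_generated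
  refine ⟨U, fun _ _ => rfl, hua, hw, inferInstance, ?_, ⟨?_⟩, ⟨?_⟩, fun i => ?_⟩
  · refine UniformSpace.complete_of_cauchySeq_tendsto fun u hu => ?_
    obtain ⟨x, hx, hux⟩ := h.complete (fun k => (u k : R)) (fun k => (u k).2) fun i ε hε => by
      have h1 : Tendsto (fun k : ℕ × ℕ => u k.2 - u k.1) atTop (𝓝 0) := by
        have h2 : Tendsto (Prod.map u u) atTop (uniformity A) := cauchySeq_iff_tendsto.1 hu
        rw [uniformity_eq_comap_nhds_zero, tendsto_comap_iff] at h2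
        exact h2
      have h3 := (hw.tendsto_nhds _ _).1 h1 i ε hε
      obtain ⟨⟨K₁, K₂⟩, hK⟩ := eventually_atTop.1 h3
      refine ⟨max K₁ K₂, fun a ha b hb => ?_⟩
      have h4 := hK (b, a) ⟨(le_max_left _ _).trans hb, (le_max_right _ _).trans ha⟩
      simpa [hs] using h4
    exact ⟨⟨x, hx⟩, (hw.tendsto_nhds_atTop _ _).2 hux⟩
  · refine continuous_iff_continuousAt.2 fun ⟨x, y⟩ => ?_
    refine (hw.tendsto_nhds _ _).2 fun i ε hε => ?_
    obtain ⟨C, hC0, hC⟩ := h.exists_nonneg_mul_bound i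
    have hc : Continuous (s i) := hw.continuous_seminorm i
    have h1 : Tendsto (fun z : A × A => C * s i (z.1 - x) * s i z.2 + C * s i x * s i (z.2 - y))
        (𝓝 (x, y)) (𝓝 (C * s i (x - x) * s i y + C * s i x * s i (y - y))) := by
      apply Continuous.tendsto (x := (x, y))
        (f := fun z : A × A => C * s i (z.1 - x) * s i z.2 + C * s i x * s i (z.2 - y))
      fun_prop
    rw [sub_self, sub_self, map_zero, mul_zero, zero_mul, mul_zero, add_zero] at h1
    filter_upwards [h1.eventually (gt_mem_nhds hε)] with z hz
    refine lt_of_le_of_lt ?_ hz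
    have h2 : z.1 * z.2 - x * y = (z.1 - x) * z.2 + x * (z.2 - y) := by
      rw [sub_mul, mul_sub, sub_add_sub_cancel]
    rw [h2]
    refine (map_add_le_add (s i) _ _).trans (add_le_add ?_ ?_)
    · exact hC _ (z.1 - x).2 _ z.2.2
    · exact hC _ x.2 _ (z.2 - y).2
  · refine continuous_iff_continuousAt.2 fun x => ?_
    refine (hw.tendsto_nhds _ _).2 fun i ε hε => ?_
    have hc : Continuous (s i) := hw.continuous_seminorm i
    have h1 : Tendsto (fun z : A => s i (z - x)) (𝓝 x) (𝓝 (s i (x - x))) :=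
      Continuous.tendsto (f := fun z : A => s i (z - x)) (by fun_prop) x
    rw [sub_self, map_zero] at h1
    filter_upwards [h1.eventually (gt_mem_nhds hε)] with z hz
    rw [← star_sub]
    exact (h.q_star i _ (z - x).2).trans_lt hz
  · obtain ⟨C, hC⟩ := h.q_mul i
    exact ⟨C, fun x y => hC x x.2 y y.2⟩

/-- Matrices over a Fréchet `*`-algebra form a Fréchet `*`-algebra. -/
theorem matricesOver (h : FrechetData B q) (m : ℕ) :
    FrechetData (matricesOver B m) (matrixSeminorm q m) where
  zero_mem := fun _ _ => h.zero_mem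
  add_mem := fun x hx y hy i j => h.add_mem _ (hx i j) _ (hy i j)
  smul_mem := fun c x hx i j => h.smul_mem c _ (hx i j)
  mul_mem := fun x hx y hy i j => by
    rw [Matrix.mul_apply]
    exact h.sum_mem _ fun k _ => h.mul_mem _ (hx i k) _ (hy k j)
  star_mem := fun x hx i j => h.star_mem _ (hx j i)
  q_add := fun i x hx y hy => by
    simp only [matrixSeminorm, ← Finset.sum_add_distrib]
    exact Finset.sum_le_sum fun a _ => Finset.sum_le_sum fun b _ =>
      h.q_add i _ (hx a b) _ (hy a b)
  q_smul := fun i c x hx => by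
    simp only [matrixSeminorm, Finset.mul_sum]
    exact Finset.sum_congr rfl fun a _ => Finset.sum_congr rfl fun b _ =>
      h.q_smul i c _ (hx a b)
  q_star := fun i x hx => by
    simp only [matrixSeminorm]
    rw [Finset.sum_comm]
    exact Finset.sum_le_sum fun a _ => Finset.sum_le_sum fun b _ => h.q_star i _ (hx a b)
  q_mul := fun i => by
    obtain ⟨C, hC0, hC⟩ := h.exists_nonneg_mul_bound i
    refine ⟨C, fun x hx y hy => ?_⟩
    simp only [matrixSeminorm]
    -- The rows and columns that occur on the left are among those on the right.
    have h1 : ∀ a b, q i ((x * y) a b) ≤ ∑ c, C * q i (x a c) * ∑ d, q i (y d b) := by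
      intro a b
      rw [Matrix.mul_apply]
      refine (h.q_sum i _ fun k _ => h.mul_mem _ (hx a k) _ (hy k b)).trans ?_
      refine Finset.sum_le_sum fun c _ => (hC _ (hx a c) _ (hy c b)).trans ?_
      refine mul_le_mul_of_nonneg_left ?_ (mul_nonneg hC0 (h.q_nonneg i (hx a c)))
      exact Finset.single_le_sum (f := fun d => q i (y d b))
        (fun d _ => h.q_nonneg i (hy d b)) (Finset.mem_univ c)
    refine (Finset.sum_le_sum fun a _ => Finset.sum_le_sum fun b _ => h1 a b).trans (le_of_eq ?_)
    simp only [← Finset.sum_mul, ← Finset.mul_sum]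
    rw [Finset.sum_comm (f := fun d b => q i (y d b))]
  sep := fun x hx h0 => by
    ext a b
    refine h.sep _ (hx a b) fun i => ?_
    have h1 := h0 i
    simp only [matrixSeminorm] at h1
    have h2 := (Finset.sum_eq_zero_iff_of_nonneg fun a _ => Finset.sum_nonneg fun b _ =>
      h.q_nonneg i (hx a b)).1 h1 a (Finset.mem_univ a)
    exact (Finset.sum_eq_zero_iff_of_nonneg fun b _ => h.q_nonneg i (hx a b)).1 h2 b
      (Finset.mem_univ b)
  complete := fun u hu hc => by
    have hle : ∀ i (x : Matrix (Fin m) (Fin m) R), (∀ a b, x a b ∈ B) → ∀ a b,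
        q i (x a b) ≤ matrixSeminorm q m i x := by
      intro i x hx a b
      simp only [matrixSeminorm]
      exact (Finset.single_le_sum (f := fun d => q i (x a d))
        (fun d _ => h.q_nonneg i (hx a d)) (Finset.mem_univ b)).trans
        (Finset.single_le_sum (f := fun a => ∑ d, q i (x a d))
          (fun a _ => Finset.sum_nonneg fun d _ => h.q_nonneg i (hx a d)) (Finset.mem_univ a))
    have h1 : ∀ a b, ∃ x ∈ B, ∀ i, ∀ ε > 0, ∃ K, ∀ k ≥ K, q i (u k a b - x) < ε := fun a b =>
      h.complete (fun k => u k a b) (fun k => hu k a b) fun i ε hε => by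
        obtain ⟨K, hK⟩ := hc i ε hε
        exact ⟨K, fun k hk k' hk' => (hle i (u k - u k')
          (fun a b => h.sub_mem (hu k a b) (hu k' a b)) a b).trans_lt (hK k hk k' hk')⟩
    choose x hx hxu using h1
    refine ⟨Matrix.of x, hx, fun i ε hε => ?_⟩
    have h2 : Tendsto (fun k => matrixSeminorm q m i (u k - Matrix.of x)) atTop (𝓝 (∑ _a : Fin m,
        ∑ _b : Fin m, (0 : ℝ))) := by
      refine tendsto_finsetSum _ fun a _ => tendsto_finsetSum _ fun b _ => ?_
      refine Metric.tendsto_atTop.2 fun ε hε => ?_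
      obtain ⟨K, hK⟩ := hxu a b i ε hε
      refine ⟨K, fun k hk => ?_⟩
      rw [Real.dist_0_eq_abs, abs_of_nonneg]
      · exact hK k hk
      · exact h.q_nonneg i (h.sub_mem (hu k a b) (hx a b))
    simp only [Finset.sum_const_zero] at h2
    exact eventually_atTop.1 (h2.eventually (gt_mem_nhds hε))

end FrechetData

end Frechet

/-! ### Von Neumann algebras: inverses, functional calculus, norm limits -/

section VonNeumann

variable {H : Type*} [NormedAddCommGroup H] [InnerProductSpace ℂ H] [CompleteSpace H]

theorem mem_of_forall_commute {N : VonNeumannAlgebra H} {x : H →L[ℂ] H}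
    (h : ∀ z ∈ N.commutant, Commute z x) : x ∈ N := by
  rw [← N.commutant_commutant, VonNeumannAlgebra.mem_commutant_iff]
  exact fun z hz => h z hz

theorem commute_of_mem_commutant {N : VonNeumannAlgebra H} {x z : H →L[ℂ] H} (hx : x ∈ N)
    (hz : z ∈ N.commutant) : Commute z x :=
  (VonNeumannAlgebra.mem_commutant_iff.1 hz x hx).symm

theorem smul_mem_vonNeumann {N : VonNeumannAlgebra H} (c : ℂ) {x : H →L[ℂ] H} (hx : x ∈ N) :
    c • x ∈ N :=
  N.toStarSubalgebra.smul_mem hx c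

theorem real_smul_mem_vonNeumann {N : VonNeumannAlgebra H} (c : ℝ) {x : H →L[ℂ] H} (hx : x ∈ N) :
    c • x ∈ N := by
  rw [← Complex.coe_smul]
  exact smul_mem_vonNeumann _ hx

theorem cfc_mem_vonNeumann {N : VonNeumannAlgebra H} {a : H →L[ℂ] H} (ha : a ∈ N) (f : ℝ → ℝ) :
    cfc f a ∈ N :=
  mem_of_forall_commute fun _ hz => ((commute_of_mem_commutant ha hz).symm.cfc_real f).symm

theorem isClosed_vonNeumann (N : VonNeumannAlgebra H) : IsClosed (N : Set (H →L[ℂ] H)) := by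
  rw [← N.centralizer_centralizer]
  exact Set.isClosed_centralizer _

/-- A von Neumann algebra is spanned by its unitaries, so an operator that commutes with the
unitaries of the commutant belongs to the algebra. -/
theorem mem_of_forall_unitary_commute {N : VonNeumannAlgebra H} {x : H →L[ℂ] H}
    (h : ∀ u ∈ N.commutant, u ∈ unitary (H →L[ℂ] H) → Commute u x) : x ∈ N := by
  have h1 : ∀ a ∈ N.commutant, IsSelfAdjoint a → ‖a‖ ≤ 1 → Commute a x := by
    intro a ha hsa hn
    have hs : CFC.sqrt (1 - a ^ 2) ∈ N.commutant := by
      have hp : 0 ≤ 1 - a ^ 2 := by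
        rwa [sub_nonneg, ← CStarAlgebra.norm_le_one_iff_of_nonneg (a ^ 2) (by
          simpa [sq, hsa.star_eq] using star_mul_self_nonneg a), sq, hsa.norm_mul_self,
          sq_le_one_iff₀ (by positivity)]
      rw [CFC.sqrt_eq_real_sqrt _ hp, cfcₙ_eq_cfc (hf0 := Real.sqrt_zero)]
      exact cfc_mem_vonNeumann (sub_mem (one_mem _) (pow_mem ha 2)) _
    have hu := hsa.self_add_I_smul_cfcSqrt_sub_sq_mem_unitary a hn
    set u := a + Complex.I • CFC.sqrt (1 - a ^ 2) with hu_def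
    have hum : u ∈ N.commutant := add_mem ha (smul_mem_vonNeumann _ hs)
    have c1 := h u hum hu
    have c2 := h (star u) (star_mem hum) (Unitary.star_mem hu)
    have hre : a = (2⁻¹ : ℂ) • (u + star u) := by
      have hsq : star (CFC.sqrt (1 - a ^ 2)) = CFC.sqrt (1 - a ^ 2) :=
        (IsSelfAdjoint.of_nonneg (CFC.sqrt_nonneg _)).star_eq
      rw [hu_def, star_add, star_smul, hsq, hsa.star_eq]
      simp only [RCLike.star_def, Complex.conj_I, neg_smul]
      rw [add_add_add_comm, add_neg_cancel, add_zero, ← two_smul ℂ a, smul_smul]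
      simp
    rw [hre]
    exact (c1.add_left c2).smul_left _
  have h2 : ∀ a ∈ N.commutant, IsSelfAdjoint a → Commute a x := by
    intro a ha hsa
    by_cases h0 : ‖a‖ = 0
    · rw [norm_eq_zero.1 h0]; exact Commute.zero_left _
    have h3 := h1 (((‖a‖⁻¹ : ℝ) : ℂ) • a) (smul_mem_vonNeumann _ ha)
      (by rw [Complex.coe_smul]; exact (IsSelfAdjoint.all _).smul hsa)
      (by rw [norm_smul]; simp [h0])
    have h4 : a = (‖a‖ : ℂ) • (((‖a‖⁻¹ : ℝ) : ℂ) • a) := by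
      rw [smul_smul, ← Complex.ofReal_mul, mul_inv_cancel₀ h0]; simp
    rw [h4]; exact h3.smul_left _
  refine mem_of_forall_commute fun z hz => ?_
  have h3 := h2 (z + star z) (add_mem hz (star_mem hz)) (IsSelfAdjoint.add_star_self z)
  have h4 := h2 (Complex.I • (z - star z))
    (smul_mem_vonNeumann _ (sub_mem hz (star_mem hz))) (by
      rw [isSelfAdjoint_iff, star_smul, star_sub, star_star]
      simp only [RCLike.star_def, Complex.conj_I, neg_smul, ← smul_neg, neg_sub])
  have h5 : z = (2⁻¹ : ℂ) • ((z + star z) - Complex.I • (Complex.I • (z - star z))) := by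
    rw [smul_smul, Complex.I_mul_I, neg_one_smul, sub_neg_eq_add, add_add_sub_cancel,
      ← two_smul ℂ z, smul_smul]
    simp
  rw [h5]
  exact (h3.sub_left (h4.smul_left _)).smul_left _

end VonNeumann

/-! ### Traces: monotonicity, Minkowski's inequality, lower semicontinuity -/

namespace IsFaithfulNormalSemifiniteTrace

variable {H : Type*} [NormedAddCommGroup H] [InnerProductSpace ℂ H] [CompleteSpace H]
variable {N : VonNeumannAlgebra H} {τ : (H →L[ℂ] H) → ℝ≥0∞}

theorem mono (hτ : IsFaithfulNormalSemifiniteTrace N τ) {S T : H →L[ℂ] H} (hS : S ∈ N) (hT : T ∈ N)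
    (h0 : 0 ≤ S) (h : S ≤ T) : τ S ≤ τ T := by
  have h1 := hτ.add S hS (T - S) (sub_mem hT hS) h0 (sub_nonneg.2 h)
  rw [add_sub_cancel] at h1
  rw [h1]
  exact le_self_add

theorem real_smul (hτ : IsFaithfulNormalSemifiniteTrace N τ) {r : ℝ} (hr : 0 ≤ r)
    {T : H →L[ℂ] H} (hT : T ∈ N) (h0 : 0 ≤ T) : τ (r • T) = ENNReal.ofReal r * τ T := by
  have h1 := hτ.smul ⟨r, hr⟩ T hT h0
  have h2 : (((⟨r, hr⟩ : ℝ≥0) : ℝ) : ℂ) • T = r • T := Complex.coe_smul r T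
  rw [ENNReal.ofReal_eq_coe_nnreal hr, ← h2]
  exact h1

/-- `τ(((1 + t)a + (1 + 1/t)b))` bounds `τ|x + y|²`, where `a = |x|²` and `b = |y|²`. Optimising
over `t > 0` gives Minkowski's inequality. -/
theorem sq_add_le (hτ : IsFaithfulNormalSemifiniteTrace N τ) {x y : H →L[ℂ] H} (hx : x ∈ N)
    (hy : y ∈ N) {t : ℝ} (ht : 0 < t) : τ (star (x + y) * (x + y)) ≤
      ENNReal.ofReal (1 + t) * τ (star x * x) + ENNReal.ofReal (1 + t⁻¹) * τ (star y * y) := by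
  have hxx : star x * x ∈ N := mul_mem (star_mem hx) hx
  have hyy : star y * y ∈ N := mul_mem (star_mem hy) hy
  have h1 : 0 < 1 + t := by positivity
  have h2 : 0 < 1 + t⁻¹ := by positivity
  rw [← hτ.real_smul h1.le hxx (star_mul_self_nonneg x),
    ← hτ.real_smul h2.le hyy (star_mul_self_nonneg y),
    ← hτ.add _ (real_smul_mem_vonNeumann _ hxx) _ (real_smul_mem_vonNeumann _ hyy)
      (smul_nonneg h1.le (star_mul_self_nonneg x)) (smul_nonneg h2.le (star_mul_self_nonneg y))]
  refine hτ.mono (mul_mem (star_mem (add_mem hx hy)) (add_mem hx hy))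
    (add_mem (real_smul_mem_vonNeumann _ hxx) (real_smul_mem_vonNeumann _ hyy))
    (star_mul_self_nonneg _) ?_
  have h3 : 0 ≤ t • (star (x - t⁻¹ • y) * (x - t⁻¹ • y)) :=
    smul_nonneg ht.le (star_mul_self_nonneg _)
  have h4 : (1 + t) • (star x * x) + (1 + t⁻¹) • (star y * y) - star (x + y) * (x + y) =
      t • (star (x - t⁻¹ • y) * (x - t⁻¹ • y)) := by
    simp only [star_add, star_sub, star_smul, star_trivial, add_mul, mul_add, sub_mul, mul_sub,
      smul_mul_assoc, mul_smul_comm, smul_sub, add_smul, one_smul, smul_smul,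
      mul_inv_cancel₀ ht.ne', mul_inv_cancel_left₀ ht.ne']
    abel
  rw [← sub_nonneg, h4]
  exact h3

theorem sq_smul (hτ : IsFaithfulNormalSemifiniteTrace N τ) (c : ℂ) {x : H →L[ℂ] H} (hx : x ∈ N) :
    τ (star (c • x) * (c • x)) = ENNReal.ofReal (‖c‖ ^ 2) * τ (star x * x) := by
  rw [← hτ.real_smul (by positivity) (mul_mem (star_mem hx) hx) (star_mul_self_nonneg x)]
  congr 1
  rw [star_smul, smul_mul_smul_comm, ← Complex.coe_smul]
  congr 1
  rw [RCLike.star_def, mul_comm, Complex.mul_conj, Complex.normSq_eq_norm_sq]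

theorem sq_mul_le (hτ : IsFaithfulNormalSemifiniteTrace N τ) {a x : H →L[ℂ] H} (ha : a ∈ N)
    (hx : x ∈ N) : τ (star (a * x) * (a * x)) ≤ ENNReal.ofReal (‖a‖ ^ 2) * τ (star x * x) := by
  have hxx : star x * x ∈ N := mul_mem (star_mem hx) hx
  rw [← hτ.real_smul (by positivity) hxx (star_mul_self_nonneg x)]
  refine hτ.mono (mul_mem (star_mem (mul_mem ha hx)) (mul_mem ha hx))
    (real_smul_mem_vonNeumann _ hxx) (star_mul_self_nonneg _) ?_
  have h1 := CStarAlgebra.star_left_conjugate_le_norm_smul (a := x) (b := star a * a)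
    (IsSelfAdjoint.star_mul_self a)
  rw [CStarRing.norm_star_mul_self, ← pow_two] at h1
  rw [star_mul]
  simpa only [mul_assoc] using h1

/-- The square root of the function `(t - δ)₊ / t`, extended by zero. -/
theorem exists_cutoff_sqrt {δ : ℝ} (hδ : 0 < δ) : ∃ g : ℝ → ℝ, Continuous g ∧
    (∀ t, g t * t * g t = max (t - δ) 0) ∧ (∀ t, g t * g t ≤ δ⁻¹ * max (t - δ) 0) ∧
    ∀ t, g t * g t ≤ 1 := by
  have hm : ∀ t : ℝ, 0 < max t δ := fun t => lt_max_of_lt_right hδ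
  have hgg : ∀ t, Real.sqrt (1 - δ / max t δ) * Real.sqrt (1 - δ / max t δ) =
      1 - δ / max t δ := fun t => by
    refine Real.mul_self_sqrt (sub_nonneg.2 ?_)
    rw [div_le_one (hm t)]
    exact le_max_right _ _
  refine ⟨fun t => Real.sqrt (1 - δ / max t δ), ?_, fun t => ?_, fun t => ?_, fun t => ?_⟩
  · refine Real.continuous_sqrt.comp (continuous_const.sub (continuous_const.div ?_ ?_))
    · fun_prop
    · exact fun t => (hm t).ne'
  · rw [mul_right_comm, hgg]
    rcases le_total t δ with h | h
    · rw [max_eq_right h, max_eq_right (by linarith), div_self hδ.ne']; ring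
    · have : t ≠ 0 := by linarith
      rw [max_eq_left h, max_eq_left (by linarith)]; field_simp
  · rw [hgg]
    rcases le_total t δ with h | h
    · rw [max_eq_right h, max_eq_right (by linarith), div_self hδ.ne']; simp
    · have h0 : 0 < t := by linarith
      rw [max_eq_left h, max_eq_left (by linarith)]
      have h1 : 1 - δ / t = t⁻¹ * (t - δ) := by field_simp
      rw [h1]
      gcongr
  · rw [hgg]
    have := hm t
    have : 0 ≤ δ / max t δ := by positivity
    linarith

/-- If `y` is within `ε < δ` of `x`, its trace dominates that of the cut-off `(x - δ)₊`, up to the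
factor `1 - ε/δ`. The cut-off equals `c x c` with `c = (1 - δ / max(x, δ))^(1/2)`. -/
theorem tau_posPart_sub_le (hτ : IsFaithfulNormalSemifiniteTrace N τ) {x y : H →L[ℂ] H}
    (hx : x ∈ N) (hy : y ∈ N) (hx0 : 0 ≤ x) (hy0 : 0 ≤ y) {δ ε : ℝ} (hδ : 0 < δ)
    (hε : ε < δ) (hxy : ‖x - y‖ ≤ ε) :
    ENNReal.ofReal (1 - ε / δ) * τ (cfc (fun t : ℝ => max (t - δ) 0) x) ≤ τ y := by
  have hε0 : 0 ≤ ε := (norm_nonneg _).trans hxy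
  have hsa : IsSelfAdjoint x := IsSelfAdjoint.of_nonneg hx0
  obtain ⟨g, hg, hgt, hg1, hg2⟩ := exists_cutoff_sqrt hδ
  set c := cfc g x with hc
  have hcN : c ∈ N := cfc_mem_vonNeumann hx g
  have hcs : star c = c := (cfc_predicate g x : IsSelfAdjoint c).star_eq
  have hcxc : c * x * c = cfc (fun t : ℝ => max (t - δ) 0) x := by
    have h1 : c * x = cfc (fun t => g t * t) x := by rw [cfc_mul .., cfc_id' ℝ x hsa]
    rw [h1, hc, ← cfc_mul ..]
    exact cfc_congr fun t _ => hgt t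
  set z := cfc (fun t : ℝ => max (t - δ) 0) x with hz
  have hzN : z ∈ N := cfc_mem_vonNeumann hx _
  have hz0 : 0 ≤ z := cfc_nonneg fun t _ => le_max_right _ _
  have hcc : c * c ≤ δ⁻¹ • z := by
    rw [hc, hz, ← cfc_mul .., ← cfc_const_mul ..]
    exact cfc_mono fun t _ => hg1 t
  have hcc1 : c * c ≤ 1 := by
    rw [hc, ← cfc_mul .., ← cfc_one ℝ x]
    refine cfc_mono fun t _ => ?_
    exact hg2 t
  -- Since `x ≤ y + ε` and `c² ≤ δ⁻¹ c x c`, one has `(1 - ε/δ) c x c ≤ c y c`.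
  have h1 : (1 - ε / δ) • z ≤ c * y * c := by
    have h2 : x ≤ y + algebraMap ℝ (H →L[ℂ] H) ε := by
      have h3 : x - y ≤ algebraMap ℝ (H →L[ℂ] H) ‖x - y‖ :=
        (hsa.sub (IsSelfAdjoint.of_nonneg hy0)).le_algebraMap_norm_self
      have h4 : algebraMap ℝ (H →L[ℂ] H) ‖x - y‖ ≤ algebraMap ℝ (H →L[ℂ] H) ε :=
        algebraMap_mono _ hxy
      rw [add_comm]
      exact sub_le_iff_le_add.1 (h3.trans h4)
    have h5 := star_left_conjugate_le_conjugate h2 c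
    rw [hcs, hcxc, mul_add, add_mul, Algebra.algebraMap_eq_smul_one, mul_smul_comm, mul_one,
      smul_mul_assoc] at h5
    have h6 : ε • (c * c) ≤ ε • δ⁻¹ • z := smul_le_smul_of_nonneg_left hcc hε0
    rw [sub_smul, one_smul, sub_le_iff_le_add]
    refine h5.trans (add_le_add_right ?_ _)
    rwa [smul_smul, ← div_eq_mul_inv] at h6
  have hε1 : 0 ≤ 1 - ε / δ := by rw [sub_nonneg, div_le_one hδ]; exact hε.le
  rw [← hτ.real_smul hε1 hzN hz0]
  refine (hτ.mono (real_smul_mem_vonNeumann _ hzN) (mul_mem (mul_mem hcN hy) hcN)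
    (smul_nonneg hε1 hz0) h1).trans ?_
  -- By the trace property `τ(c y c) = τ(r c² r)` with `r = y^(1/2)`.
  set r := CFC.sqrt y with hr
  have hrr : r * r = y := CFC.sqrt_mul_sqrt_self y hy0
  have hrs : star r = r := (IsSelfAdjoint.of_nonneg (CFC.sqrt_nonneg _)).star_eq
  have hrN : r ∈ N := by
    rw [hr, CFC.sqrt_eq_real_sqrt _ hy0, cfcₙ_eq_cfc (hf0 := Real.sqrt_zero)]
    exact cfc_mem_vonNeumann hy _
  have h7 := hτ.trace (r * c) (mul_mem hrN hcN)
  rw [star_mul, hrs, hcs] at h7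
  have h8 : c * r * (r * c) = c * y * c := by rw [← hrr]; simp only [mul_assoc]
  rw [h8] at h7
  rw [h7]
  have h9 : r * c * (c * r) ≤ y := by
    have := star_left_conjugate_le_conjugate hcc1 r
    rw [hrs, mul_one, hrr] at this
    simpa only [mul_assoc] using this
  refine hτ.mono (mul_mem (mul_mem hrN hcN) (mul_mem hcN hrN)) hy ?_ h9
  have := mul_star_self_nonneg (r * c)
  rwa [star_mul, hrs, hcs] at this

/-- A normal trace is lower semicontinuous for convergence in norm. -/
theorem le_of_tendsto (hτ : IsFaithfulNormalSemifiniteTrace N τ) {u : ℕ → (H →L[ℂ] H)}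
    {x : H →L[ℂ] H} (hu : ∀ k, u k ∈ N) (hu0 : ∀ k, 0 ≤ u k) (hux : Tendsto u atTop (𝓝 x))
    {M : ℝ≥0∞} (hM : ∀ᶠ k in atTop, τ (u k) ≤ M) : τ x ≤ M := by
  have hx : x ∈ N := (isClosed_vonNeumann N).mem_of_tendsto hux (Eventually.of_forall hu)
  have hx0 : 0 ≤ x := ge_of_tendsto' hux hu0
  have hsa : IsSelfAdjoint x := IsSelfAdjoint.of_nonneg hx0
  have h1 : ∀ δ : ℝ, 0 < δ → τ (cfc (fun t : ℝ => max (t - δ) 0) x) ≤ M := by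
    intro δ hδ
    refine ENNReal.le_of_forall_lt_one_mul_le fun a ha => ?_
    lift a to ℝ≥0 using ha.ne_top
    have ha1 : (a : ℝ) < 1 := by exact_mod_cast ha
    have hε : 0 < δ * (1 - a) := mul_pos hδ (by linarith)
    have h2 : ∀ᶠ k in atTop, ‖x - u k‖ < δ * (1 - a) := by
      filter_upwards [Metric.tendsto_nhds.1 hux _ hε] with k hk
      rwa [dist_comm, dist_eq_norm] at hk
    by_cases ha0 : a = 0
    · simp [ha0]
    obtain ⟨k, hk1, hk2⟩ := (h2.and hM).exists
    have h3 := hτ.tau_posPart_sub_le hx (hu k) hx0 (hu0 k) hδ (ε := δ * (1 - a))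
      (by
        have : 0 < (a : ℝ) := by positivity
        nlinarith) hk1.le
    rw [mul_div_cancel_left₀ _ hδ.ne', sub_sub_cancel, ENNReal.ofReal_coe_nnreal] at h3
    exact h3.trans hk2
  let v : ℕ → (H →L[ℂ] H) := fun n => cfc (fun t : ℝ => max (t - 1 / ((n : ℝ) + 1)) 0) x
  have hv : Monotone v := by
    intro m n hmn
    refine cfc_mono fun t _ => max_le_max (sub_le_sub_left ?_ t) le_rfl
    exact one_div_le_one_div_of_le (by positivity) (by gcongr)
  have hvx : Tendsto v atTop (𝓝 x) := by
    refine tendsto_iff_norm_sub_tendsto_zero.2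
      (squeeze_zero (fun n => norm_nonneg _) (fun n => ?_) tendsto_one_div_add_atTop_nhds_zero_nat)
    have hn : (0 : ℝ) < 1 / ((n : ℝ) + 1) := by positivity
    have h2 : v n - x = cfc (fun t : ℝ => max (t - 1 / ((n : ℝ) + 1)) 0 - t) x := by
      rw [cfc_sub .., cfc_id' ..]
    rw [h2]
    refine norm_cfc_le hn.le fun t ht => ?_
    have ht0 : 0 ≤ t := spectrum_nonneg_of_nonneg hx0 ht
    rw [Real.norm_eq_abs, abs_le]
    constructor
    · have := le_max_left (t - 1 / ((n : ℝ) + 1)) 0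
      linarith
    · have : max (t - 1 / ((n : ℝ) + 1)) 0 ≤ t := max_le (by linarith) ht0
      linarith
  have hn := hτ.normal (Set.range v) x ?_ (Set.range_nonempty v) hv.directed_le.directedOn_range
    (isLUB_of_tendsto_atTop hv hvx)
  · rw [hn]
    refine iSup₂_le ?_
    rintro _ ⟨n, rfl⟩
    exact h1 _ (by positivity)
  · rintro _ ⟨n, rfl⟩
    exact ⟨cfc_mem_vonNeumann hx _, cfc_nonneg fun t _ => le_max_right _ _⟩

end IsFaithfulNormalSemifiniteTrace

/-- If `s ≤ (1 + t)a² + (1 + 1/t)b²` for all `t > 0`, then `s ≤ (a + b)²`. -/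
theorem sqrt_le_add_of_forall {s a b : ℝ} (ha : 0 ≤ a) (hb : 0 ≤ b)
    (h : ∀ t > 0, s ≤ (1 + t) * a ^ 2 + (1 + t⁻¹) * b ^ 2) : Real.sqrt s ≤ a + b := by
  refine le_of_forall_pos_le_add fun ε hε => ?_
  refine Real.sqrt_le_iff.2 ⟨by positivity, ?_⟩
  have ha' : 0 < a + ε / 2 := by positivity
  have hb' : 0 < b + ε / 2 := by positivity
  have h1 := h ((b + ε / 2) / (a + ε / 2)) (by positivity)
  have h2 : (1 + (b + ε / 2) / (a + ε / 2)) * (a + ε / 2) ^ 2 +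
      (1 + ((b + ε / 2) / (a + ε / 2))⁻¹) * (b + ε / 2) ^ 2 = (a + b + ε) ^ 2 := by
    field_simp; ring
  rw [← h2]
  refine h1.trans ?_
  gcongr <;> linarith

/-! ### The operator `(1 + D²)⁻¹` and its powers -/

section Resolvent

theorem inner_self_eq_ofReal {E : Type*} [NormedAddCommGroup E] [InnerProductSpace ℂ E]
    (x : E) : ⟪x, x⟫_ℂ = ((‖x‖ ^ 2 : ℝ) : ℂ) := by
  rw [inner_self_eq_norm_sq_to_K]
  push_cast
  rfl

variable {H : Type*} [NormedAddCommGroup H] [InnerProductSpace ℂ H] [CompleteSpace H]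
variable {D : H →ₗ.[ℂ] H}

theorem inner_apply_eq_of_isSelfAdjoint (hD : IsSelfAdjoint D) (x y : D.domain) :
    ⟪D x, (y : H)⟫_ℂ = ⟪(x : H), D y⟫_ℂ := by
  have h := LinearPMap.adjoint_isFormalAdjoint (T := D) hD.dense_domain
  rw [LinearPMap.isSelfAdjoint_def.1 hD] at h
  exact h x y

theorem eq_zero_of_add_sq_eq_zero (hD : IsSelfAdjoint D) {y : H} (h : y ∈ D.domain)
    (h' : D ⟨y, h⟩ ∈ D.domain) (h0 : y + D ⟨D ⟨y, h⟩, h'⟩ = 0) : y = 0 := by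
  have h1 : ⟪y, y + D ⟨D ⟨y, h⟩, h'⟩⟫_ℂ = 0 := by rw [h0, inner_zero_right]
  have h2 := inner_apply_eq_of_isSelfAdjoint hD ⟨y, h⟩ ⟨D ⟨y, h⟩, h'⟩
  simp only at h2
  rw [inner_add_right, ← h2, inner_self_eq_ofReal, inner_self_eq_ofReal] at h1
  have h3 : ‖y‖ ^ 2 + ‖D ⟨y, h⟩‖ ^ 2 = 0 := by exact_mod_cast h1
  have h4 : ‖y‖ ^ 2 = 0 := by nlinarith [sq_nonneg ‖y‖, sq_nonneg ‖D ⟨y, h⟩‖]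
  simpa using h4

theorem invOneAddSq_nonneg (hD : IsSelfAdjoint D) : 0 ≤ invOneAddSq D := by
  rw [ContinuousLinearMap.nonneg_iff_isPositive, ContinuousLinearMap.isPositive_iff_complex]
  intro x
  obtain ⟨h, h', hx⟩ := isInvOneAddSq_invOneAddSq hD x
  have h2 := inner_apply_eq_of_isSelfAdjoint hD ⟨_, h⟩ ⟨_, h'⟩
  have h1 : ⟪invOneAddSq D x, x⟫_ℂ =
      ((‖invOneAddSq D x‖ ^ 2 + ‖D ⟨invOneAddSq D x, h⟩‖ ^ 2 : ℝ) : ℂ) := by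
    have h3 : ⟪invOneAddSq D x, x⟫_ℂ =
        ⟪invOneAddSq D x, invOneAddSq D x + D ⟨D ⟨invOneAddSq D x, h⟩, h'⟩⟫_ℂ := by rw [hx]
    simp only at h2
    rw [h3, inner_add_right, ← h2, inner_self_eq_ofReal, inner_self_eq_ofReal, Complex.ofReal_add]
  rw [h1]
  refine ⟨?_, ?_⟩
  · rw [RCLike.re_to_complex, Complex.ofReal_re]
  · simp only [RCLike.re_to_complex, Complex.ofReal_re]; positivity

theorem invOneAddSq_le_one (hD : IsSelfAdjoint D) : invOneAddSq D ≤ 1 := by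
  rw [← sub_nonneg, ContinuousLinearMap.nonneg_iff_isPositive,
    ContinuousLinearMap.isPositive_iff_complex]
  intro x
  obtain ⟨h, h', hx⟩ := isInvOneAddSq_invOneAddSq hD x
  set y := invOneAddSq D x with hy
  have h2 := inner_apply_eq_of_isSelfAdjoint hD ⟨D ⟨y, h⟩, h'⟩ ⟨y, h⟩
  simp only at h2
  have h3 : (1 - invOneAddSq D) x = D ⟨D ⟨y, h⟩, h'⟩ := by
    simp only [sub_apply, one_apply_eq_self]
    rw [← hy, sub_eq_iff_eq_add']
    exact hx.symm
  have h1 : ⟪(1 - invOneAddSq D) x, x⟫_ℂ =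
      ((‖D ⟨y, h⟩‖ ^ 2 + ‖D ⟨D ⟨y, h⟩, h'⟩‖ ^ 2 : ℝ) : ℂ) := by
    rw [h3]
    conv_lhs => rw [← hx]
    rw [inner_add_right, h2, inner_self_eq_ofReal, inner_self_eq_ofReal, Complex.ofReal_add]
  rw [h1]
  refine ⟨?_, ?_⟩
  · rw [RCLike.re_to_complex, Complex.ofReal_re]
  · simp only [RCLike.re_to_complex, Complex.ofReal_re]; positivity

theorem invOneAddSq_injective (hD : IsSelfAdjoint D) : Function.Injective (invOneAddSq D) := by
  rw [injective_iff_map_eq_zero]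
  intro x hx
  obtain ⟨h, h', hx'⟩ := isInvOneAddSq_invOneAddSq hD x
  have h1 : D ⟨invOneAddSq D x, h⟩ = 0 := by
    have : (⟨invOneAddSq D x, h⟩ : D.domain) = 0 := Subtype.ext hx
    rw [this, LinearPMap.map_zero]
  have h2 : D ⟨D ⟨invOneAddSq D x, h⟩, h'⟩ = 0 := by
    have : (⟨D ⟨invOneAddSq D x, h⟩, h'⟩ : D.domain) = 0 := Subtype.ext h1
    rw [this, LinearPMap.map_zero]
  rw [h2, add_zero] at hx'
  exact hx'.symm.trans hx

theorem isSelfAdjoint_invOneAddSq (hD : IsSelfAdjoint D) : IsSelfAdjoint (invOneAddSq D) :=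
  IsSelfAdjoint.of_nonneg (invOneAddSq_nonneg hD)

theorem spectrum_invOneAddSq_subset (hD : IsSelfAdjoint D) :
    spectrum ℝ (invOneAddSq D) ⊆ Set.Icc 0 1 := by
  intro t ht
  refine ⟨spectrum_nonneg_of_nonneg (invOneAddSq_nonneg hD) ht, ?_⟩
  have h1 := isSelfAdjoint_invOneAddSq hD
  have h2 : invOneAddSq D ≤ algebraMap ℝ _ 1 := by
    rw [map_one]; exact invOneAddSq_le_one hD
  exact (le_algebraMap_iff_spectrum_le h1).1 h2 t ht

theorem invOneAddSq_mem (hD : IsSelfAdjoint D) {N : VonNeumannAlgebra H}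
    (hDN : IsAffiliated N D) : invOneAddSq D ∈ N := by
  refine mem_of_forall_unitary_commute fun u hu huu => ?_
  ext x
  obtain ⟨h, h', hx⟩ := isInvOneAddSq_invOneAddSq hD x
  obtain ⟨k, k', kx⟩ := isInvOneAddSq_invOneAddSq hD (u x)
  obtain ⟨h1, h2⟩ := hDN u hu huu ⟨_, h⟩
  obtain ⟨h3, h4⟩ := hDN u hu huu ⟨_, h'⟩
  simp only at h1 h2 h3 h4
  have h5 : D ⟨u (invOneAddSq D x), h1⟩ ∈ D.domain := by rw [h2]; exact h3
  have h6 : D ⟨D ⟨u (invOneAddSq D x), h1⟩, h5⟩ = u (D ⟨_, h'⟩) := by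
    rw [← h4]; congr 1; exact Subtype.ext h2
  -- Both `u b x` and `b u x` solve `y + D²y = u x`.
  have h7 : D ⟨u (invOneAddSq D x) - invOneAddSq D (u x), D.domain.sub_mem h1 k⟩ =
      D ⟨_, h1⟩ - D ⟨_, k⟩ := by
    rw [← LinearPMap.map_sub]; rfl
  have h8 : D ⟨u (invOneAddSq D x) - invOneAddSq D (u x), D.domain.sub_mem h1 k⟩ ∈ D.domain := by
    rw [h7]; exact D.domain.sub_mem h5 k'
  have h9 : D ⟨D ⟨u (invOneAddSq D x) - invOneAddSq D (u x), D.domain.sub_mem h1 k⟩, h8⟩ =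
      u (D ⟨_, h'⟩) - D ⟨_, k'⟩ := by
    rw [← h6, ← LinearPMap.map_sub]; congr 1; exact Subtype.ext h7
  have h10 := eq_zero_of_add_sq_eq_zero hD _ h8 (by
    rw [h9]
    have e1 : u (invOneAddSq D x) + u (D ⟨_, h'⟩) = u x := by rw [← map_add, hx]
    calc _ = (u (invOneAddSq D x) + u (D ⟨_, h'⟩)) -
          (invOneAddSq D (u x) + D ⟨_, k'⟩) := by abel
      _ = 0 := by rw [e1, kx, sub_self])
  exact sub_eq_zero.1 h10

theorem resPow_mem (hD : IsSelfAdjoint D) {N : VonNeumannAlgebra H} (hDN : IsAffiliated N D)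
    (r : ℝ) : resPow D r ∈ N :=
  cfc_mem_vonNeumann (invOneAddSq_mem hD hDN) _

theorem star_resPow (r : ℝ) : star (resPow D r) = resPow D r :=
  (cfc_predicate _ _ : IsSelfAdjoint (resPow D r)).star_eq

theorem continuousOn_rpow_spectrum {r : ℝ} (hr : 0 ≤ r) {s : Set ℝ} :
    ContinuousOn (fun x : ℝ => x ^ r) s :=
  (Real.continuous_rpow_const hr).continuousOn

theorem resPow_mul_self_antitone (hD : IsSelfAdjoint D) {r r' : ℝ} (hr : 0 ≤ r) (h : r ≤ r') :
    resPow D r' * resPow D r' ≤ resPow D r * resPow D r := by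
  have hr' := hr.trans h
  rw [resPow, resPow, ← cfc_mul _ _ _ (continuousOn_rpow_spectrum hr')
    (continuousOn_rpow_spectrum hr'), ← cfc_mul _ _ _ (continuousOn_rpow_spectrum hr)
    (continuousOn_rpow_spectrum hr)]
  refine cfc_mono (fun t ht => ?_)
    ((continuousOn_rpow_spectrum hr').mul (continuousOn_rpow_spectrum hr'))
    ((continuousOn_rpow_spectrum hr).mul (continuousOn_rpow_spectrum hr))
  obtain ⟨h0, h1⟩ := spectrum_invOneAddSq_subset hD ht
  rcases eq_or_lt_of_le h0 with h0 | h0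
  · subst h0
    have h2 : (0 : ℝ) ^ r' ≤ 0 ^ r := by
      rcases eq_or_lt_of_le hr with e | e
      · rw [← e, Real.rpow_zero]; exact Real.zero_rpow_le_one _
      · rw [Real.zero_rpow e.ne', Real.zero_rpow (e.trans_le h).ne']
    exact mul_self_le_mul_self (Real.rpow_nonneg le_rfl _) h2
  · exact mul_self_le_mul_self (Real.rpow_nonneg h0.le _)
      (Real.rpow_le_rpow_of_exponent_ge h0 h1 h)

end Resolvent

/-! ### The weights `φ_s` and the algebra of square-integrable elements -/

section SquareIntegrable

variable {H : Type*} [NormedAddCommGroup H] [InnerProductSpace ℂ H] [CompleteSpace H]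
variable {N : VonNeumannAlgebra H} {τ : (H →L[ℂ] H) → ℝ≥0∞} {D : H →ₗ.[ℂ] H} {p : ℝ}

theorem weight_star_mul_self (s : ℝ) (T : H →L[ℂ] H) : weight τ D s (star T * T) =
    τ (star (T * resPow D (s / 4)) * (T * resPow D (s / 4))) := by
  rw [weight, star_mul, star_resPow]
  simp only [mul_assoc]

theorem weight_sq_add_le (hτ : IsFaithfulNormalSemifiniteTrace N τ) (hD : IsSelfAdjoint D)
    (hDN : IsAffiliated N D) (s : ℝ) {x y : H →L[ℂ] H} (hx : x ∈ N) (hy : y ∈ N) {t : ℝ}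
    (ht : 0 < t) : weight τ D s (star (x + y) * (x + y)) ≤
      ENNReal.ofReal (1 + t) * weight τ D s (star x * x) +
        ENNReal.ofReal (1 + t⁻¹) * weight τ D s (star y * y) := by
  have hc := resPow_mem hD hDN (s / 4)
  simp only [weight_star_mul_self, add_mul]
  exact hτ.sq_add_le (mul_mem hx hc) (mul_mem hy hc) ht

theorem weight_sq_smul (hτ : IsFaithfulNormalSemifiniteTrace N τ) (hD : IsSelfAdjoint D)
    (hDN : IsAffiliated N D) (s : ℝ) (c : ℂ) {x : H →L[ℂ] H} (hx : x ∈ N) :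
    weight τ D s (star (c • x) * (c • x)) =
      ENNReal.ofReal (‖c‖ ^ 2) * weight τ D s (star x * x) := by
  have hc := resPow_mem hD hDN (s / 4)
  simp only [weight_star_mul_self, smul_mul_assoc]
  exact hτ.sq_smul c (mul_mem hx hc)

theorem weight_sq_mul_le (hτ : IsFaithfulNormalSemifiniteTrace N τ) (hD : IsSelfAdjoint D)
    (hDN : IsAffiliated N D) (s : ℝ) {a x : H →L[ℂ] H} (ha : a ∈ N) (hx : x ∈ N) :
    weight τ D s (star (a * x) * (a * x)) ≤
      ENNReal.ofReal (‖a‖ ^ 2) * weight τ D s (star x * x) := by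
  have hc := resPow_mem hD hDN (s / 4)
  simp only [weight_star_mul_self, mul_assoc a]
  exact hτ.sq_mul_le ha (mul_mem hx hc)

/-- The weights `φ_s` decrease in `s`: by the trace property `φ_s(x*x) = τ(x (1 + D²)^(-s/2) x*)`. -/
theorem weight_sq_antitone (hτ : IsFaithfulNormalSemifiniteTrace N τ) (hD : IsSelfAdjoint D)
    (hDN : IsAffiliated N D) {s s' : ℝ} (hs : 0 ≤ s) (h : s ≤ s') {x : H →L[ℂ] H} (hx : x ∈ N) :
    weight τ D s' (star x * x) ≤ weight τ D s (star x * x) := by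
  have hc := resPow_mem hD hDN (s / 4)
  have hc' := resPow_mem hD hDN (s' / 4)
  have key : ∀ r, x * resPow D r * star (x * resPow D r) =
      x * (resPow D r * resPow D r) * star x := by
    intro r
    rw [star_mul, star_resPow]
    simp only [mul_assoc]
  rw [weight_star_mul_self, weight_star_mul_self, hτ.trace _ (mul_mem hx hc),
    hτ.trace _ (mul_mem hx hc')]
  refine hτ.mono (mul_mem (mul_mem hx hc') (star_mem (mul_mem hx hc')))
    (mul_mem (mul_mem hx hc) (star_mem (mul_mem hx hc))) (mul_star_self_nonneg _) ?_
  rw [key, key]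
  exact star_right_conjugate_le_conjugate
    (resPow_mul_self_antitone hD (by positivity) (by linarith)) x

theorem weight_sq_le_of_tendsto (hτ : IsFaithfulNormalSemifiniteTrace N τ) (hD : IsSelfAdjoint D)
    (hDN : IsAffiliated N D) (s : ℝ) {u : ℕ → (H →L[ℂ] H)} {x : H →L[ℂ] H} (hu : ∀ k, u k ∈ N)
    (hux : Tendsto u atTop (𝓝 x)) {M : ℝ≥0∞}
    (hM : ∀ᶠ k in atTop, weight τ D s (star (u k) * u k) ≤ M) :
    weight τ D s (star x * x) ≤ M := by
  have hc := resPow_mem hD hDN (s / 4)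
  simp only [weight_star_mul_self] at hM ⊢
  have h1 : Tendsto (fun k => u k * resPow D (s / 4)) atTop (𝓝 (x * resPow D (s / 4))) :=
    hux.mul_const _
  refine hτ.le_of_tendsto (fun k => ?_) (fun k => star_mul_self_nonneg _)
    (h1.star.mul h1) hM
  exact mul_mem (star_mem (mul_mem (hu k) hc)) (mul_mem (hu k) hc)

theorem mem_B2_iff {T : H →L[ℂ] H} : T ∈ B2 N τ D p ↔ T ∈ N ∧ ∀ s : ℝ, p < s →
    weight τ D s (star T * T) < ∞ ∧ weight τ D s (star (star T) * star T) < ∞ := by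
  constructor
  · intro h
    exact ⟨(h (p + 1) (by linarith)).1.1, fun s hs => ⟨(h s hs).1.2, (h s hs).2.2⟩⟩
  · rintro ⟨h1, h2⟩ s hs
    exact ⟨⟨h1, (h2 s hs).1⟩, ⟨star_mem h1, (h2 s hs).2⟩⟩

theorem lt_add_one_div_pnat (n : ℕ+) : p < p + 1 / (n : ℝ) := by
  have : (0 : ℝ) < n := by exact_mod_cast n.pos
  have : 0 < 1 / (n : ℝ) := by positivity
  linarith

theorem normQ_sq (n : ℕ+) (T : H →L[ℂ] H) : normQ τ D p n T ^ 2 = ‖T‖ ^ 2 +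
    (weight τ D (p + 1 / (n : ℝ)) (star T * T)).toReal +
    (weight τ D (p + 1 / (n : ℝ)) (star (star T) * star T)).toReal := by
  rw [star_star]
  exact Real.sq_sqrt (by positivity)

theorem normQ_eq (n : ℕ+) (T : H →L[ℂ] H) : normQ τ D p n T = Real.sqrt (‖T‖ ^ 2 +
    (weight τ D (p + 1 / (n : ℝ)) (star T * T)).toReal +
    (weight τ D (p + 1 / (n : ℝ)) (star (star T) * star T)).toReal) := by
  rw [star_star]; rfl

theorem normQ_nonneg (n : ℕ+) (T : H →L[ℂ] H) : 0 ≤ normQ τ D p n T := Real.sqrt_nonneg _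

theorem norm_le_normQ (n : ℕ+) (T : H →L[ℂ] H) : ‖T‖ ≤ normQ τ D p n T := by
  rw [normQ_eq]
  refine Real.le_sqrt_of_sq_le ?_
  have h1 : 0 ≤ (weight τ D (p + 1 / (n : ℝ)) (star T * T)).toReal := ENNReal.toReal_nonneg
  have h2 : 0 ≤ (weight τ D (p + 1 / (n : ℝ)) (star (star T) * star T)).toReal :=
    ENNReal.toReal_nonneg
  linarith

theorem normQ_star (n : ℕ+) (T : H →L[ℂ] H) : normQ τ D p n (star T) = normQ τ D p n T := by
  rw [normQ_eq, normQ_eq, star_star, norm_star, add_right_comm]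

theorem star_mem_B2 {T : H →L[ℂ] H} (hT : T ∈ B2 N τ D p) : star T ∈ B2 N τ D p := by
  intro s hs
  rw [star_star]
  exact (hT s hs).symm

theorem zero_mem_B2 (hτ : IsFaithfulNormalSemifiniteTrace N τ) (hD : IsSelfAdjoint D)
    (hDN : IsAffiliated N D) : (0 : H →L[ℂ] H) ∈ B2 N τ D p := by
  have h : ∀ s, weight τ D s (star (0 : H →L[ℂ] H) * 0) = 0 := fun s => by
    have := weight_sq_smul hτ hD hDN s 0 (zero_mem N)
    rw [zero_smul] at this
    simpa using this
  refine mem_B2_iff.2 ⟨zero_mem N, fun s _ => ⟨by rw [h]; simp, ?_⟩⟩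
  rw [star_zero (H →L[ℂ] H), h]; simp

theorem add_mem_B2 (hτ : IsFaithfulNormalSemifiniteTrace N τ) (hD : IsSelfAdjoint D)
    (hDN : IsAffiliated N D) {x y : H →L[ℂ] H} (hx : x ∈ B2 N τ D p) (hy : y ∈ B2 N τ D p) :
    x + y ∈ B2 N τ D p := by
  obtain ⟨hxN, hx⟩ := mem_B2_iff.1 hx
  obtain ⟨hyN, hy⟩ := mem_B2_iff.1 hy
  refine mem_B2_iff.2 ⟨add_mem hxN hyN, fun s hs => ⟨?_, ?_⟩⟩
  · refine (weight_sq_add_le hτ hD hDN s hxN hyN one_pos).trans_lt (ENNReal.add_lt_top.2 ⟨?_, ?_⟩)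
    · exact ENNReal.mul_lt_top ENNReal.ofReal_lt_top (hx s hs).1
    · exact ENNReal.mul_lt_top ENNReal.ofReal_lt_top (hy s hs).1
  · rw [star_add]
    refine (weight_sq_add_le hτ hD hDN s (star_mem hxN) (star_mem hyN) one_pos).trans_lt
      (ENNReal.add_lt_top.2 ⟨?_, ?_⟩)
    · exact ENNReal.mul_lt_top ENNReal.ofReal_lt_top (hx s hs).2
    · exact ENNReal.mul_lt_top ENNReal.ofReal_lt_top (hy s hs).2

theorem smul_mem_B2 (hτ : IsFaithfulNormalSemifiniteTrace N τ) (hD : IsSelfAdjoint D)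
    (hDN : IsAffiliated N D) (c : ℂ) {x : H →L[ℂ] H} (hx : x ∈ B2 N τ D p) :
    c • x ∈ B2 N τ D p := by
  obtain ⟨hxN, hx⟩ := mem_B2_iff.1 hx
  refine mem_B2_iff.2 ⟨smul_mem_vonNeumann c hxN, fun s hs => ⟨?_, ?_⟩⟩
  · rw [weight_sq_smul hτ hD hDN s c hxN]
    exact ENNReal.mul_lt_top ENNReal.ofReal_lt_top (hx s hs).1
  · rw [star_smul, weight_sq_smul hτ hD hDN s _ (star_mem hxN)]
    exact ENNReal.mul_lt_top ENNReal.ofReal_lt_top (hx s hs).2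

theorem normQ_add_le (hτ : IsFaithfulNormalSemifiniteTrace N τ) (hD : IsSelfAdjoint D)
    (hDN : IsAffiliated N D) (n : ℕ+) {x y : H →L[ℂ] H} (hx : x ∈ B2 N τ D p)
    (hy : y ∈ B2 N τ D p) : normQ τ D p n (x + y) ≤ normQ τ D p n x + normQ τ D p n y := by
  obtain ⟨hxN, hx⟩ := mem_B2_iff.1 hx
  obtain ⟨hyN, hy⟩ := mem_B2_iff.1 hy
  have hs := lt_add_one_div_pnat (p := p) n
  have key : ∀ (a b : ℝ≥0∞) (c : ℝ≥0∞) (t : ℝ), 0 < t → a < ∞ → b < ∞ →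
      c ≤ ENNReal.ofReal (1 + t) * a + ENNReal.ofReal (1 + t⁻¹) * b →
      c.toReal ≤ (1 + t) * a.toReal + (1 + t⁻¹) * b.toReal := by
    intro a b c t ht ha hb h
    have h1 := ENNReal.mul_lt_top (ENNReal.ofReal_lt_top (r := 1 + t)) ha
    have h2 := ENNReal.mul_lt_top (ENNReal.ofReal_lt_top (r := 1 + t⁻¹)) hb
    have h3 := ENNReal.toReal_mono (ENNReal.add_lt_top.2 ⟨h1, h2⟩).ne h
    rwa [ENNReal.toReal_add h1.ne h2.ne, ENNReal.toReal_mul, ENNReal.toReal_mul,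
      ENNReal.toReal_ofReal (by positivity), ENNReal.toReal_ofReal (by positivity)] at h3
  rw [normQ_eq n (x + y)]
  refine sqrt_le_add_of_forall (normQ_nonneg _ _) (normQ_nonneg _ _) fun t ht => ?_
  have h1 := key _ _ _ t ht (hx _ hs).1 (hy _ hs).1 (weight_sq_add_le hτ hD hDN _ hxN hyN ht)
  have h2 := key _ _ _ t ht (hx _ hs).2 (hy _ hs).2
    (weight_sq_add_le hτ hD hDN _ (star_mem hxN) (star_mem hyN) ht)
  rw [← star_add] at h2
  have h3 : ‖x + y‖ ^ 2 ≤ (1 + t) * ‖x‖ ^ 2 + (1 + t⁻¹) * ‖y‖ ^ 2 := by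
    have h4 : ‖x + y‖ ^ 2 ≤ (‖x‖ + ‖y‖) ^ 2 := by
      gcongr
      exact norm_add_le x y
    refine h4.trans ?_
    have h5 : (1 + t) * ‖x‖ ^ 2 + (1 + t⁻¹) * ‖y‖ ^ 2 - (‖x‖ + ‖y‖) ^ 2 =
        t * (‖x‖ - t⁻¹ * ‖y‖) ^ 2 := by field_simp; ring
    have h6 : 0 ≤ t * (‖x‖ - t⁻¹ * ‖y‖) ^ 2 := by positivity
    linarith
  rw [normQ_sq, normQ_sq]
  linarith

theorem normQ_smul (hτ : IsFaithfulNormalSemifiniteTrace N τ) (hD : IsSelfAdjoint D)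
    (hDN : IsAffiliated N D) (n : ℕ+) (c : ℂ) {x : H →L[ℂ] H} (hx : x ∈ B2 N τ D p) :
    normQ τ D p n (c • x) = ‖c‖ * normQ τ D p n x := by
  obtain ⟨hxN, -⟩ := mem_B2_iff.1 hx
  rw [← sq_eq_sq₀ (normQ_nonneg _ _) (mul_nonneg (norm_nonneg _) (normQ_nonneg _ _)), mul_pow,
    normQ_sq, normQ_sq, weight_sq_smul hτ hD hDN _ c hxN, star_smul,
    weight_sq_smul hτ hD hDN _ _ (star_mem hxN), norm_star, ENNReal.toReal_mul, ENNReal.toReal_mul,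
    ENNReal.toReal_ofReal (by positivity), norm_smul]
  ring

/-- The algebra `B₂` is a quasi-ideal: `B₂ N B₂ ⊆ B₂`. -/
theorem mul_mul_mem_B2 (hτ : IsFaithfulNormalSemifiniteTrace N τ) (hD : IsSelfAdjoint D)
    (hDN : IsAffiliated N D) {R X S : H →L[ℂ] H} (hR : R ∈ B2 N τ D p) (hX : X ∈ N)
    (hS : S ∈ B2 N τ D p) : R * X * S ∈ B2 N τ D p := by
  obtain ⟨hRN, hR⟩ := mem_B2_iff.1 hR
  obtain ⟨hSN, hS⟩ := mem_B2_iff.1 hS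
  refine mem_B2_iff.2 ⟨mul_mem (mul_mem hRN hX) hSN, fun s hs => ⟨?_, ?_⟩⟩
  · exact (weight_sq_mul_le hτ hD hDN s (mul_mem hRN hX) hSN).trans_lt
      (ENNReal.mul_lt_top ENNReal.ofReal_lt_top (hS s hs).1)
  · have e : star (R * X * S) = star S * star X * star R := by simp only [star_mul, mul_assoc]
    rw [e]
    exact (weight_sq_mul_le hτ hD hDN s (mul_mem (star_mem hSN) (star_mem hX))
      (star_mem hRN)).trans_lt (ENNReal.mul_lt_top ENNReal.ofReal_lt_top (hR s hs).2)

theorem normQ_mul_mul_le (hτ : IsFaithfulNormalSemifiniteTrace N τ) (hD : IsSelfAdjoint D)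
    (hDN : IsAffiliated N D) (n : ℕ+) {R X S : H →L[ℂ] H} (hR : R ∈ B2 N τ D p) (hX : X ∈ N)
    (hS : S ∈ B2 N τ D p) :
    normQ τ D p n (R * X * S) ≤ ‖X‖ * (normQ τ D p n R * normQ τ D p n S) := by
  obtain ⟨hRN, hR⟩ := mem_B2_iff.1 hR
  obtain ⟨hSN, hS⟩ := mem_B2_iff.1 hS
  have hs := lt_add_one_div_pnat (p := p) n
  have key : ∀ (a c : ℝ≥0∞) (r : ℝ), 0 ≤ r → a < ∞ → c ≤ ENNReal.ofReal r * a →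
      c.toReal ≤ r * a.toReal := by
    intro a c r hr ha h
    have h3 := ENNReal.toReal_mono (ENNReal.mul_lt_top (ENNReal.ofReal_lt_top (r := r)) ha).ne h
    rwa [ENNReal.toReal_mul, ENNReal.toReal_ofReal hr] at h3
  have h1 := key _ _ _ (by positivity) (hS _ hs).1
    (weight_sq_mul_le hτ hD hDN _ (mul_mem hRN hX) hSN)
  have h2 := key _ _ _ (by positivity) (hR _ hs).2
    (weight_sq_mul_le hτ hD hDN _ (mul_mem (star_mem hSN) (star_mem hX)) (star_mem hRN))
  rw [← star_mul, ← star_mul, ← mul_assoc] at h2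
  have h3 : ‖R * X‖ ^ 2 ≤ ‖R‖ ^ 2 * ‖X‖ ^ 2 := by
    rw [← mul_pow]; gcongr; exact norm_mul_le _ _
  have h4 : ‖star (X * S)‖ ^ 2 ≤ ‖S‖ ^ 2 * ‖X‖ ^ 2 := by
    rw [← mul_pow, norm_star, mul_comm ‖S‖]; gcongr; exact norm_mul_le _ _
  have h5 : ‖R * X * S‖ ^ 2 ≤ ‖R‖ ^ 2 * ‖X‖ ^ 2 * ‖S‖ ^ 2 := by
    refine le_trans ?_ (mul_le_mul_of_nonneg_right h3 (sq_nonneg _))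
    rw [← mul_pow]; gcongr; exact norm_mul_le _ _
  refine (sq_le_sq₀ (normQ_nonneg _ _) (mul_nonneg (norm_nonneg _)
    (mul_nonneg (normQ_nonneg _ _) (normQ_nonneg _ _)))).1 ?_
  rw [mul_pow, mul_pow, normQ_sq n (R * X * S), normQ_sq, normQ_sq]
  set a := (weight τ D (p + 1 / (n : ℝ)) (star R * R)).toReal
  set b := (weight τ D (p + 1 / (n : ℝ)) (star (star R) * star R)).toReal
  set c := (weight τ D (p + 1 / (n : ℝ)) (star S * S)).toReal
  set d := (weight τ D (p + 1 / (n : ℝ)) (star (star S) * star S)).toReal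
  have ha : 0 ≤ a := ENNReal.toReal_nonneg
  have hb : 0 ≤ b := ENNReal.toReal_nonneg
  have hc : 0 ≤ c := ENNReal.toReal_nonneg
  have hd : 0 ≤ d := ENNReal.toReal_nonneg
  have h6 := h1.trans (mul_le_mul_of_nonneg_right h3 hc)
  have h7 := h2.trans (mul_le_mul_of_nonneg_right h4 hb)
  have h8 : 0 ≤ ‖X‖ ^ 2 * (‖R‖ ^ 2 * d + a * (‖S‖ ^ 2 + c + d) + b * (c + d)) := by positivity
  calc _ ≤ ‖R‖ ^ 2 * ‖X‖ ^ 2 * ‖S‖ ^ 2 + ‖R‖ ^ 2 * ‖X‖ ^ 2 * c + ‖S‖ ^ 2 * ‖X‖ ^ 2 * b :=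
        add_le_add (add_le_add h5 h6) h7
    _ ≤ _ := by linarith

theorem mul_mem_B2 (hτ : IsFaithfulNormalSemifiniteTrace N τ) (hD : IsSelfAdjoint D)
    (hDN : IsAffiliated N D) {R S : H →L[ℂ] H} (hR : R ∈ B2 N τ D p) (hS : S ∈ B2 N τ D p) :
    R * S ∈ B2 N τ D p := by
  simpa using mul_mul_mem_B2 hτ hD hDN hR (one_mem N) hS

theorem normQ_mul_le (hτ : IsFaithfulNormalSemifiniteTrace N τ) (hD : IsSelfAdjoint D)
    (hDN : IsAffiliated N D) (n : ℕ+) {R S : H →L[ℂ] H} (hR : R ∈ B2 N τ D p)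
    (hS : S ∈ B2 N τ D p) : normQ τ D p n (R * S) ≤ normQ τ D p n R * normQ τ D p n S := by
  have h1 := normQ_mul_mul_le hτ hD hDN n hR (one_mem N) hS
  rw [mul_one] at h1
  refine h1.trans (mul_le_of_le_one_left (mul_nonneg (normQ_nonneg _ _) (normQ_nonneg _ _)) ?_)
  exact ContinuousLinearMap.norm_id_le

theorem normQ_mono (hτ : IsFaithfulNormalSemifiniteTrace N τ) (hD : IsSelfAdjoint D)
    (hDN : IsAffiliated N D) (hp : 0 ≤ p) {m n : ℕ+} (hmn : m ≤ n) {x : H →L[ℂ] H}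
    (hx : x ∈ B2 N τ D p) : normQ τ D p m x ≤ normQ τ D p n x := by
  obtain ⟨hxN, hx⟩ := mem_B2_iff.1 hx
  have hs := lt_add_one_div_pnat (p := p) n
  have h0 : 0 ≤ p + 1 / (n : ℝ) := by positivity
  have h1 : p + 1 / (n : ℝ) ≤ p + 1 / (m : ℝ) := by
    have hm : (0 : ℝ) < m := by exact_mod_cast m.pos
    have : (m : ℝ) ≤ n := by exact_mod_cast hmn
    gcongr
  rw [normQ_eq, normQ_eq]
  refine Real.sqrt_le_sqrt (add_le_add (add_le_add le_rfl ?_) ?_)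
  · exact ENNReal.toReal_mono (hx _ hs).1.ne (weight_sq_antitone hτ hD hDN h0 h1 hxN)
  · exact ENNReal.toReal_mono (hx _ hs).2.ne (weight_sq_antitone hτ hD hDN h0 h1 (star_mem hxN))

theorem exists_limit_B2 (hτ : IsFaithfulNormalSemifiniteTrace N τ) (hD : IsSelfAdjoint D)
    (hDN : IsAffiliated N D) (hp : 0 ≤ p) {u : ℕ → (H →L[ℂ] H)} (hu : ∀ k, u k ∈ B2 N τ D p)
    (hc : ∀ n, ∀ ε > 0, ∃ K, ∀ a ≥ K, ∀ b ≥ K, normQ τ D p n (u a - u b) < ε) :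
    ∃ x ∈ B2 N τ D p, ∀ n, ∀ ε > 0, ∃ K, ∀ a ≥ K, normQ τ D p n (u a - x) < ε := by
  have huN : ∀ k, u k ∈ N := fun k => (mem_B2_iff.1 (hu k)).1
  have hsub : ∀ a b, u a - u b ∈ B2 N τ D p := fun a b => by
    rw [sub_eq_add_neg, ← neg_one_smul ℂ]
    exact add_mem_B2 hτ hD hDN (hu a) (smul_mem_B2 hτ hD hDN _ (hu b))
  have hcau : CauchySeq u := by
    refine Metric.cauchySeq_iff.2 fun ε hε => ?_
    obtain ⟨K, hK⟩ := hc 1 ε hε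
    refine ⟨K, fun a ha b hb => ?_⟩
    rw [dist_eq_norm]
    exact (norm_le_normQ 1 _).trans_lt (hK a ha b hb)
  obtain ⟨x, hx⟩ := cauchySeq_tendsto_of_complete hcau
  have hxN : x ∈ N := (isClosed_vonNeumann N).mem_of_tendsto hx (Eventually.of_forall huN)
  have hw : ∀ (n : ℕ+) (y : H →L[ℂ] H) (ε : ℝ), y ∈ B2 N τ D p → normQ τ D p n y < ε →
      weight τ D (p + 1 / (n : ℝ)) (star y * y) ≤ ENNReal.ofReal (ε ^ 2) ∧
      weight τ D (p + 1 / (n : ℝ)) (star (star y) * star y) ≤ ENNReal.ofReal (ε ^ 2) := by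
    intro n y ε hy hlt
    obtain ⟨f1, f2⟩ := (mem_B2_iff.1 hy).2 _ (lt_add_one_div_pnat n)
    have h1 : normQ τ D p n y ^ 2 ≤ ε ^ 2 := by
      have := normQ_nonneg (τ := τ) (D := D) (p := p) n y
      gcongr
    rw [normQ_sq] at h1
    have g1 := ENNReal.toReal_nonneg (a := weight τ D (p + 1 / (n : ℝ)) (star y * y))
    have g2 := ENNReal.toReal_nonneg (a := weight τ D (p + 1 / (n : ℝ)) (star (star y) * star y))
    have g3 := sq_nonneg ‖y‖
    exact ⟨(ENNReal.le_ofReal_iff_toReal_le f1.ne (sq_nonneg ε)).2 (by linarith),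
      (ENNReal.le_ofReal_iff_toReal_le f2.ne (sq_nonneg ε)).2 (by linarith)⟩
  -- Lower semicontinuity of the weights passes the Cauchy estimates on to the limit.
  have hlim : ∀ n : ℕ+, ∀ ε > 0, ∃ K, ∀ a ≥ K,
      ‖u a - x‖ ≤ ε ∧
      weight τ D (p + 1 / (n : ℝ)) (star (u a - x) * (u a - x)) ≤ ENNReal.ofReal (ε ^ 2) ∧
      weight τ D (p + 1 / (n : ℝ)) (star (star (u a - x)) * star (u a - x)) ≤
        ENNReal.ofReal (ε ^ 2) := by
    intro n ε hε
    obtain ⟨K, hK⟩ := hc n ε hε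
    refine ⟨K, fun a ha => ?_⟩
    have ht : Tendsto (fun b => u a - u b) atTop (𝓝 (u a - x)) := tendsto_const_nhds.sub hx
    refine ⟨?_, ?_, ?_⟩
    · refine _root_.le_of_tendsto ht.norm ?_
      filter_upwards [eventually_ge_atTop K] with b hb
      exact (norm_le_normQ n _).trans (hK a ha b hb).le
    · refine weight_sq_le_of_tendsto hτ hD hDN _ (fun b => sub_mem (huN a) (huN b)) ht ?_
      filter_upwards [eventually_ge_atTop K] with b hb
      exact (hw n _ ε (hsub a b) (hK a ha b hb)).1
    · refine weight_sq_le_of_tendsto hτ hD hDN _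
        (fun b => star_mem (sub_mem (huN a) (huN b))) ht.star ?_
      filter_upwards [eventually_ge_atTop K] with b hb
      exact (hw n _ ε (hsub a b) (hK a ha b hb)).2
  have hxB : x ∈ B2 N τ D p := by
    refine mem_B2_iff.2 ⟨hxN, fun s hs => ?_⟩
    obtain ⟨n, hn⟩ := exists_nat_one_div_lt (sub_pos.2 hs)
    let n' : ℕ+ := ⟨n + 1, n.succ_pos⟩
    have hn' : p + 1 / (n' : ℝ) ≤ s := by
      have : ((n' : ℕ) : ℝ) = (n : ℝ) + 1 := by simp [n']
      rw [this]; linarith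
    have h0 : 0 ≤ p + 1 / (n' : ℝ) := by positivity
    obtain ⟨K, hK⟩ := hlim n' 1 one_pos
    obtain ⟨-, k1, k2⟩ := hK K le_rfl
    obtain ⟨l1, l2⟩ := (mem_B2_iff.1 (hu K)).2 _ (lt_add_one_div_pnat n')
    have hneg : ∀ y : H →L[ℂ] H, star (-y) * (-y) = star y * y := fun y => by
      rw [star_neg, neg_mul_neg]
    have hfin : ∀ y z : H →L[ℂ] H, y ∈ N → z ∈ N →
        weight τ D (p + 1 / (n' : ℝ)) (star y * y) < ∞ →
        weight τ D (p + 1 / (n' : ℝ)) (star (y - z) * (y - z)) ≤ ENNReal.ofReal (1 ^ 2) →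
        weight τ D s (star z * z) < ∞ := by
      intro y z hy hz h1 h2
      refine (weight_sq_antitone hτ hD hDN h0 hn' hz).trans_lt ?_
      have h3 := weight_sq_add_le hτ hD hDN (p + 1 / (n' : ℝ)) hy
        (neg_mem (sub_mem hy hz)) one_pos
      rw [hneg, show y + -(y - z) = z by abel] at h3
      refine h3.trans_lt (ENNReal.add_lt_top.2 ⟨?_, ?_⟩)
      · exact ENNReal.mul_lt_top ENNReal.ofReal_lt_top h1
      · exact ENNReal.mul_lt_top ENNReal.ofReal_lt_top (h2.trans_lt ENNReal.ofReal_lt_top)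
    refine ⟨hfin _ _ (huN K) hxN l1 k1, hfin _ _ (star_mem (huN K)) (star_mem hxN) l2 ?_⟩
    rwa [← star_sub]
  refine ⟨x, hxB, fun n ε hε => ?_⟩
  obtain ⟨K, hK⟩ := hlim n (ε / 2) (by positivity)
  refine ⟨K, fun a ha => ?_⟩
  obtain ⟨h1, h2, h3⟩ := hK a ha
  rw [normQ_eq, Real.sqrt_lt' hε]
  have h4 := ENNReal.toReal_le_of_le_ofReal (sq_nonneg _) h2
  have h5 := ENNReal.toReal_le_of_le_ofReal (sq_nonneg _) h3
  have h6 : ‖u a - x‖ ^ 2 ≤ (ε / 2) ^ 2 := by gcongr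
  nlinarith [sq_pos_of_pos hε]

theorem frechetData_B2 (hτ : IsFaithfulNormalSemifiniteTrace N τ) (hD : IsSelfAdjoint D)
    (hDN : IsAffiliated N D) (hp : 0 ≤ p) : FrechetData (B2 N τ D p) (normQ τ D p) where
  zero_mem := zero_mem_B2 hτ hD hDN
  add_mem := fun _ hx _ hy => add_mem_B2 hτ hD hDN hx hy
  smul_mem := fun c _ hx => smul_mem_B2 hτ hD hDN c hx
  mul_mem := fun _ hx _ hy => mul_mem_B2 hτ hD hDN hx hy
  star_mem := fun _ hx => star_mem_B2 hx
  q_add := fun n _ hx _ hy => normQ_add_le hτ hD hDN n hx hy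
  q_smul := fun n c _ hx => normQ_smul hτ hD hDN n c hx
  q_star := fun n x _ => (normQ_star n x).le
  q_mul := fun n => ⟨1, fun x hx y hy => by
    rw [one_mul]; exact normQ_mul_le hτ hD hDN n hx hy⟩
  sep := fun x _ h => norm_le_zero_iff.1 ((norm_le_normQ 1 x).trans (h 1).le)
  complete := fun _ hu hc => exists_limit_B2 hτ hD hDN hp hu hc

end SquareIntegrable

/-! ### The projective seminorms on the span of the products -/

section Projective

variable {H : Type*} [NormedAddCommGroup H] [InnerProductSpace ℂ H] [CompleteSpace H]
variable {N : VonNeumannAlgebra H} {τ : (H →L[ℂ] H) → ℝ≥0∞} {D : H →ₗ.[ℂ] H} {p : ℝ}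

theorem sum_mul_mem_B2Sq {ι : Type*} [Fintype ι] {R S : ι → (H →L[ℂ] H)}
    (hR : ∀ i, R i ∈ B2 N τ D p) (hS : ∀ i, S i ∈ B2 N τ D p) :
    ∑ i, R i * S i ∈ B2Sq N τ D p :=
  Submodule.sum_mem _ fun i _ => Submodule.subset_span ⟨R i, hR i, S i, hS i, rfl⟩

theorem normPSq_sum_le {ι : Type*} [Fintype ι] {R S : ι → (H →L[ℂ] H)}
    (hR : ∀ i, R i ∈ B2 N τ D p) (hS : ∀ i, S i ∈ B2 N τ D p) (n : ℕ+) :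
    normPSq N τ D p n (∑ i, R i * S i) ≤ ∑ i, normQ τ D p n (R i) * normQ τ D p n (S i) := by
  refine csInf_le ⟨0, ?_⟩ ?_
  · rintro c ⟨k, R, S, -, -, -, rfl⟩
    exact Finset.sum_nonneg fun i _ => mul_nonneg (normQ_nonneg _ _) (normQ_nonneg _ _)
  · let e := (Fintype.equivFin ι).symm
    refine ⟨Fintype.card ι, R ∘ e, S ∘ e, fun i => hR _, fun i => hS _, ?_, ?_⟩
    · exact (Equiv.sum_comp e fun i => R i * S i).symm
    · exact (Equiv.sum_comp e fun i => normQ τ D p n (R i) * normQ τ D p n (S i)).symm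

theorem exists_eq_sum_mul (hτ : IsFaithfulNormalSemifiniteTrace N τ) (hD : IsSelfAdjoint D)
    (hDN : IsAffiliated N D) {T : H →L[ℂ] H} (hT : T ∈ B2Sq N τ D p) :
    ∃ (k : ℕ) (R S : Fin k → (H →L[ℂ] H)), (∀ i, R i ∈ B2 N τ D p) ∧ (∀ i, S i ∈ B2 N τ D p) ∧
      T = ∑ i, R i * S i := by
  refine Submodule.span_induction ?_ ?_ ?_ ?_ hT
  · rintro x ⟨R, hR, S, hS, rfl⟩
    exact ⟨1, fun _ => R, fun _ => S, fun _ => hR, fun _ => hS, by simp⟩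
  · exact ⟨0, Fin.elim0, Fin.elim0, fun i => i.elim0, fun i => i.elim0, by simp⟩
  · rintro x y - - ⟨k, R, S, hR, hS, rfl⟩ ⟨k', R', S', hR', hS', rfl⟩
    refine ⟨k + k', Fin.append R R', Fin.append S S', fun i => ?_, fun i => ?_, ?_⟩
    · refine Fin.addCases (fun i => ?_) (fun i => ?_) i <;> simp [hR, hR']
    · refine Fin.addCases (fun i => ?_) (fun i => ?_) i <;> simp [hS, hS']
    · simp [Fin.sum_univ_add]
  · rintro c x - ⟨k, R, S, hR, hS, rfl⟩
    exact ⟨k, fun i => c • R i, S, fun i => smul_mem_B2 hτ hD hDN c (hR i), hS, by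
      simp [Finset.smul_sum]⟩

theorem exists_eq_sum_mul_lt (hτ : IsFaithfulNormalSemifiniteTrace N τ) (hD : IsSelfAdjoint D)
    (hDN : IsAffiliated N D) {T : H →L[ℂ] H} (hT : T ∈ B2Sq N τ D p) (n : ℕ+) {c : ℝ}
    (hc : normPSq N τ D p n T < c) :
    ∃ (k : ℕ) (R S : Fin k → (H →L[ℂ] H)), (∀ i, R i ∈ B2 N τ D p) ∧ (∀ i, S i ∈ B2 N τ D p) ∧
      T = ∑ i, R i * S i ∧ ∑ i, normQ τ D p n (R i) * normQ τ D p n (S i) < c := by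
  obtain ⟨k, R, S, hR, hS, hT'⟩ := exists_eq_sum_mul hτ hD hDN hT
  obtain ⟨_, ⟨k, R, S, hR, hS, hT, rfl⟩, hlt⟩ := exists_lt_of_csInf_lt
    (by exact ⟨_, k, R, S, hR, hS, hT', rfl⟩) hc
  exact ⟨k, R, S, hR, hS, hT, hlt⟩

/-- The properties of the seminorms `P_n` on `B₂(D, p)²` from which those of the completion
follow. -/
structure IsProjective (N : VonNeumannAlgebra H) (τ : (H →L[ℂ] H) → ℝ≥0∞) (D : H →ₗ.[ℂ] H)
    (p : ℝ) : Prop where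
  mem_vonNeumann : ∀ x ∈ B2Sq N τ D p, x ∈ N
  norm_le : ∀ n, ∀ x ∈ B2Sq N τ D p, ‖x‖ ≤ normPSq N τ D p n x
  add_le : ∀ n, ∀ x ∈ B2Sq N τ D p, ∀ y ∈ B2Sq N τ D p,
    normPSq N τ D p n (x + y) ≤ normPSq N τ D p n x + normPSq N τ D p n y
  smul_le : ∀ n, ∀ (c : ℂ), ∀ x ∈ B2Sq N τ D p,
    normPSq N τ D p n (c • x) ≤ ‖c‖ * normPSq N τ D p n x
  mono : ∀ m n, m ≤ n → ∀ x ∈ B2Sq N τ D p, normPSq N τ D p m x ≤ normPSq N τ D p n x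
  star_mem : ∀ x ∈ B2Sq N τ D p, star x ∈ B2Sq N τ D p
  star_le : ∀ n, ∀ x ∈ B2Sq N τ D p, normPSq N τ D p n (star x) ≤ normPSq N τ D p n x
  mul_mem : ∀ x ∈ B2Sq N τ D p, ∀ X ∈ N, ∀ y ∈ B2Sq N τ D p, x * X * y ∈ B2Sq N τ D p
  mul_le : ∀ n, ∀ x ∈ B2Sq N τ D p, ∀ X ∈ N, ∀ y ∈ B2Sq N τ D p, normPSq N τ D p n (x * X * y) ≤
    ‖X‖ * (normPSq N τ D p n x * normPSq N τ D p n y)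

theorem sum_mul_mul_sum_mul {R : Type*} [Ring R] {k k' : ℕ} (A B : Fin k → R)
    (A' B' : Fin k' → R) (X : R) :
    (∑ i, A i * B i) * X * ∑ j, A' j * B' j =
      ∑ z : Fin k × Fin k', A z.1 * (B z.1 * X * (A' z.2 * B' z.2)) := by
  rw [Fintype.sum_prod_type, Finset.sum_mul, Finset.sum_mul]
  refine Finset.sum_congr rfl fun i _ => ?_
  rw [Finset.mul_sum]
  exact Finset.sum_congr rfl fun j _ => by simp only [mul_assoc]

theorem isProjective (hτ : IsFaithfulNormalSemifiniteTrace N τ) (hD : IsSelfAdjoint D)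
    (hDN : IsAffiliated N D) (hp : 0 ≤ p) : IsProjective N τ D p where
  mem_vonNeumann := fun x hx => by
    obtain ⟨k, R, S, hR, hS, rfl⟩ := exists_eq_sum_mul hτ hD hDN hx
    exact sum_mem fun i _ => mul_mem (mem_B2_iff.1 (hR i)).1 (mem_B2_iff.1 (hS i)).1
  norm_le := fun n x hx => by
    refine le_of_forall_gt fun c hc => ?_
    obtain ⟨k, R, S, hR, hS, rfl, hlt⟩ := exists_eq_sum_mul_lt hτ hD hDN hx n hc
    refine lt_of_le_of_lt ?_ hlt
    refine (norm_sum_le _ _).trans (Finset.sum_le_sum fun i _ => (norm_mul_le _ _).trans ?_)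
    exact mul_le_mul (norm_le_normQ n _) (norm_le_normQ n _) (norm_nonneg _) (normQ_nonneg _ _)
  add_le := fun n x hx y hy => by
    refine le_of_forall_pos_le_add fun ε hε => ?_
    obtain ⟨k, R, S, hR, hS, hxe, hlt⟩ := exists_eq_sum_mul_lt hτ hD hDN hx n
      (lt_add_of_pos_right _ (half_pos hε))
    obtain ⟨k', R', S', hR', hS', hye, hlt'⟩ := exists_eq_sum_mul_lt hτ hD hDN hy n
      (lt_add_of_pos_right _ (half_pos hε))
    have h := normPSq_sum_le (N := N) (τ := τ) (D := D) (p := p) (R := Sum.elim R R')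
      (S := Sum.elim S S') (by rintro (i | i); exacts [hR i, hR' i])
      (by rintro (i | i); exacts [hS i, hS' i]) n
    simp only [Fintype.sum_sum_type, Sum.elim_inl, Sum.elim_inr, ← hxe, ← hye] at h
    linarith
  smul_le := fun n c x hx => by
    refine le_of_forall_pos_le_add fun ε hε => ?_
    have hc : 0 < ‖c‖ + 1 := by positivity
    obtain ⟨k, R, S, hR, hS, hxe, hlt⟩ := exists_eq_sum_mul_lt hτ hD hDN hx n
      (lt_add_of_pos_right _ (div_pos hε hc))
    have h := normPSq_sum_le (fun i => smul_mem_B2 hτ hD hDN c (hR i)) hS n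
    simp only [smul_mul_assoc, ← Finset.smul_sum, ← hxe] at h
    refine h.trans ?_
    have h2 : ∑ i, normQ τ D p n (c • R i) * normQ τ D p n (S i) =
        ‖c‖ * ∑ i, normQ τ D p n (R i) * normQ τ D p n (S i) := by
      rw [Finset.mul_sum]
      exact Finset.sum_congr rfl fun i _ => by rw [normQ_smul hτ hD hDN n c (hR i), mul_assoc]
    rw [h2]
    refine (mul_le_mul_of_nonneg_left hlt.le (norm_nonneg c)).trans ?_
    rw [mul_add]
    gcongr
    calc ‖c‖ * (ε / (‖c‖ + 1)) ≤ (‖c‖ + 1) * (ε / (‖c‖ + 1)) := by gcongr; linarith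
      _ = ε := by field_simp
  mono := fun m n hmn x hx => by
    refine le_of_forall_gt fun c hc => ?_
    obtain ⟨k, R, S, hR, hS, rfl, hlt⟩ := exists_eq_sum_mul_lt hτ hD hDN hx n hc
    refine lt_of_le_of_lt ((normPSq_sum_le hR hS m).trans ?_) hlt
    exact Finset.sum_le_sum fun i _ => mul_le_mul (normQ_mono hτ hD hDN hp hmn (hR i))
      (normQ_mono hτ hD hDN hp hmn (hS i)) (normQ_nonneg _ _) (normQ_nonneg _ _)
  star_mem := fun x hx => by
    obtain ⟨k, R, S, hR, hS, rfl⟩ := exists_eq_sum_mul hτ hD hDN hx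
    simp only [star_sum, star_mul]
    exact sum_mul_mem_B2Sq (fun i => star_mem_B2 (hS i)) (fun i => star_mem_B2 (hR i))
  star_le := fun n x hx => by
    refine le_of_forall_gt fun c hc => ?_
    obtain ⟨k, R, S, hR, hS, rfl, hlt⟩ := exists_eq_sum_mul_lt hτ hD hDN hx n hc
    simp only [star_sum, star_mul]
    refine lt_of_le_of_lt ((normPSq_sum_le (fun i => star_mem_B2 (hS i))
      (fun i => star_mem_B2 (hR i)) n).trans (le_of_eq ?_)) hlt
    exact Finset.sum_congr rfl fun i _ => by rw [normQ_star, normQ_star, mul_comm]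
  mul_mem := fun x hx X hX y hy => by
    obtain ⟨k, R, S, hR, hS, rfl⟩ := exists_eq_sum_mul hτ hD hDN hx
    obtain ⟨k', R', S', hR', hS', rfl⟩ := exists_eq_sum_mul hτ hD hDN hy
    rw [sum_mul_mul_sum_mul]
    exact sum_mul_mem_B2Sq (fun z => hR z.1) fun z => mul_mul_mem_B2 hτ hD hDN (hS z.1) hX
      (mul_mem_B2 hτ hD hDN (hR' z.2) (hS' z.2))
  mul_le := fun n x hx X hX y hy => by
    -- The bound holds with `a > P_n(x)` and `b > P_n(y)` in place of the seminorms.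
    have key : ∀ a > normPSq N τ D p n x, ∀ b > normPSq N τ D p n y,
        normPSq N τ D p n (x * X * y) ≤ ‖X‖ * (a * b) := by
      intro a ha b hb
      obtain ⟨k, R, S, hR, hS, hxe, hlt⟩ := exists_eq_sum_mul_lt hτ hD hDN hx n ha
      obtain ⟨k', R', S', hR', hS', hye, hlt'⟩ := exists_eq_sum_mul_lt hτ hD hDN hy n hb
      have h := normPSq_sum_le (R := fun z : Fin k × Fin k' => R z.1)
        (S := fun z : Fin k × Fin k' => S z.1 * X * (R' z.2 * S' z.2)) (fun z => hR z.1)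
        (fun z => mul_mul_mem_B2 hτ hD hDN (hS z.1) hX
          (mul_mem_B2 hτ hD hDN (hR' z.2) (hS' z.2))) n
      rw [← sum_mul_mul_sum_mul, ← hxe, ← hye] at h
      refine h.trans ?_
      have h1 : ∀ z : Fin k × Fin k', normQ τ D p n (R z.1) *
          normQ τ D p n (S z.1 * X * (R' z.2 * S' z.2)) ≤
          ‖X‖ * ((normQ τ D p n (R z.1) * normQ τ D p n (S z.1)) *
            (normQ τ D p n (R' z.2) * normQ τ D p n (S' z.2))) := by
        intro z
        have e1 := normQ_mul_mul_le hτ hD hDN n (hS z.1) hX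
          (mul_mem_B2 hτ hD hDN (hR' z.2) (hS' z.2))
        have e2 := normQ_mul_le hτ hD hDN n (hR' z.2) (hS' z.2)
        have q1 := normQ_nonneg (τ := τ) (D := D) (p := p) n (R z.1)
        have q2 := normQ_nonneg (τ := τ) (D := D) (p := p) n (S z.1)
        calc _ ≤ normQ τ D p n (R z.1) * (‖X‖ * (normQ τ D p n (S z.1) *
              (normQ τ D p n (R' z.2) * normQ τ D p n (S' z.2)))) := by
              refine mul_le_mul_of_nonneg_left (e1.trans ?_) q1
              gcongr
          _ = _ := by ring
      refine (Finset.sum_le_sum fun z _ => h1 z).trans ?_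
      rw [← Finset.mul_sum, Fintype.sum_prod_type]
      simp only [← Finset.mul_sum, ← Finset.sum_mul]
      have q1 : 0 ≤ ∑ i, normQ τ D p n (R i) * normQ τ D p n (S i) :=
        Finset.sum_nonneg fun i _ => mul_nonneg (normQ_nonneg _ _) (normQ_nonneg _ _)
      have q2 : 0 ≤ ∑ i, normQ τ D p n (R' i) * normQ τ D p n (S' i) :=
        Finset.sum_nonneg fun i _ => mul_nonneg (normQ_nonneg _ _) (normQ_nonneg _ _)
      gcongr
      exact q1.trans hlt.le
    have ht : Tendsto (fun ε : ℝ => ‖X‖ * ((normPSq N τ D p n x + ε) *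
        (normPSq N τ D p n y + ε))) (𝓝[>] 0)
        (𝓝 (‖X‖ * ((normPSq N τ D p n x + 0) * (normPSq N τ D p n y + 0)))) := by
      refine Tendsto.mono_left (Continuous.tendsto ?_ 0) nhdsWithin_le_nhds
      fun_prop
    rw [add_zero, add_zero] at ht
    refine ge_of_tendsto ht ?_
    filter_upwards [self_mem_nhdsWithin] with ε hε
    exact key _ (lt_add_of_pos_right _ hε) _ (lt_add_of_pos_right _ hε)

end Projective

/-! ### The completion in the von Neumann algebra -/

section Completion

variable {H : Type*} [NormedAddCommGroup H] [InnerProductSpace ℂ H] [CompleteSpace H]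
variable {N : VonNeumannAlgebra H} {τ : (H →L[ℂ] H) → ℝ≥0∞} {D : H →ₗ.[ℂ] H} {p : ℝ}

namespace IsProjective

theorem nonneg (h : IsProjective N τ D p) (n : ℕ+) {x : H →L[ℂ] H} (hx : x ∈ B2Sq N τ D p) :
    0 ≤ normPSq N τ D p n x :=
  (norm_nonneg x).trans (h.norm_le n x hx)

theorem neg_le (h : IsProjective N τ D p) (n : ℕ+) {x : H →L[ℂ] H} (hx : x ∈ B2Sq N τ D p) :
    normPSq N τ D p n (-x) ≤ normPSq N τ D p n x := by
  simpa using h.smul_le n (-1) x hx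

theorem sub_le (h : IsProjective N τ D p) (n : ℕ+) {x y : H →L[ℂ] H} (hx : x ∈ B2Sq N τ D p)
    (hy : y ∈ B2Sq N τ D p) :
    normPSq N τ D p n (x - y) ≤ normPSq N τ D p n x + normPSq N τ D p n y := by
  rw [sub_eq_add_neg]
  exact (h.add_le n x hx _ (neg_mem hy)).trans (add_le_add_right (h.neg_le n hy) _)

theorem abs_sub_le (h : IsProjective N τ D p) (n : ℕ+) {x y : H →L[ℂ] H} (hx : x ∈ B2Sq N τ D p)
    (hy : y ∈ B2Sq N τ D p) :
    |normPSq N τ D p n x - normPSq N τ D p n y| ≤ normPSq N τ D p n (x - y) := by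
  have h1 := h.add_le n _ (sub_mem hx hy) y hy
  have h2 := h.add_le n _ (sub_mem hy hx) x hx
  have h3 := h.neg_le n (sub_mem hx hy)
  rw [sub_add_cancel] at h1 h2
  rw [neg_sub] at h3
  rw [abs_sub_le_iff]
  constructor <;> linarith

theorem exists_tendsto (h : IsProjective N τ D p) (n : ℕ+) {u : ℕ → (H →L[ℂ] H)} {T : H →L[ℂ] H}
    (hu : Represents N τ D p u T) :
    ∃ c, Tendsto (fun k => normPSq N τ D p n (u k)) atTop (𝓝 c) := by
  refine cauchySeq_tendsto_of_complete (Metric.cauchySeq_iff.2 fun ε hε => ?_)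
  obtain ⟨K, hK⟩ := hu.cauchy n ε hε
  refine ⟨K, fun a ha b hb => ?_⟩
  rw [Real.dist_eq]
  exact (h.abs_sub_le n (hu.mem a) (hu.mem b)).trans_lt (hK a ha b hb)

theorem normP_le_of_eventually (h : IsProjective N τ D p) (n : ℕ+) {u : ℕ → (H →L[ℂ] H)}
    {T : H →L[ℂ] H} (hu : Represents N τ D p u T) {M : ℝ}
    (hM : ∀ᶠ k in atTop, normPSq N τ D p n (u k) ≤ M) : normP N τ D p n T ≤ M := by
  obtain ⟨c, hc⟩ := h.exists_tendsto n hu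
  refine le_trans (csInf_le ⟨0, ?_⟩ ⟨u, hu, hc⟩) (le_of_tendsto hc hM)
  rintro d ⟨v, hv, hd⟩
  exact ge_of_tendsto' hd fun k => h.nonneg n (hv.mem k)

theorem _root_.WeightIntegration.Represents.comp {u : ℕ → (H →L[ℂ] H)} {T : H →L[ℂ] H}
    (hu : Represents N τ D p u T) {φ : ℕ → ℕ} (hφ : Tendsto φ atTop atTop) :
    Represents N τ D p (u ∘ φ) T where
  mem := fun k => hu.mem _
  cauchy := fun n ε hε => by
    obtain ⟨K, hK⟩ := hu.cauchy n ε hε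
    obtain ⟨L, hL⟩ := eventually_atTop.1 (hφ.eventually_ge_atTop K)
    exact ⟨L, fun i hi j hj => hK _ (hL i hi) _ (hL j hj)⟩
  tendsto := hu.tendsto.comp hφ

theorem exists_represents_lt (h : IsProjective N τ D p) (n : ℕ+) {T : H →L[ℂ] H}
    (hT : T ∈ B1 N τ D p) {ε : ℝ} (hε : normP N τ D p n T < ε) :
    ∃ u, Represents N τ D p u T ∧ ∀ k, normPSq N τ D p n (u k) < ε := by
  obtain ⟨v, hv⟩ := hT
  obtain ⟨c, hc⟩ := h.exists_tendsto n hv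
  obtain ⟨d, ⟨u, hu, hd⟩, hdε⟩ := exists_lt_of_csInf_lt (by exact ⟨c, v, hv, hc⟩) hε
  obtain ⟨K, hK⟩ := eventually_atTop.1 (hd.eventually (gt_mem_nhds hdε))
  refine ⟨u ∘ fun k => k + K, hu.comp (tendsto_add_atTop_nat K), fun k => hK _ (Nat.le_add_left K k)⟩

theorem represents_add (h : IsProjective N τ D p) {u v : ℕ → (H →L[ℂ] H)} {S T : H →L[ℂ] H}
    (hu : Represents N τ D p u S) (hv : Represents N τ D p v T) :
    Represents N τ D p (fun k => u k + v k) (S + T) where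
  mem := fun k => add_mem (hu.mem k) (hv.mem k)
  cauchy := fun n ε hε => by
    obtain ⟨K, hK⟩ := hu.cauchy n (ε / 2) (by positivity)
    obtain ⟨L, hL⟩ := hv.cauchy n (ε / 2) (by positivity)
    refine ⟨max K L, fun i hi j hj => ?_⟩
    have h1 := hK i (le_of_max_le_left hi) j (le_of_max_le_left hj)
    have h2 := hL i (le_of_max_le_right hi) j (le_of_max_le_right hj)
    have h3 := h.add_le n _ (sub_mem (hu.mem i) (hu.mem j)) _ (sub_mem (hv.mem i) (hv.mem j))
    rw [add_sub_add_comm]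
    linarith
  tendsto := hu.tendsto.add hv.tendsto

theorem represents_smul (h : IsProjective N τ D p) (c : ℂ) {u : ℕ → (H →L[ℂ] H)} {T : H →L[ℂ] H}
    (hu : Represents N τ D p u T) : Represents N τ D p (fun k => c • u k) (c • T) where
  mem := fun k => Submodule.smul_mem _ c (hu.mem k)
  cauchy := fun n ε hε => by
    have hc : 0 < ‖c‖ + 1 := by positivity
    obtain ⟨K, hK⟩ := hu.cauchy n (ε / (‖c‖ + 1)) (by positivity)
    refine ⟨K, fun i hi j hj => ?_⟩
    have h1 := hK i hi j hj
    have hm := sub_mem (hu.mem i) (hu.mem j)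
    rw [← smul_sub]
    rw [lt_div_iff₀ hc] at h1
    have h2 := h.smul_le n c _ hm
    have h3 := h.nonneg n hm
    nlinarith
  tendsto := hu.tendsto.const_smul c

theorem represents_sub (h : IsProjective N τ D p) {u v : ℕ → (H →L[ℂ] H)} {S T : H →L[ℂ] H}
    (hu : Represents N τ D p u S) (hv : Represents N τ D p v T) :
    Represents N τ D p (fun k => u k - v k) (S - T) := by
  have h1 := h.represents_add hu (h.represents_smul (-1) hv)
  simpa only [neg_smul, one_smul, ← sub_eq_add_neg] using h1

theorem represents_star (h : IsProjective N τ D p) {u : ℕ → (H →L[ℂ] H)} {T : H →L[ℂ] H}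
    (hu : Represents N τ D p u T) : Represents N τ D p (fun k => star (u k)) (star T) where
  mem := fun k => h.star_mem _ (hu.mem k)
  cauchy := fun n ε hε => by
    obtain ⟨K, hK⟩ := hu.cauchy n ε hε
    refine ⟨K, fun i hi j hj => ?_⟩
    rw [← star_sub]
    exact (h.star_le n _ (sub_mem (hu.mem i) (hu.mem j))).trans_lt (hK i hi j hj)
  tendsto := hu.tendsto.star

theorem represents_mul (h : IsProjective N τ D p) {u v : ℕ → (H →L[ℂ] H)} {S X T : H →L[ℂ] H}
    (hu : Represents N τ D p u S) (hX : X ∈ N) (hv : Represents N τ D p v T) :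
    Represents N τ D p (fun k => u k * X * v k) (S * X * T) where
  mem := fun k => h.mul_mem _ (hu.mem k) X hX _ (hv.mem k)
  cauchy := fun n ε hε => by
    obtain ⟨a, ha⟩ := h.exists_tendsto n hu
    obtain ⟨b, hb⟩ := h.exists_tendsto n hv
    have ha0 : 0 ≤ a := ge_of_tendsto' ha fun k => h.nonneg n (hu.mem k)
    have hb0 : 0 ≤ b := ge_of_tendsto' hb fun k => h.nonneg n (hv.mem k)
    obtain ⟨K₁, hK₁⟩ := eventually_atTop.1 (ha.eventually (gt_mem_nhds (lt_add_one a)))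
    obtain ⟨K₂, hK₂⟩ := eventually_atTop.1 (hb.eventually (gt_mem_nhds (lt_add_one b)))
    have hM : 0 < (‖X‖ + 1) * (a + b + 2) := by positivity
    obtain ⟨K, hK⟩ := hu.cauchy n (ε / ((‖X‖ + 1) * (a + b + 2))) (by positivity)
    obtain ⟨L, hL⟩ := hv.cauchy n (ε / ((‖X‖ + 1) * (a + b + 2))) (by positivity)
    refine ⟨max (max K₁ K₂) (max K L), fun i hi j hj => ?_⟩
    simp only [ge_iff_le, max_le_iff] at hi hj
    have mu := sub_mem (hu.mem i) (hu.mem j)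
    have mv := sub_mem (hv.mem i) (hv.mem j)
    have e : u i * X * v i - u j * X * v j =
        (u i - u j) * X * v i + u j * X * (v i - v j) := by
      rw [sub_mul, sub_mul, mul_sub, sub_add_sub_cancel]
    have h1 := h.add_le n _ (h.mul_mem _ mu X hX _ (hv.mem i)) _
      (h.mul_mem _ (hu.mem j) X hX _ mv)
    have h2 := h.mul_le n _ mu X hX _ (hv.mem i)
    have h3 := h.mul_le n _ (hu.mem j) X hX _ mv
    have g1 := hK i hi.2.1 j hj.2.1
    have g2 := hL i hi.2.2 j hj.2.2
    have g3 := hK₁ j hj.1.1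
    have g4 := hK₂ i hi.1.2
    have n1 := h.nonneg n mu
    have n2 := h.nonneg n mv
    have n3 := h.nonneg n (hu.mem j)
    have n4 := h.nonneg n (hv.mem i)
    set η := ε / ((‖X‖ + 1) * (a + b + 2)) with hη
    have hη0 : 0 < η := by positivity
    have m1 : normPSq N τ D p n (u i - u j) * normPSq N τ D p n (v i) ≤ η * (b + 1) :=
      mul_le_mul g1.le g4.le n4 hη0.le
    have m2 : normPSq N τ D p n (u j) * normPSq N τ D p n (v i - v j) ≤ (a + 1) * η :=
      mul_le_mul g3.le g2.le n2 (by positivity)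
    have m3 := mul_le_mul_of_nonneg_left (add_le_add m1 m2) (norm_nonneg X)
    have m4 : ‖X‖ * (η * (b + 1) + (a + 1) * η) < ε := by
      have e1 : (‖X‖ + 1) * (a + b + 2) * η = ε := by rw [hη]; field_simp
      have e2 : 0 < (a + b + 2) * η := by positivity
      nlinarith
    rw [e]
    linarith
  tendsto := (hu.tendsto.mul_const X).mul hv.tendsto

theorem zero_mem_B1 (h : IsProjective N τ D p) : (0 : H →L[ℂ] H) ∈ B1 N τ D p :=
  ⟨fun _ => 0, fun _ => zero_mem _, fun n ε hε => ⟨0, fun i _ j _ => by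
    have h1 := h.smul_le n 0 0 (zero_mem _)
    simp only [zero_smul, norm_zero, zero_mul] at h1
    simpa using h1.trans_lt hε⟩, tendsto_const_nhds⟩

theorem add_mem_B1 (h : IsProjective N τ D p) {S T : H →L[ℂ] H} (hS : S ∈ B1 N τ D p)
    (hT : T ∈ B1 N τ D p) : S + T ∈ B1 N τ D p :=
  ⟨_, h.represents_add hS.choose_spec hT.choose_spec⟩

theorem smul_mem_B1 (h : IsProjective N τ D p) (c : ℂ) {T : H →L[ℂ] H} (hT : T ∈ B1 N τ D p) :
    c • T ∈ B1 N τ D p :=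
  ⟨_, h.represents_smul c hT.choose_spec⟩

theorem sub_mem_B1 (h : IsProjective N τ D p) {S T : H →L[ℂ] H} (hS : S ∈ B1 N τ D p)
    (hT : T ∈ B1 N τ D p) : S - T ∈ B1 N τ D p :=
  ⟨_, h.represents_sub hS.choose_spec hT.choose_spec⟩

theorem star_mem_B1 (h : IsProjective N τ D p) {T : H →L[ℂ] H} (hT : T ∈ B1 N τ D p) :
    star T ∈ B1 N τ D p :=
  ⟨_, h.represents_star hT.choose_spec⟩

/-- The algebra `B₁` is a quasi-ideal: `B₁ N B₁ ⊆ B₁`. -/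
theorem mul_mul_mem_B1 (h : IsProjective N τ D p) {S X T : H →L[ℂ] H} (hS : S ∈ B1 N τ D p)
    (hX : X ∈ N) (hT : T ∈ B1 N τ D p) : S * X * T ∈ B1 N τ D p :=
  ⟨_, h.represents_mul hS.choose_spec hX hT.choose_spec⟩

theorem mem_vonNeumann_of_mem_B1 (h : IsProjective N τ D p) {T : H →L[ℂ] H}
    (hT : T ∈ B1 N τ D p) : T ∈ N := by
  obtain ⟨u, hu⟩ := hT
  exact (isClosed_vonNeumann N).mem_of_tendsto hu.tendsto
    (Eventually.of_forall fun k => h.mem_vonNeumann _ (hu.mem k))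

theorem norm_le_normP (h : IsProjective N τ D p) (n : ℕ+) {T : H →L[ℂ] H}
    (hT : T ∈ B1 N τ D p) : ‖T‖ ≤ normP N τ D p n T := by
  refine le_of_forall_gt_imp_ge_of_dense fun c hc => ?_
  obtain ⟨u, hu, hlt⟩ := h.exists_represents_lt n hT hc
  exact _root_.le_of_tendsto hu.tendsto.norm
    (Eventually.of_forall fun k => (h.norm_le n _ (hu.mem k)).trans (hlt k).le)

theorem normP_nonneg (h : IsProjective N τ D p) (n : ℕ+) {T : H →L[ℂ] H}
    (hT : T ∈ B1 N τ D p) : 0 ≤ normP N τ D p n T :=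
  (norm_nonneg T).trans (h.norm_le_normP n hT)

theorem normP_add_le (h : IsProjective N τ D p) (n : ℕ+) {S T : H →L[ℂ] H}
    (hS : S ∈ B1 N τ D p) (hT : T ∈ B1 N τ D p) :
    normP N τ D p n (S + T) ≤ normP N τ D p n S + normP N τ D p n T := by
  refine le_of_forall_pos_le_add fun ε hε => ?_
  obtain ⟨u, hu, hu'⟩ := h.exists_represents_lt n hS (lt_add_of_pos_right _ (half_pos hε))
  obtain ⟨v, hv, hv'⟩ := h.exists_represents_lt n hT (lt_add_of_pos_right _ (half_pos hε))
  refine h.normP_le_of_eventually n (h.represents_add hu hv) (Eventually.of_forall fun k => ?_)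
  have h1 := h.add_le n _ (hu.mem k) _ (hv.mem k)
  have h2 := hu' k
  have h3 := hv' k
  linarith

theorem normP_smul_le (h : IsProjective N τ D p) (n : ℕ+) (c : ℂ) {T : H →L[ℂ] H}
    (hT : T ∈ B1 N τ D p) : normP N τ D p n (c • T) ≤ ‖c‖ * normP N τ D p n T := by
  refine le_of_forall_pos_le_add fun ε hε => ?_
  have hc : 0 < ‖c‖ + 1 := by positivity
  obtain ⟨u, hu, hu'⟩ := h.exists_represents_lt n hT (lt_add_of_pos_right _ (div_pos hε hc))
  refine h.normP_le_of_eventually n (h.represents_smul c hu) (Eventually.of_forall fun k => ?_)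
  refine (h.smul_le n c _ (hu.mem k)).trans
    ((mul_le_mul_of_nonneg_left (hu' k).le (norm_nonneg c)).trans ?_)
  rw [mul_add]
  gcongr
  calc ‖c‖ * (ε / (‖c‖ + 1)) ≤ (‖c‖ + 1) * (ε / (‖c‖ + 1)) := by gcongr; linarith
    _ = ε := by field_simp

theorem normP_smul (h : IsProjective N τ D p) (n : ℕ+) (c : ℂ) {T : H →L[ℂ] H}
    (hT : T ∈ B1 N τ D p) : normP N τ D p n (c • T) = ‖c‖ * normP N τ D p n T := by
  refine le_antisymm (h.normP_smul_le n c hT) ?_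
  rcases eq_or_ne c 0 with rfl | hc
  · rw [norm_zero, zero_mul]
    exact h.normP_nonneg n (h.smul_mem_B1 0 hT)
  · have h1 := h.normP_smul_le n c⁻¹ (h.smul_mem_B1 c hT)
    rw [inv_smul_smul₀ hc, norm_inv] at h1
    have hc' : 0 < ‖c‖ := norm_pos_iff.2 hc
    rwa [← div_eq_inv_mul, le_div_iff₀' hc'] at h1

theorem normP_star_le (h : IsProjective N τ D p) (n : ℕ+) {T : H →L[ℂ] H}
    (hT : T ∈ B1 N τ D p) : normP N τ D p n (star T) ≤ normP N τ D p n T := by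
  refine le_of_forall_gt_imp_ge_of_dense fun c hc => ?_
  obtain ⟨u, hu, hlt⟩ := h.exists_represents_lt n hT hc
  exact h.normP_le_of_eventually n (h.represents_star hu)
    (Eventually.of_forall fun k => (h.star_le n _ (hu.mem k)).trans (hlt k).le)

theorem normP_mono (h : IsProjective N τ D p) {m n : ℕ+} (hmn : m ≤ n) {T : H →L[ℂ] H}
    (hT : T ∈ B1 N τ D p) : normP N τ D p m T ≤ normP N τ D p n T := by
  refine le_of_forall_gt_imp_ge_of_dense fun c hc => ?_
  obtain ⟨u, hu, hlt⟩ := h.exists_represents_lt n hT hc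
  exact h.normP_le_of_eventually m hu
    (Eventually.of_forall fun k => (h.mono m n hmn _ (hu.mem k)).trans (hlt k).le)

theorem mul_mem_B1 (h : IsProjective N τ D p) {S T : H →L[ℂ] H} (hS : S ∈ B1 N τ D p)
    (hT : T ∈ B1 N τ D p) : S * T ∈ B1 N τ D p := by
  simpa using h.mul_mul_mem_B1 hS (one_mem N) hT

theorem normP_mul_le (h : IsProjective N τ D p) (n : ℕ+) {S T : H →L[ℂ] H}
    (hS : S ∈ B1 N τ D p) (hT : T ∈ B1 N τ D p) :
    normP N τ D p n (S * T) ≤ normP N τ D p n S * normP N τ D p n T := by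
  have key : ∀ a > normP N τ D p n S, ∀ b > normP N τ D p n T,
      normP N τ D p n (S * T) ≤ a * b := by
    intro a ha b hb
    obtain ⟨u, hu, hu'⟩ := h.exists_represents_lt n hS ha
    obtain ⟨v, hv, hv'⟩ := h.exists_represents_lt n hT hb
    have h1 := h.represents_mul hu (one_mem N) hv
    rw [mul_one] at h1
    refine h.normP_le_of_eventually n h1 (Eventually.of_forall fun k => ?_)
    have n1 := h.nonneg n (hu.mem k)
    have n2 := h.nonneg n (hv.mem k)
    refine (h.mul_le n _ (hu.mem k) 1 (one_mem N) _ (hv.mem k)).trans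
      ((mul_le_of_le_one_left (mul_nonneg n1 n2) ContinuousLinearMap.norm_id_le).trans ?_)
    exact mul_le_mul (hu' k).le (hv' k).le n2 (n1.trans (hu' k).le)
  have ht : Tendsto (fun ε : ℝ => (normP N τ D p n S + ε) * (normP N τ D p n T + ε)) (𝓝[>] 0)
      (𝓝 ((normP N τ D p n S + 0) * (normP N τ D p n T + 0))) := by
    refine Tendsto.mono_left (Continuous.tendsto ?_ 0) nhdsWithin_le_nhds
    fun_prop
  rw [add_zero, add_zero] at ht
  refine ge_of_tendsto ht ?_
  filter_upwards [self_mem_nhdsWithin] with ε hε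
  exact key _ (lt_add_of_pos_right _ hε) _ (lt_add_of_pos_right _ hε)

end IsProjective

end Completion

/-! ### Completeness of the algebra of integrable elements -/

section Complete

variable {H : Type*} [NormedAddCommGroup H] [InnerProductSpace ℂ H] [CompleteSpace H]
variable {N : VonNeumannAlgebra H} {τ : (H →L[ℂ] H) → ℝ≥0∞} {D : H →ₗ.[ℂ] H} {p : ℝ}

namespace IsProjective

/-- Completeness of `B₁`. A Cauchy sequence is thinned out and telescoped: representatives `w j` of
its differences are chosen with `P_j(w j i) < 2⁻ʲ` for all `i`, so that the partial sums `v j`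
represent the terms of the thinned sequence and are uniformly close to each other; a diagonal
sequence of the `v j` represents the limit. -/
theorem exists_limit_B1 (h : IsProjective N τ D p) {T : ℕ → (H →L[ℂ] H)}
    (hT : ∀ k, T k ∈ B1 N τ D p)
    (hc : ∀ n, ∀ ε > 0, ∃ K, ∀ a ≥ K, ∀ b ≥ K, normP N τ D p n (T a - T b) < ε) :
    ∃ x ∈ B1 N τ D p, ∀ n, ∀ ε > 0, ∃ K, ∀ a ≥ K, normP N τ D p n (T a - x) < ε := by
  let e : ℕ → ℝ := fun j => (1 / 2) ^ j
  have he : ∀ j, 0 < e j := fun j => by positivity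
  have he1 : ∀ j, e j = 2 * e (j + 1) := fun j => by simp only [e, pow_succ]; ring
  have he0 : Tendsto e atTop (𝓝 0) :=
    tendsto_pow_atTop_nhds_zero_of_lt_one (by norm_num) (by norm_num)
  obtain ⟨φ, hφ, hφT⟩ := extraction_forall_of_eventually'
    (P := fun j k => ∀ a ≥ k, ∀ b ≥ k, normP N τ D p j.succPNat (T a - T b) < e j)
    fun j => by
      obtain ⟨K, hK⟩ := hc j.succPNat (e j) (he j)
      exact ⟨K, fun k hk a ha b hb => hK a (hk.trans ha) b (hk.trans hb)⟩
  have hw : ∀ j, ∃ w, Represents N τ D p w (T (φ (j + 1)) - T (φ j)) ∧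
      ∀ k, normPSq N τ D p j.succPNat (w k) < e j := fun j =>
    h.exists_represents_lt _ (h.sub_mem_B1 (hT _) (hT _))
      (hφT j _ (hφ.monotone (Nat.le_succ j)) _ le_rfl)
  choose w hwr hwe using hw
  obtain ⟨u, hu⟩ := hT (φ 0)
  let v : ℕ → ℕ → (H →L[ℂ] H) := fun j => Nat.rec u (fun l vl i => vl i + w l i) j
  have hv1 : ∀ j i, v (j + 1) i = v j i + w j i := fun j i => rfl
  have hv : ∀ j, Represents N τ D p (v j) (T (φ j)) := by
    intro j
    induction j with
    | zero => exact hu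
    | succ j ih =>
      have := h.represents_add ih (hwr j)
      rwa [add_sub_cancel] at this
  have hmono : ∀ {m n : ℕ}, m ≤ n → m.succPNat ≤ n.succPNat := fun hmn =>
    Nat.succPNat_le_succPNat.2 hmn
  have hvd : ∀ j j', j ≤ j' → ∀ i,
      normPSq N τ D p j.succPNat (v j' i - v j i) ≤ 2 * e j - 2 * e j' := by
    intro j j' hj i
    induction j', hj using Nat.le_induction with
    | base =>
      have h1 := h.smul_le j.succPNat 0 0 (zero_mem _)
      simp only [zero_smul, norm_zero, zero_mul] at h1
      simpa using h1
    | succ l hl ih =>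
      have h1 := h.add_le j.succPNat _ (sub_mem ((hv l).mem i) ((hv j).mem i)) _ ((hwr l).mem i)
      have h2 := h.mono _ _ (hmono hl) _ ((hwr l).mem i)
      have h3 := hwe l i
      have h4 := he1 l
      rw [hv1, add_sub_right_comm]
      linarith
  obtain ⟨ψ, hψ, hψv⟩ := extraction_forall_of_eventually'
    (P := fun j k => ∀ a ≥ k, ∀ b ≥ k, normPSq N τ D p j.succPNat (v j a - v j b) < e j)
    fun j => by
      obtain ⟨K, hK⟩ := (hv j).cauchy j.succPNat (e j) (he j)
      exact ⟨K, fun k hk a ha b hb => hK a (hk.trans ha) b (hk.trans hb)⟩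
  let x : ℕ → (H →L[ℂ] H) := fun j => v j (ψ j)
  have hxm : ∀ j, x j ∈ B2Sq N τ D p := fun j => (hv j).mem _
  have hxd : ∀ j j', j ≤ j' → normPSq N τ D p j.succPNat (x j' - x j) ≤ 3 * e j := by
    intro j j' hj
    have h1 := hvd j j' hj (ψ j')
    have h2 := hψv j (ψ j') (hψ.monotone hj) (ψ j) le_rfl
    have h3 := h.add_le j.succPNat _ (sub_mem ((hv j').mem (ψ j')) ((hv j).mem (ψ j'))) _
      (sub_mem ((hv j).mem (ψ j')) ((hv j).mem (ψ j)))
    rw [sub_add_sub_cancel] at h3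
    have h4 := he j'
    change normPSq N τ D p j.succPNat (v j' (ψ j') - v j (ψ j)) ≤ _
    linarith
  have hcau : CauchySeq T := by
    refine Metric.cauchySeq_iff.2 fun ε hε => ?_
    obtain ⟨K, hK⟩ := hc 1 ε hε
    refine ⟨K, fun a ha b hb => ?_⟩
    rw [dist_eq_norm]
    exact (h.norm_le_normP 1 (h.sub_mem_B1 (hT a) (hT b))).trans_lt (hK a ha b hb)
  obtain ⟨S, hS⟩ := cauchySeq_tendsto_of_complete hcau
  have hxS : Tendsto x atTop (𝓝 S) := by
    have h1 : ∀ j, ‖x j - T (φ j)‖ ≤ e j := fun j => by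
      refine _root_.le_of_tendsto ((tendsto_const_nhds (x := x j)).sub (hv j).tendsto).norm ?_
      filter_upwards [eventually_ge_atTop (ψ j)] with a ha
      exact (h.norm_le j.succPNat _ (sub_mem (hxm j) ((hv j).mem a))).trans
        (hψv j (ψ j) le_rfl a ha).le
    have h2 : Tendsto (fun j => x j - T (φ j)) atTop (𝓝 0) :=
      squeeze_zero_norm h1 he0
    have h3 := h2.add (hS.comp hφ.tendsto_atTop)
    simpa using h3
  have hsmall : ∀ (n : ℕ+) (ε : ℝ), 0 < ε → ∃ J : ℕ, n ≤ J.succPNat ∧ 6 * e J < ε := by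
    intro n ε hε
    obtain ⟨J, hJ⟩ := eventually_atTop.1 (he0.eventually (gt_mem_nhds (by positivity : 0 < ε / 6)))
    refine ⟨max J n, ?_, ?_⟩
    · rw [← PNat.coe_le_coe, Nat.succPNat_coe]
      exact (le_max_right J (n : ℕ)).trans (Nat.le_succ _)
    · have := hJ (max J n) (le_max_left _ _)
      linarith
  have hx : Represents N τ D p x S := by
    refine ⟨hxm, fun n ε hε => ?_, hxS⟩
    obtain ⟨J, hJn, hJ⟩ := hsmall n ε hε
    refine ⟨J, fun i hi j hj => ?_⟩
    have h1 := h.mono _ _ hJn _ (sub_mem (hxm i) (hxm j))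
    have h2 := h.sub_le J.succPNat (sub_mem (hxm i) (hxm J)) (sub_mem (hxm j) (hxm J))
    rw [sub_sub_sub_cancel_right] at h2
    have h3 := hxd J i hi
    have h4 := hxd J j hj
    linarith
  refine ⟨S, ⟨x, hx⟩, fun n ε hε => ?_⟩
  obtain ⟨J, hJn, hJ⟩ := hsmall n ε hε
  have hSJ : normP N τ D p J.succPNat (S - T (φ J)) ≤ 2 * e J := by
    refine h.normP_le_of_eventually _
      (h.represents_sub hx ((hv J).comp hψ.tendsto_atTop)) ?_
    filter_upwards [eventually_ge_atTop J] with j hj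
    have h1 := hvd J j hj (ψ j)
    have h2 := he j
    change normPSq N τ D p J.succPNat (v j (ψ j) - v J (ψ j)) ≤ _
    linarith
  have hSB : S ∈ B1 N τ D p := ⟨x, hx⟩
  refine ⟨φ J, fun a ha => ?_⟩
  have h1 := hφT J a ha (φ J) le_rfl
  have h2 := h.normP_smul J.succPNat (-1) (h.sub_mem_B1 hSB (hT (φ J)))
  rw [neg_one_smul, neg_sub, norm_neg, norm_one, one_mul] at h2
  have h3 := h.normP_add_le J.succPNat (h.sub_mem_B1 (hT a) (hT (φ J)))
    (h.sub_mem_B1 (hT (φ J)) hSB)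
  rw [sub_add_sub_cancel] at h3
  have h4 := h.normP_mono hJn (h.sub_mem_B1 (hT a) hSB)
  have h5 := he J
  linarith

end IsProjective

end Complete

/-! ### The derivation `[|D|, ·]` in terms of the resolvents of `|D|` -/

section Derivation

variable {H : Type*} [NormedAddCommGroup H] [InnerProductSpace ℂ H] [CompleteSpace H]
variable {D : H →ₗ.[ℂ] H}

/-- The operator `(1 - b)^(1/2)` for `b = (1 + D²)⁻¹`, that is `|D| (1 + D²)^(-1/2)`. -/
noncomputable def absBounded (D : H →ₗ.[ℂ] H) : H →L[ℂ] H :=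
  cfc (fun x : ℝ => Real.sqrt (1 - x)) (invOneAddSq D)

/-- The resolvent `(1 + ε|D|)⁻¹` as the function `b^(1/2) / (b^(1/2) + ε (1 - b)^(1/2))` of
`b = (1 + D²)⁻¹`. -/
noncomputable def absResolvent (D : H →ₗ.[ℂ] H) (ε : ℝ) : H →L[ℂ] H :=
  cfc (fun x : ℝ => x ^ (1 / 2 : ℝ) * (x ^ (1 / 2 : ℝ) + ε * Real.sqrt (1 - x))⁻¹) (invOneAddSq D)

theorem resPow_half_injective (hD : IsSelfAdjoint D) : Function.Injective (resPow D (1 / 2)) := by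
  have h1 : resPow D (1 / 2) * resPow D (1 / 2) = invOneAddSq D := by
    have hc := continuousOn_rpow_spectrum (r := 1 / 2) (by norm_num)
      (s := spectrum ℝ (invOneAddSq D))
    rw [resPow, ← cfc_mul _ _ _ hc hc]
    conv_rhs => rw [← cfc_id' ℝ (invOneAddSq D) (isSelfAdjoint_invOneAddSq hD)]
    refine cfc_congr fun t ht => ?_
    have h0 := (spectrum_invOneAddSq_subset hD ht).1
    rw [← Real.sqrt_eq_rpow, Real.mul_self_sqrt h0]
  intro x y hxy
  refine invOneAddSq_injective hD ?_
  rw [← h1, mul_apply_eq_comp, mul_apply_eq_comp, hxy]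

theorem absOp_graph (hD : IsSelfAdjoint D) : (absOp D).graph =
    LinearMap.range ((resPow D (1 / 2)).prod (absBounded D)).toLinearMap := by
  refine Submodule.toLinearPMap_graph_eq _ ?_
  rintro ⟨x, y⟩ ⟨z, hz⟩ h0
  have h1 : resPow D (1 / 2) z = x := congrArg Prod.fst hz
  have h2 : absBounded D z = y := congrArg Prod.snd hz
  have h3 : z = 0 := resPow_half_injective hD (by
    rw [h1, map_zero]; exact h0)
  rw [h3, map_zero] at h2
  exact h2.symm

theorem resPow_half_mem_domain (hD : IsSelfAdjoint D) (y : H) :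
    ∃ h : resPow D (1 / 2) y ∈ (absOp D).domain,
      absOp D ⟨resPow D (1 / 2) y, h⟩ = absBounded D y := by
  have h1 : (resPow D (1 / 2) y, absBounded D y) ∈ (absOp D).graph := by
    rw [absOp_graph hD]; exact ⟨y, rfl⟩
  obtain ⟨z, hz1, hz2⟩ := (LinearPMap.mem_graph_iff _).1 h1
  have hz3 : (z : H) = resPow D (1 / 2) y := hz1
  refine ⟨hz3 ▸ z.2, ?_⟩
  refine Eq.trans ?_ hz2
  congr 1
  exact Subtype.ext hz3.symm

theorem exists_of_mem_domain (hD : IsSelfAdjoint D) (x : (absOp D).domain) :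
    ∃ y, resPow D (1 / 2) y = x ∧ absBounded D y = absOp D x := by
  have h1 := (absOp D).mem_graph x
  rw [absOp_graph hD] at h1
  obtain ⟨y, hy⟩ := h1
  exact ⟨y, congrArg Prod.fst hy, congrArg Prod.snd hy⟩

/-- In terms of `|D| = (1 - b)^(1/2) b^(-1/2)`, the relation `S = [|D|, T]` says that
`T b^(1/2) y = b^(1/2) z` with `(1 - b)^(1/2) z - T (1 - b)^(1/2) y = S b^(1/2) y`. -/
theorem isDelta_iff_exists (hD : IsSelfAdjoint D) {T S : H →L[ℂ] H} : IsDelta D T S ↔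
    ∀ y, ∃ z, T (resPow D (1 / 2) y) = resPow D (1 / 2) z ∧
      absBounded D z - T (absBounded D y) = S (resPow D (1 / 2) y) := by
  constructor
  · intro hd y
    obtain ⟨h, hy⟩ := resPow_half_mem_domain hD y
    obtain ⟨h', hd⟩ := hd ⟨_, h⟩
    obtain ⟨z, hz1, hz2⟩ := exists_of_mem_domain hD ⟨_, h'⟩
    refine ⟨z, hz1.symm, ?_⟩
    rw [hz2, ← hy]
    exact hd
  · intro hd x
    obtain ⟨y, hy1, hy2⟩ := exists_of_mem_domain hD x
    obtain ⟨z, hz1, hz2⟩ := hd y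
    obtain ⟨h, hz⟩ := resPow_half_mem_domain hD z
    rw [hy1] at hz1 hz2
    refine ⟨by rw [hz1]; exact h, ?_⟩
    rw [← hz2, hy2, ← hz]
    congr 2
    exact Subtype.ext hz1

theorem rpow_half_add_pos {ε : ℝ} (hε : 0 < ε) {t : ℝ} (ht : t ∈ Set.Icc (0 : ℝ) 1) :
    0 < t ^ (1 / 2 : ℝ) + ε * Real.sqrt (1 - t) := by
  rw [← Real.sqrt_eq_rpow]
  rcases eq_or_lt_of_le ht.1 with h | h
  · rw [← h]; simpa using hε
  · have := Real.sqrt_pos.2 h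
    positivity

/-- The data of the resolvent `K = (1 + ε|D|)⁻¹ = b^(1/2) E`, where `E` is the inverse of
`b^(1/2) + ε (1 - b)^(1/2)`. -/
theorem exists_absResolvent_eq_mul (hD : IsSelfAdjoint D) {ε : ℝ} (hε : 0 < ε) :
    ∃ E : H →L[ℂ] H, absResolvent D ε = resPow D (1 / 2) * E ∧
      E * (resPow D (1 / 2) + ε • absBounded D) = 1 ∧
      (resPow D (1 / 2) + ε • absBounded D) * E = 1 ∧
      ‖absResolvent D ε‖ ≤ 1 := by
  have hsa := isSelfAdjoint_invOneAddSq hD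
  have hc1 := continuousOn_rpow_spectrum (r := 1 / 2) (by norm_num)
      (s := spectrum ℝ (invOneAddSq D))
  have hc2 : ContinuousOn (fun x : ℝ => Real.sqrt (1 - x)) (spectrum ℝ (invOneAddSq D)) := by
    fun_prop
  have hc3 : ContinuousOn (fun x : ℝ => x ^ (1 / 2 : ℝ) + ε * Real.sqrt (1 - x))
      (spectrum ℝ (invOneAddSq D)) := hc1.add (continuousOn_const.mul hc2)
  have hpos : ∀ t ∈ spectrum ℝ (invOneAddSq D), 0 < t ^ (1 / 2 : ℝ) + ε * Real.sqrt (1 - t) :=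
    fun t ht => rpow_half_add_pos hε (spectrum_invOneAddSq_subset hD ht)
  have hc4 : ContinuousOn (fun x : ℝ => (x ^ (1 / 2 : ℝ) + ε * Real.sqrt (1 - x))⁻¹)
      (spectrum ℝ (invOneAddSq D)) := hc3.inv₀ fun t ht => (hpos t ht).ne'
  have hF : resPow D (1 / 2) + ε • absBounded D =
      cfc (fun x : ℝ => x ^ (1 / 2 : ℝ) + ε * Real.sqrt (1 - x)) (invOneAddSq D) := by
    have h1 := cfc_add (a := invOneAddSq D) (fun x : ℝ => x ^ (1 / 2 : ℝ))
      (fun x : ℝ => ε * Real.sqrt (1 - x)) hc1 (continuousOn_const.mul hc2)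
    rw [h1, cfc_const_mul _ _ _ hc2]
    rfl
  refine ⟨cfc (fun x : ℝ => (x ^ (1 / 2 : ℝ) + ε * Real.sqrt (1 - x))⁻¹) (invOneAddSq D),
    ?_, ?_, ?_, ?_⟩
  · rw [resPow, ← cfc_mul _ _ _ hc1 hc4]; rfl
  · rw [hF, ← cfc_mul _ _ _ hc4 hc3, ← cfc_one ℝ (invOneAddSq D)]
    exact cfc_congr fun t ht => inv_mul_cancel₀ (hpos t ht).ne'
  · rw [hF, ← cfc_mul _ _ _ hc3 hc4, ← cfc_one ℝ (invOneAddSq D)]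
    exact cfc_congr fun t ht => mul_inv_cancel₀ (hpos t ht).ne'
  · refine norm_cfc_le zero_le_one fun t ht => ?_
    have h0 := (spectrum_invOneAddSq_subset hD ht).1
    have h1 := hpos t ht
    have h2 : 0 ≤ t ^ (1 / 2 : ℝ) := Real.rpow_nonneg h0 _
    have h3 : 0 ≤ ε * Real.sqrt (1 - t) := mul_nonneg hε.le (Real.sqrt_nonneg _)
    rw [Real.norm_eq_abs, abs_of_nonneg (mul_nonneg h2 (inv_nonneg.2 h1.le)), ← div_eq_mul_inv,
      div_le_one h1]
    linarith

theorem star_absResolvent (ε : ℝ) : star (absResolvent D ε) = absResolvent D ε :=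
  (cfc_predicate _ _ : IsSelfAdjoint (absResolvent D ε)).star_eq

theorem norm_absResolvent_le (hD : IsSelfAdjoint D) {ε : ℝ} (hε : 0 < ε) :
    ‖absResolvent D ε‖ ≤ 1 :=
  (exists_absResolvent_eq_mul hD hε).choose_spec.2.2.2

theorem absResolvent_injective (hD : IsSelfAdjoint D) {ε : ℝ} (hε : 0 < ε) :
    Function.Injective (absResolvent D ε) := by
  obtain ⟨E, h1, -, h4, -⟩ := exists_absResolvent_eq_mul hD hε
  rw [h1]
  refine (resPow_half_injective hD).comp fun x y hxy => ?_
  have h5 : ∀ x, (resPow D (1 / 2) + ε • absBounded D) (E x) = x := fun x => by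
    rw [← mul_apply_eq_comp, h4, one_apply_eq_self]
  rw [← h5 x, ← h5 y]
  exact congrArg _ hxy

/-- For `K = (1 + ε|D|)⁻¹` the relation `S = [|D|, T]` is the identity `[T, K] = ε K S K` between
bounded operators. -/
theorem isDelta_iff (hD : IsSelfAdjoint D) {ε : ℝ} (hε : 0 < ε) {T S : H →L[ℂ] H} :
    IsDelta D T S ↔ T * absResolvent D ε - absResolvent D ε * T =
      ε • (absResolvent D ε * S * absResolvent D ε) := by
  obtain ⟨E, h1, h3, h4, -⟩ := exists_absResolvent_eq_mul hD hε
  set K := absResolvent D ε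
  set B := resPow D (1 / 2)
  set C := absBounded D
  have a1 : ∀ x, B (E x) = K x := fun x => by rw [h1]; rfl
  have a3 : ∀ x, E (B x + ε • C x) = x := fun x => by
    have := congrArg (fun A : H →L[ℂ] H => A x) h3
    simpa using this
  have a4 : ∀ x, B (E x) + ε • C (E x) = x := fun x => by
    have := congrArg (fun A : H →L[ℂ] H => A x) h4
    simpa using this
  have hreal : ∀ (A : H →L[ℂ] H) (x : H), A (ε • x) = ε • A x := fun A x =>
    A.map_smul_of_tower ε x
  rw [isDelta_iff_exists hD]
  have key : (T * K - K * T = ε • (K * S * K)) ↔ ∀ w, T (K w) = K (T w + ε • S (K w)) := by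
    rw [sub_eq_iff_eq_add', ContinuousLinearMap.ext_iff]
    refine forall_congr' fun w => ?_
    rw [map_add, hreal]
    rfl
  rw [key]
  constructor
  · intro h w
    obtain ⟨z, hz1, hz2⟩ := h (E w)
    -- `z = E (T w + ε S K w)`, because `(B + ε C) z = T (B + ε C) E w + ε S B E w`.
    have hz : B z + ε • C z = T w + ε • S (K w) := by
      rw [← hz1, sub_eq_iff_eq_add.1 hz2, smul_add, a1, ← a1 w]
      conv_rhs => rw [← a4 w, map_add, hreal]
      simp only [a4]
      abel
    rw [← a1 w, hz1, ← a1 (T w + _)]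
    congr 1
    rw [a1, ← hz, a3]
  · intro h y
    have h5 := h (B y + ε • C y)
    have h6 : K (B y + ε • C y) = B y := by rw [← a1, a3]
    rw [h6] at h5
    have h7 := a4 (T (B y + ε • C y) + ε • S (B y))
    have h8 : T (B y) = B (E (T (B y + ε • C y) + ε • S (B y))) := by rw [h5, a1]
    generalize E (T (B y + ε • C y) + ε • S (B y)) = z at h7 h8
    refine ⟨z, h8, ?_⟩
    rw [← h8, map_add, hreal, add_assoc] at h7
    have h9 : ε • C z = ε • (T (C y) + S (B y)) := by
      rw [smul_add]; exact add_left_cancel h7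
    have h10 : C z = T (C y) + S (B y) := smul_right_injective H hε.ne' h9
    change C z - T (C y) = S (B y)
    rw [h10, add_sub_cancel_left]

/-- Left and right cancellation of the resolvent, which is self-adjoint and injective. -/
theorem eq_of_absResolvent_mul_mul (hD : IsSelfAdjoint D) {ε : ℝ} (hε : 0 < ε) {S S' : H →L[ℂ] H}
    (h : absResolvent D ε * S * absResolvent D ε = absResolvent D ε * S' * absResolvent D ε) :
    S = S' := by
  have hinj := absResolvent_injective hD hε
  have key : ∀ A B : H →L[ℂ] H, absResolvent D ε * A = absResolvent D ε * B → A = B := by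
    intro A B hAB
    ext x
    exact hinj (congrArg (fun A : H →L[ℂ] H => A x) hAB)
  rw [mul_assoc, mul_assoc] at h
  have h1 := congrArg star (key _ _ h)
  rw [star_mul, star_mul, star_absResolvent] at h1
  exact star_injective (key _ _ h1)

theorem IsDelta.unique (hD : IsSelfAdjoint D) {T S S' : H →L[ℂ] H} (h : IsDelta D T S)
    (h' : IsDelta D T S') : S = S' := by
  have h1 := ((isDelta_iff hD one_pos).1 h).symm.trans ((isDelta_iff hD one_pos).1 h')
  rw [one_smul, one_smul] at h1
  exact eq_of_absResolvent_mul_mul hD one_pos h1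

theorem isDelta_delta {T : H →L[ℂ] H} (hT : T ∈ deltaDomain D) : IsDelta D T (delta D T) := by
  have h : ∃ S, IsDelta D T S := hT
  rw [delta, dif_pos h]
  exact h.choose_spec

theorem IsDelta.delta_eq (hD : IsSelfAdjoint D) {T S : H →L[ℂ] H} (h : IsDelta D T S) :
    delta D T = S :=
  (isDelta_delta ⟨S, h⟩).unique hD h

theorem IsDelta.add (hD : IsSelfAdjoint D) {T T' S S' : H →L[ℂ] H} (h : IsDelta D T S)
    (h' : IsDelta D T' S') : IsDelta D (T + T') (S + S') := by
  rw [isDelta_iff hD one_pos] at *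
  rw [add_mul, mul_add, mul_add, add_mul, smul_add, ← h, ← h', add_sub_add_comm]

theorem IsDelta.smul (hD : IsSelfAdjoint D) (c : ℂ) {T S : H →L[ℂ] H} (h : IsDelta D T S) :
    IsDelta D (c • T) (c • S) := by
  rw [isDelta_iff hD one_pos] at *
  rw [one_smul] at *
  rw [smul_mul_assoc, mul_smul_comm, mul_smul_comm, smul_mul_assoc, ← h, smul_sub]

theorem isDelta_zero (hD : IsSelfAdjoint D) : IsDelta D (0 : H →L[ℂ] H) 0 := by
  rw [isDelta_iff hD one_pos]; simp

theorem isDelta_one (hD : IsSelfAdjoint D) : IsDelta D (1 : H →L[ℂ] H) 0 := by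
  rw [isDelta_iff hD one_pos]; simp

theorem IsDelta.star (hD : IsSelfAdjoint D) {T S : H →L[ℂ] H} (h : IsDelta D T S) :
    IsDelta D (star T) (-star S) := by
  rw [isDelta_iff hD one_pos] at *
  have h1 := congrArg Star.star h
  simp only [one_smul, star_sub, star_mul, star_absResolvent] at h1
  rw [one_smul, ← neg_sub, h1]
  simp only [mul_assoc, neg_mul, mul_neg]

/-- The Leibniz rule for the relation `[T, K] = K S K`. -/
theorem commutator_mul {A : Type*} [Ring A] {K T T' S S' : A} (h : T * K - K * T = K * S * K)
    (h' : T' * K - K * T' = K * S' * K) :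
    T * T' * K - K * (T * T') = K * (T * S' + S * T') * K := by
  have e1 : T * T' * K - K * (T * T') = T * (T' * K - K * T') + (T * K - K * T) * T' := by
    noncomm_ring
  have e2 : T * K = K * T + K * S * K := by rw [← h]; abel
  have e3 : K * T' = T' * K - K * S' * K := by rw [← h']; abel
  rw [e1, h, h']
  calc T * (K * S' * K) + K * S * K * T' = T * K * (S' * K) + K * S * (K * T') := by
        simp only [mul_assoc]
    _ = K * (T * S' + S * T') * K := by rw [e2, e3]; noncomm_ring

theorem IsDelta.mul (hD : IsSelfAdjoint D) {T T' S S' : H →L[ℂ] H} (h : IsDelta D T S)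
    (h' : IsDelta D T' S') : IsDelta D (T * T') (T * S' + S * T') := by
  rw [isDelta_iff hD one_pos, one_smul] at *
  exact commutator_mul h h'

theorem IsDelta.of_tendsto (hD : IsSelfAdjoint D) {u v : ℕ → (H →L[ℂ] H)} {T S : H →L[ℂ] H}
    (h : ∀ k, IsDelta D (u k) (v k)) (hu : Tendsto u atTop (𝓝 T)) (hv : Tendsto v atTop (𝓝 S)) :
    IsDelta D T S := by
  simp only [isDelta_iff hD one_pos, one_smul] at *
  refine tendsto_nhds_unique_of_eventuallyEq
    ((hu.mul_const (absResolvent D 1)).sub (hu.const_mul (absResolvent D 1)))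
    ((hv.const_mul (absResolvent D 1)).mul_const (absResolvent D 1))
    (Eventually.of_forall h)

end Derivation

/-! ### The smooth subalgebras -/

section Smooth

variable {H : Type*} [NormedAddCommGroup H] [InnerProductSpace ℂ H] [CompleteSpace H]
variable {N : VonNeumannAlgebra H} {τ : (H →L[ℂ] H) → ℝ≥0∞} {D : H →ₗ.[ℂ] H} {p : ℝ}

theorem IsDelta.mem_deltaDomain {T S : H →L[ℂ] H} (h : IsDelta D T S) : T ∈ deltaDomain D :=
  ⟨S, h⟩

theorem mem_B1Smooth_zero {T : H →L[ℂ] H} : T ∈ B1Smooth N τ D p 0 ↔ T ∈ B1 N τ D p := by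
  constructor
  · exact fun h => h.2 0 le_rfl
  · refine fun h => ⟨fun j hj => absurd hj (by simp), fun j hj => ?_⟩
    have : j = 0 := by simpa using hj
    rw [this]
    exact h

theorem mem_B1Smooth_succ {k : ℕ} {T : H →L[ℂ] H} :
    T ∈ B1Smooth N τ D p ((k + 1 : ℕ) : ℕ∞) ↔
      T ∈ deltaDomain D ∧ T ∈ B1 N τ D p ∧ delta D T ∈ B1Smooth N τ D p (k : ℕ∞) := by
  constructor
  · intro h
    refine ⟨h.1 0 (by simp), h.2 0 (by simp), fun j hj => ?_, fun j hj => ?_⟩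
    · have := h.1 (j + 1) (by norm_cast at hj ⊢; omega)
      rwa [Function.iterate_succ_apply] at this
    · have := h.2 (j + 1) (by norm_cast at hj ⊢; omega)
      rwa [Function.iterate_succ_apply] at this
  · rintro ⟨h1, h2, h3⟩
    refine ⟨fun j hj => ?_, fun j hj => ?_⟩
    · cases j with
      | zero => exact h1
      | succ j =>
        rw [Function.iterate_succ_apply]
        exact h3.1 j (by norm_cast at hj ⊢; omega)
    · cases j with
      | zero => exact h2
      | succ j =>
        rw [Function.iterate_succ_apply]
        exact h3.2 j (by norm_cast at hj ⊢; omega)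

theorem mem_B1Smooth_iff {l : ℕ∞} {T : H →L[ℂ] H} :
    T ∈ B1Smooth N τ D p l ↔ ∀ k : ℕ, (k : ℕ∞) ≤ l → T ∈ B1Smooth N τ D p (k : ℕ∞) := by
  constructor
  · exact fun h k hk => ⟨fun j hj => h.1 j (hj.trans_le hk), fun j hj => h.2 j (hj.trans hk)⟩
  · intro h
    refine ⟨fun j hj => ?_, fun j hj => (h j hj).2 j le_rfl⟩
    have h1 : ((j + 1 : ℕ) : ℕ∞) ≤ l := by
      push_cast; exact Order.add_one_le_of_lt hj
    exact (h (j + 1) h1).1 j (by norm_cast; omega)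

theorem B1Smooth_mono {l l' : ℕ∞} (h : l ≤ l') {T : H →L[ℂ] H} (hT : T ∈ B1Smooth N τ D p l') :
    T ∈ B1Smooth N τ D p l :=
  mem_B1Smooth_iff.2 fun k hk => mem_B1Smooth_iff.1 hT k (hk.trans h)

theorem mem_B1_of_mem_B1Smooth {l : ℕ∞} {T : H →L[ℂ] H} (hT : T ∈ B1Smooth N τ D p l) :
    T ∈ B1 N τ D p :=
  mem_B1Smooth_zero.1 (B1Smooth_mono zero_le hT)

theorem normPSmooth_zero (n : ℕ+) (T : H →L[ℂ] H) :
    normPSmooth N τ D p n 0 T = normP N τ D p n T := by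
  simp [normPSmooth]

theorem normPSmooth_succ (n : ℕ+) (k : ℕ) (T : H →L[ℂ] H) :
    normPSmooth N τ D p n (k + 1) T =
      normP N τ D p n T + normPSmooth N τ D p n k (delta D T) := by
  rw [normPSmooth, Finset.sum_range_succ', add_comm]
  rfl

theorem delta_iterate_sub (hD : IsSelfAdjoint D) (k : ℕ) {S T : H →L[ℂ] H}
    (hS : S ∈ B1Smooth N τ D p (k : ℕ∞)) (hT : T ∈ B1Smooth N τ D p (k : ℕ∞)) :
    (delta D)^[k] (S - T) = (delta D)^[k] S - (delta D)^[k] T := by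
  induction k generalizing S T with
  | zero => rfl
  | succ k ih =>
    obtain ⟨hS1, hS2, hS3⟩ := mem_B1Smooth_succ.1 hS
    obtain ⟨hT1, hT2, hT3⟩ := mem_B1Smooth_succ.1 hT
    have hd := (isDelta_delta hS1).add hD ((isDelta_delta hT1).smul hD (-1))
    simp only [neg_smul, one_smul, ← sub_eq_add_neg] at hd
    rw [Function.iterate_succ_apply, Function.iterate_succ_apply, Function.iterate_succ_apply,
      hd.delta_eq hD, ih hS3 hT3]

namespace IsProjective

theorem normPSmooth_nonneg (h : IsProjective N τ D p) (n : ℕ+) (k : ℕ) {T : H →L[ℂ] H}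
    (hT : T ∈ B1Smooth N τ D p (k : ℕ∞)) : 0 ≤ normPSmooth N τ D p n k T :=
  Finset.sum_nonneg fun j hj => h.normP_nonneg n
    (hT.2 j (by exact_mod_cast Nat.lt_succ_iff.1 (Finset.mem_range.1 hj)))

theorem normP_iterate_le (h : IsProjective N τ D p) (n : ℕ+) {j k : ℕ} (hj : j ≤ k)
    {T : H →L[ℂ] H} (hT : T ∈ B1Smooth N τ D p (k : ℕ∞)) :
    normP N τ D p n ((delta D)^[j] T) ≤ normPSmooth N τ D p n k T :=
  Finset.single_le_sum (f := fun j => normP N τ D p n ((delta D)^[j] T))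
    (fun i hi => h.normP_nonneg n
      (hT.2 i (by exact_mod_cast Nat.lt_succ_iff.1 (Finset.mem_range.1 hi))))
    (Finset.mem_range.2 (Nat.lt_succ_of_le hj))

theorem normPSmooth_mono (h : IsProjective N τ D p) (n : ℕ+) {j k : ℕ} (hj : j ≤ k)
    {T : H →L[ℂ] H} (hT : T ∈ B1Smooth N τ D p (k : ℕ∞)) :
    normPSmooth N τ D p n j T ≤ normPSmooth N τ D p n k T :=
  Finset.sum_le_sum_of_subset_of_nonneg (Finset.range_mono (Nat.succ_le_succ hj))
    fun i hi _ => h.normP_nonneg n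
      (hT.2 i (by exact_mod_cast Nat.lt_succ_iff.1 (Finset.mem_range.1 hi)))

theorem zero_mem_B1Smooth (h : IsProjective N τ D p) (hD : IsSelfAdjoint D) (k : ℕ) :
    (0 : H →L[ℂ] H) ∈ B1Smooth N τ D p (k : ℕ∞) := by
  induction k with
  | zero => exact mem_B1Smooth_zero.2 h.zero_mem_B1
  | succ k ih =>
    exact mem_B1Smooth_succ.2 ⟨(isDelta_zero hD).mem_deltaDomain, h.zero_mem_B1, by
      rwa [(isDelta_zero hD).delta_eq hD]⟩

theorem add_B1Smooth (h : IsProjective N τ D p) (hD : IsSelfAdjoint D) (k : ℕ)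
    {S T : H →L[ℂ] H} (hS : S ∈ B1Smooth N τ D p (k : ℕ∞)) (hT : T ∈ B1Smooth N τ D p (k : ℕ∞)) :
    S + T ∈ B1Smooth N τ D p (k : ℕ∞) ∧ ∀ n, normPSmooth N τ D p n k (S + T) ≤
      normPSmooth N τ D p n k S + normPSmooth N τ D p n k T := by
  induction k generalizing S T with
  | zero =>
    have hS' := mem_B1_of_mem_B1Smooth hS
    have hT' := mem_B1_of_mem_B1Smooth hT
    refine ⟨mem_B1Smooth_zero.2 (h.add_mem_B1 hS' hT'), fun n => ?_⟩
    simp only [normPSmooth_zero]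
    exact h.normP_add_le n hS' hT'
  | succ k ih =>
    obtain ⟨hS1, hS2, hS3⟩ := mem_B1Smooth_succ.1 hS
    obtain ⟨hT1, hT2, hT3⟩ := mem_B1Smooth_succ.1 hT
    have hd := (isDelta_delta hS1).add hD (isDelta_delta hT1)
    obtain ⟨h1, h2⟩ := ih hS3 hT3
    refine ⟨mem_B1Smooth_succ.2 ⟨hd.mem_deltaDomain, h.add_mem_B1 hS2 hT2, ?_⟩, fun n => ?_⟩
    · rwa [hd.delta_eq hD]
    · simp only [normPSmooth_succ, hd.delta_eq hD]
      have h3 := h.normP_add_le n hS2 hT2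
      have h4 := h2 n
      linarith

theorem smul_B1Smooth (h : IsProjective N τ D p) (hD : IsSelfAdjoint D) (k : ℕ) (c : ℂ)
    {T : H →L[ℂ] H} (hT : T ∈ B1Smooth N τ D p (k : ℕ∞)) :
    c • T ∈ B1Smooth N τ D p (k : ℕ∞) ∧
      ∀ n, normPSmooth N τ D p n k (c • T) = ‖c‖ * normPSmooth N τ D p n k T := by
  induction k generalizing T with
  | zero =>
    have hT' := mem_B1_of_mem_B1Smooth hT
    refine ⟨mem_B1Smooth_zero.2 (h.smul_mem_B1 c hT'), fun n => ?_⟩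
    simp only [normPSmooth_zero]
    exact h.normP_smul n c hT'
  | succ k ih =>
    obtain ⟨hT1, hT2, hT3⟩ := mem_B1Smooth_succ.1 hT
    have hd := (isDelta_delta hT1).smul hD c
    obtain ⟨h1, h2⟩ := ih hT3
    refine ⟨mem_B1Smooth_succ.2 ⟨hd.mem_deltaDomain, h.smul_mem_B1 c hT2, ?_⟩, fun n => ?_⟩
    · rwa [hd.delta_eq hD]
    · simp only [normPSmooth_succ, hd.delta_eq hD]
      rw [h.normP_smul n c hT2, h2 n, mul_add]

theorem star_B1Smooth (h : IsProjective N τ D p) (hD : IsSelfAdjoint D) (k : ℕ)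
    {T : H →L[ℂ] H} (hT : T ∈ B1Smooth N τ D p (k : ℕ∞)) :
    star T ∈ B1Smooth N τ D p (k : ℕ∞) ∧
      ∀ n, normPSmooth N τ D p n k (star T) ≤ normPSmooth N τ D p n k T := by
  induction k generalizing T with
  | zero =>
    have hT' := mem_B1_of_mem_B1Smooth hT
    refine ⟨mem_B1Smooth_zero.2 (h.star_mem_B1 hT'), fun n => ?_⟩
    simp only [normPSmooth_zero]
    exact h.normP_star_le n hT'
  | succ k ih =>
    obtain ⟨hT1, hT2, hT3⟩ := mem_B1Smooth_succ.1 hT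
    have hd := (isDelta_delta hT1).star hD
    obtain ⟨h1, h2⟩ := ih hT3
    obtain ⟨h3, h4⟩ := h.smul_B1Smooth hD k (-1) h1
    rw [neg_one_smul] at h3 h4
    refine ⟨mem_B1Smooth_succ.2 ⟨hd.mem_deltaDomain, h.star_mem_B1 hT2, ?_⟩, fun n => ?_⟩
    · rwa [hd.delta_eq hD]
    · simp only [normPSmooth_succ, hd.delta_eq hD]
      rw [h4 n, norm_neg, norm_one, one_mul]
      exact add_le_add (h.normP_star_le n hT2) (h2 n)

/-- The norms `P_{n,k}` are submultiplicative up to constants, by induction on `k` from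
`P_{n,k+1}(T) = P_n(T) + P_{n,k}(δ(T))` and the Leibniz rule. -/
theorem mul_B1Smooth (h : IsProjective N τ D p) (hD : IsSelfAdjoint D) (k : ℕ) :
    ∃ C : ℝ, 0 ≤ C ∧ ∀ S ∈ B1Smooth N τ D p (k : ℕ∞), ∀ T ∈ B1Smooth N τ D p (k : ℕ∞),
      S * T ∈ B1Smooth N τ D p (k : ℕ∞) ∧ ∀ n, normPSmooth N τ D p n k (S * T) ≤
        C * normPSmooth N τ D p n k S * normPSmooth N τ D p n k T := by
  induction k with
  | zero =>
    refine ⟨1, zero_le_one, fun S hS T hT => ?_⟩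
    have hS' := mem_B1_of_mem_B1Smooth hS
    have hT' := mem_B1_of_mem_B1Smooth hT
    refine ⟨mem_B1Smooth_zero.2 (h.mul_mem_B1 hS' hT'), fun n => ?_⟩
    simp only [normPSmooth_zero, one_mul]
    exact h.normP_mul_le n hS' hT'
  | succ k ih =>
    obtain ⟨C, hC0, hC⟩ := ih
    refine ⟨1 + 2 * C, by positivity, fun S hS T hT => ?_⟩
    obtain ⟨hS1, hS2, hS3⟩ := mem_B1Smooth_succ.1 hS
    obtain ⟨hT1, hT2, hT3⟩ := mem_B1Smooth_succ.1 hT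
    have hk : (k : ℕ∞) ≤ ((k + 1 : ℕ) : ℕ∞) := by exact_mod_cast Nat.le_succ k
    have hS4 := B1Smooth_mono hk hS
    have hT4 := B1Smooth_mono hk hT
    have hd := (isDelta_delta hS1).mul hD (isDelta_delta hT1)
    obtain ⟨m1, b1⟩ := hC S hS4 _ hT3
    obtain ⟨m2, b2⟩ := hC _ hS3 T hT4
    obtain ⟨m3, b3⟩ := h.add_B1Smooth hD k m1 m2
    refine ⟨mem_B1Smooth_succ.2 ⟨hd.mem_deltaDomain, h.mul_mem_B1 hS2 hT2, ?_⟩, fun n => ?_⟩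
    · rwa [hd.delta_eq hD]
    · have q1 := h.normP_nonneg n hS2
      have q2 := h.normP_nonneg n hT2
      have q3 := h.normPSmooth_nonneg n k hS3
      have q4 := h.normPSmooth_nonneg n k hT3
      have q5 := h.normPSmooth_nonneg n k hS4
      have q6 := h.normPSmooth_nonneg n k hT4
      have r1 := h.normPSmooth_mono n (Nat.le_succ k) hS
      have r2 := h.normPSmooth_mono n (Nat.le_succ k) hT
      rw [normPSmooth_succ n k (S * T), hd.delta_eq hD]
      have e1 := normPSmooth_succ (N := N) (τ := τ) (D := D) (p := p) n k S
      have e2 := normPSmooth_succ (N := N) (τ := τ) (D := D) (p := p) n k T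
      set s := normPSmooth N τ D p n (k + 1) S
      set t := normPSmooth N τ D p n (k + 1) T
      have f1 := h.normP_mul_le n hS2 hT2
      have f2 := (b3 n).trans (add_le_add (b1 n) (b2 n))
      have g1 : C * normPSmooth N τ D p n k S * normPSmooth N τ D p n k (delta D T) ≤
          C * s * normPSmooth N τ D p n k (delta D T) := by gcongr
      have g2 : C * normPSmooth N τ D p n k (delta D S) * normPSmooth N τ D p n k T ≤
          C * normPSmooth N τ D p n k (delta D S) * t := by gcongr
      rw [e1] at g1 ⊢
      rw [e2] at g2 ⊢
      nlinarith [mul_nonneg hC0 (mul_nonneg q1 q2), mul_nonneg hC0 (mul_nonneg q1 q4),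
        mul_nonneg hC0 (mul_nonneg q3 q2), mul_nonneg q1 q4, mul_nonneg q3 q2, mul_nonneg q3 q4]

/-- The smooth algebras are complete, because `δ` is closed. -/
theorem exists_limit_B1Smooth (h : IsProjective N τ D p) (hD : IsSelfAdjoint D) (l : ℕ∞)
    {u : ℕ → (H →L[ℂ] H)} (hu : ∀ k, u k ∈ B1Smooth N τ D p l)
    (hc : ∀ i : SmoothIndex l, ∀ ε > 0, ∃ K, ∀ a ≥ K, ∀ b ≥ K,
      normPSmooth N τ D p i.1 i.2 (u a - u b) < ε) :
    ∃ x ∈ B1Smooth N τ D p l, ∀ i : SmoothIndex l, ∀ ε > 0, ∃ K, ∀ a ≥ K,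
      normPSmooth N τ D p i.1 i.2 (u a - x) < ε := by
  have huj : ∀ (j : ℕ), (j : ℕ∞) ≤ l → ∀ k, u k ∈ B1Smooth N τ D p (j : ℕ∞) :=
    fun j hj k => B1Smooth_mono hj (hu k)
  have hsub : ∀ (j : ℕ), (j : ℕ∞) ≤ l → ∀ a b, u a - u b ∈ B1Smooth N τ D p (j : ℕ∞) := by
    intro j hj a b
    have := (h.add_B1Smooth hD j (huj j hj a) (h.smul_B1Smooth hD j (-1) (huj j hj b)).1).1
    rwa [neg_one_smul, ← sub_eq_add_neg] at this
  have hlim : ∀ j : ℕ, ∃ S : H →L[ℂ] H, (j : ℕ∞) ≤ l → S ∈ B1 N τ D p ∧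
      ∀ n, ∀ ε > 0, ∃ K, ∀ a ≥ K, normP N τ D p n ((delta D)^[j] (u a) - S) < ε := by
    intro j
    by_cases hj : (j : ℕ∞) ≤ l
    · obtain ⟨S, hS, hSu⟩ := h.exists_limit_B1 (T := fun k => (delta D)^[j] (u k))
        (fun k => (hu k).2 j hj) fun n ε hε => by
          obtain ⟨K, hK⟩ := hc (n, ⟨j, hj⟩) ε hε
          refine ⟨K, fun a ha b hb => ?_⟩
          rw [← delta_iterate_sub hD j (huj j hj a) (huj j hj b)]
          exact (h.normP_iterate_le n le_rfl (hsub j hj a b)).trans_lt (hK a ha b hb)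
      exact ⟨S, fun _ => ⟨hS, hSu⟩⟩
    · exact ⟨0, fun hj' => absurd hj' hj⟩
  choose S hS using hlim
  have hnorm : ∀ j : ℕ, (j : ℕ∞) ≤ l → Tendsto (fun k => (delta D)^[j] (u k)) atTop (𝓝 (S j)) := by
    intro j hj
    refine Metric.tendsto_atTop.2 fun ε hε => ?_
    obtain ⟨K, hK⟩ := (hS j hj).2 1 ε hε
    refine ⟨K, fun a ha => ?_⟩
    rw [dist_eq_norm]
    exact (h.norm_le_normP 1 (h.sub_mem_B1 ((hu a).2 j hj) (hS j hj).1)).trans_lt (hK a ha)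
  have hdelta : ∀ j : ℕ, ((j + 1 : ℕ) : ℕ∞) ≤ l → IsDelta D (S j) (S (j + 1)) := by
    intro j hj
    have hjl : (j : ℕ∞) < l := lt_of_lt_of_le (by exact_mod_cast Nat.lt_succ_self j) hj
    refine IsDelta.of_tendsto hD (fun k => ?_) (hnorm j hjl.le) (hnorm (j + 1) hj)
    rw [Function.iterate_succ_apply']
    exact isDelta_delta ((hu k).1 j hjl)
  have hiter : ∀ j : ℕ, (j : ℕ∞) ≤ l → (delta D)^[j] (S 0) = S j := by
    intro j
    induction j with
    | zero => exact fun _ => rfl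
    | succ j ih =>
      intro hj
      rw [Function.iterate_succ_apply',
        ih (le_trans (by exact_mod_cast Nat.le_succ j) hj), (hdelta j hj).delta_eq hD]
  have hS0 : S 0 ∈ B1Smooth N τ D p l := by
    refine ⟨fun j hj => ?_, fun j hj => ?_⟩
    · rw [hiter j hj.le]
      refine (hdelta j ?_).mem_deltaDomain
      push_cast
      exact Order.add_one_le_of_lt hj
    · rw [hiter j hj]
      exact (hS j hj).1
  refine ⟨S 0, hS0, fun ⟨n, j, hj⟩ ε hε => ?_⟩
  have h1 : Tendsto (fun a => normPSmooth N τ D p n j (u a - S 0)) atTop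
      (𝓝 (∑ _i ∈ Finset.range (j + 1), (0 : ℝ))) := by
    refine tendsto_finsetSum _ fun i hi => ?_
    have hil : (i : ℕ∞) ≤ l :=
      le_trans (by exact_mod_cast Nat.lt_succ_iff.1 (Finset.mem_range.1 hi)) hj
    refine Metric.tendsto_atTop.2 fun η hη => ?_
    obtain ⟨K, hK⟩ := (hS i hil).2 n η hη
    refine ⟨K, fun a ha => ?_⟩
    rw [delta_iterate_sub hD i (huj i hil a) (B1Smooth_mono hil hS0), hiter i hil,
      Real.dist_0_eq_abs, abs_of_nonneg]
    · exact hK a ha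
    · exact h.normP_nonneg n (h.sub_mem_B1 ((hu a).2 i hil) (hS i hil).1)
  rw [Finset.sum_const_zero] at h1
  exact eventually_atTop.1 (h1.eventually (gt_mem_nhds hε))

theorem frechetData_B1Smooth (h : IsProjective N τ D p) (hD : IsSelfAdjoint D) (l : ℕ∞) :
    FrechetData (B1Smooth N τ D p l)
      (fun i : SmoothIndex l => normPSmooth N τ D p i.1 i.2) where
  zero_mem := mem_B1Smooth_iff.2 fun k _ => h.zero_mem_B1Smooth hD k
  add_mem := fun _ hx _ hy => mem_B1Smooth_iff.2 fun k hk =>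
    (h.add_B1Smooth hD k (B1Smooth_mono hk hx) (B1Smooth_mono hk hy)).1
  smul_mem := fun c _ hx => mem_B1Smooth_iff.2 fun k hk =>
    (h.smul_B1Smooth hD k c (B1Smooth_mono hk hx)).1
  mul_mem := fun _ hx _ hy => mem_B1Smooth_iff.2 fun k hk =>
    ((h.mul_B1Smooth hD k).choose_spec.2 _ (B1Smooth_mono hk hx) _ (B1Smooth_mono hk hy)).1
  star_mem := fun _ hx => mem_B1Smooth_iff.2 fun k hk =>
    (h.star_B1Smooth hD k (B1Smooth_mono hk hx)).1
  q_add := fun i _ hx _ hy =>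
    (h.add_B1Smooth hD i.2 (B1Smooth_mono i.2.2 hx) (B1Smooth_mono i.2.2 hy)).2 i.1
  q_smul := fun i c _ hx => (h.smul_B1Smooth hD i.2 c (B1Smooth_mono i.2.2 hx)).2 i.1
  q_star := fun i _ hx => (h.star_B1Smooth hD i.2 (B1Smooth_mono i.2.2 hx)).2 i.1
  q_mul := fun i => by
    obtain ⟨C, -, hC⟩ := h.mul_B1Smooth hD i.2
    exact ⟨C, fun x hx y hy =>
      (hC x (B1Smooth_mono i.2.2 hx) y (B1Smooth_mono i.2.2 hy)).2 i.1⟩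
  sep := fun x hx h0 => by
    have h1 := h0 (1, ⟨0, by simp⟩)
    simp only [normPSmooth_zero] at h1
    exact norm_le_zero_iff.1 ((h.norm_le_normP 1 (mem_B1_of_mem_B1Smooth hx)).trans h1.le)
  complete := fun _ hu hc => h.exists_limit_B1Smooth hD l hu hc

end IsProjective

end Smooth

/-! ### Integrals over grid contours -/

section Contour

theorem gridPoint_re (z₀ : ℂ) (h : ℝ) (a b : ℤ) : (gridPoint z₀ h a b).re = z₀.re + h * a := by
  simp [gridPoint]

theorem gridPoint_im (z₀ : ℂ) (h : ℝ) (a b : ℤ) : (gridPoint z₀ h a b).im = z₀.im + h * b := by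
  simp [gridPoint]

theorem mem_gridSquare {z₀ : ℂ} {h : ℝ} {c : ℤ × ℤ} {z : ℂ} : z ∈ gridSquare z₀ h c ↔
    (z₀.re + h * c.1 ≤ z.re ∧ z.re ≤ z₀.re + h * (c.1 + 1)) ∧
      (z₀.im + h * c.2 ≤ z.im ∧ z.im ≤ z₀.im + h * (c.2 + 1)) := by
  simp only [gridSquare, gridPoint_re, gridPoint_im, Set.mem_ofPred_eq, Int.cast_add, Int.cast_one,
    and_assoc]

/-- The set-theoretic boundary of the grid region. -/
def gridContour (z₀ : ℂ) (h : ℝ) (F : Finset (ℤ × ℤ)) : Set ℂ :=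
  gridRegion z₀ h F \ interior (gridRegion z₀ h F)

theorem le_of_grid_lt {h x y : ℝ} (hh : 0 < h) {a b : ℤ} (h1 : y + h * a ≤ x)
    (h2 : x < y + h * (b + 1)) : a ≤ b := by
  have h3 : h * (a : ℝ) < h * (b + 1) := by linarith
  have h4 : (a : ℝ) < b + 1 := lt_of_mul_lt_mul_left h3 hh.le
  exact Int.lt_add_one_iff.1 (by exact_mod_cast h4)

/-- Points of a grid square outside the family are limits of points outside the region. -/
theorem notMem_interior_gridRegion {z₀ : ℂ} {h : ℝ} (hh : 0 < h) {F : Finset (ℤ × ℤ)}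
    {c : ℤ × ℤ} (hc : c ∉ F) {z : ℂ} (hz : z ∈ gridSquare z₀ h c) :
    z ∉ interior (gridRegion z₀ h F) := by
  intro hi
  obtain ⟨⟨a1, a2⟩, b1, b2⟩ := mem_gridSquare.1 hz
  -- The open segment from `z` to the centre `w` of the square lies in the open square.
  let w : ℂ := ⟨z₀.re + h * (c.1 + 1 / 2), z₀.im + h * (c.2 + 1 / 2)⟩
  have ht : Tendsto (fun s : ℝ => z + s * (w - z)) (𝓝[>] 0) (𝓝 (z + (0 : ℝ) * (w - z))) := by
    refine Tendsto.mono_left (Continuous.tendsto ?_ 0) nhdsWithin_le_nhds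
    fun_prop
  rw [Complex.ofReal_zero, zero_mul, add_zero] at ht
  have h1 := ht.eventually (mem_interior_iff_mem_nhds.1 hi)
  have h2 : ∀ᶠ s : ℝ in 𝓝[>] 0, s < 1 := nhdsWithin_le_nhds (gt_mem_nhds one_pos)
  have h3 : ∀ᶠ s : ℝ in 𝓝[>] 0, 0 < s := self_mem_nhdsWithin
  obtain ⟨s, ⟨hs1, hs2⟩, hs3⟩ := ((h1.and h2).and h3).exists
  obtain ⟨d, hd, hds⟩ := Set.mem_iUnion₂.1 hs1
  obtain ⟨⟨d1, d2⟩, e1, e2⟩ := mem_gridSquare.1 hds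
  have hre : (z + s * (w - z)).re = (1 - s) * z.re + s * (z₀.re + h * (c.1 + 1 / 2)) := by
    simp [w]; ring
  have him : (z + s * (w - z)).im = (1 - s) * z.im + s * (z₀.im + h * (c.2 + 1 / 2)) := by
    simp [w]; ring
  rw [hre] at d1 d2
  rw [him] at e1 e2
  have hs4 : 0 < 1 - s := by linarith
  have hsh : 0 < s * h := mul_pos hs3 hh
  have k1 := mul_le_mul_of_nonneg_left a1 hs4.le
  have k2 := mul_le_mul_of_nonneg_left a2 hs4.le
  have k3 := mul_le_mul_of_nonneg_left b1 hs4.le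
  have k4 := mul_le_mul_of_nonneg_left b2 hs4.le
  have l1 : d.1 ≤ c.1 := le_of_grid_lt hh d1 (by linarith)
  have l2 : c.1 ≤ d.1 := by
    by_contra hlt
    have : (d.1 : ℝ) + 1 ≤ c.1 := by exact_mod_cast Int.add_one_le_iff.2 (not_le.1 hlt)
    have := mul_le_mul_of_nonneg_left this hh.le
    linarith
  have l3 : d.2 ≤ c.2 := le_of_grid_lt hh e1 (by linarith)
  have l4 : c.2 ≤ d.2 := by
    by_contra hlt
    have : (d.2 : ℝ) + 1 ≤ c.2 := by exact_mod_cast Int.add_one_le_iff.2 (not_le.1 hlt)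
    have := mul_le_mul_of_nonneg_left this hh.le
    linarith
  have : d = c := Prod.ext (le_antisymm l1 l2) (le_antisymm l3 l4)
  exact hc (this ▸ hd)

theorem mem_gridContour {z₀ : ℂ} {h : ℝ} (hh : 0 < h) {F : Finset (ℤ × ℤ)} {c c' : ℤ × ℤ}
    (hc : c ∈ F) (hc' : c' ∉ F) {z : ℂ} (hz : z ∈ gridSquare z₀ h c)
    (hz' : z ∈ gridSquare z₀ h c') : z ∈ gridContour z₀ h F :=
  ⟨Set.mem_iUnion₂.2 ⟨c, hc, hz⟩, notMem_interior_gridRegion hh hc' hz'⟩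

theorem segment_re (z₀ : ℂ) (h : ℝ) (a b a' b' : ℤ) (t : ℝ) :
    (gridPoint z₀ h a b + t * (gridPoint z₀ h a' b' - gridPoint z₀ h a b)).re =
      z₀.re + h * a + t * (h * a' - h * a) := by
  simp [gridPoint_re, gridPoint_im]

theorem segment_im (z₀ : ℂ) (h : ℝ) (a b a' b' : ℤ) (t : ℝ) :
    (gridPoint z₀ h a b + t * (gridPoint z₀ h a' b' - gridPoint z₀ h a b)).im =
      z₀.im + h * b + t * (h * b' - h * b) := by
  simp [gridPoint_re, gridPoint_im]

variable {E : Type*} [NormedAddCommGroup E] [NormedSpace ℂ E]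

/-- Additive maps that act on the integrals over segments of the contour act on the integral over
the whole contour. -/
theorem map_boundaryIntegral {E' : Type*} [NormedAddCommGroup E'] [NormedSpace ℂ E'] (L : E →+ E')
    {g : ℂ → E} {g' : ℂ → E'} {z₀ : ℂ} {h : ℝ} (hh : 0 < h) {F : Finset (ℤ × ℤ)}
    (hL : ∀ P Q : ℂ, (∀ t ∈ Set.Icc (0 : ℝ) 1, P + t * (Q - P) ∈ gridContour z₀ h F) →
      L (segmentIntegral g P Q) = segmentIntegral g' P Q) :
    L (boundaryIntegral g z₀ h F) = boundaryIntegral g' z₀ h F := by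
  rw [boundaryIntegral, boundaryIntegral, map_sum]
  refine Finset.sum_congr rfl fun c hc => ?_
  rw [map_add, map_add, map_add]
  refine congrArg₂ _ (congrArg₂ _ (congrArg₂ _ ?_ ?_) ?_) ?_
  all_goals
    split_ifs with hn
    · exact map_zero L
    refine hL _ _ fun t ht => mem_gridContour hh hc hn ?_ ?_
  all_goals
    rw [mem_gridSquare, segment_re, segment_im]
    obtain ⟨ht0, ht1⟩ := ht
    have e1 : 0 ≤ t * h := mul_nonneg ht0 hh.le
    have e2 : 0 ≤ (1 - t) * h := mul_nonneg (by linarith) hh.le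
    push_cast
    refine ⟨⟨?_, ?_⟩, ?_, ?_⟩ <;> nlinarith

theorem boundaryIntegral_congr {g g' : ℂ → E} {z₀ : ℂ} {h : ℝ} (hh : 0 < h)
    {F : Finset (ℤ × ℤ)} (hg : ∀ z ∈ gridContour z₀ h F, g z = g' z) :
    boundaryIntegral g z₀ h F = boundaryIntegral g' z₀ h F := by
  refine map_boundaryIntegral (AddMonoidHom.id E) hh fun P Q hPQ => ?_
  change segmentIntegral g P Q = segmentIntegral g' P Q
  rw [segmentIntegral, segmentIntegral]
  congr 1
  refine intervalIntegral.integral_congr fun t ht => ?_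
  rw [Set.uIcc_of_le zero_le_one] at ht
  exact hg _ (hPQ t ht)

theorem ContinuousLinearMap.map_boundaryIntegral [CompleteSpace E] {E' : Type*}
    [NormedAddCommGroup E'] [NormedSpace ℂ E'] [CompleteSpace E'] (L : E →L[ℂ] E') {g : ℂ → E}
    {z₀ : ℂ} {h : ℝ} (hh : 0 < h) {F : Finset (ℤ × ℤ)}
    (hg : ContinuousOn g (gridContour z₀ h F)) :
    L (boundaryIntegral g z₀ h F) = boundaryIntegral (fun z => L (g z)) z₀ h F := by
  refine WeightIntegration.map_boundaryIntegral (L : E →+ E') hh fun P Q hPQ => ?_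
  change L (segmentIntegral g P Q) = _
  rw [segmentIntegral, segmentIntegral, map_smul]
  congr 1
  refine (L.intervalIntegral_comp_comm ?_).symm
  refine ContinuousOn.intervalIntegrable ?_
  rw [Set.uIcc_of_le zero_le_one]
  exact hg.comp (by fun_prop) hPQ

theorem boundaryIntegral_add [CompleteSpace E] {g g' : ℂ → E} {z₀ : ℂ} {h : ℝ} (hh : 0 < h)
    {F : Finset (ℤ × ℤ)} (hg : ContinuousOn g (gridContour z₀ h F))
    (hg' : ContinuousOn g' (gridContour z₀ h F)) :
    boundaryIntegral (fun z => g z + g' z) z₀ h F =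
      boundaryIntegral g z₀ h F + boundaryIntegral g' z₀ h F := by
  have hp : ContinuousOn (fun z => (g z, g' z)) (gridContour z₀ h F) := hg.prodMk hg'
  have h1 := ContinuousLinearMap.map_boundaryIntegral (ContinuousLinearMap.fst ℂ E E) hh hp
  have h2 := ContinuousLinearMap.map_boundaryIntegral (ContinuousLinearMap.snd ℂ E E) hh hp
  have h3 := ContinuousLinearMap.map_boundaryIntegral
    (ContinuousLinearMap.fst ℂ E E + ContinuousLinearMap.snd ℂ E E) hh hp
  rw [add_apply, h1, h2] at h3
  exact h3.symm

theorem segmentIntegral_symm (g : ℂ → E) (z w : ℂ) :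
    segmentIntegral g w z = -segmentIntegral g z w := by
  rw [segmentIntegral, segmentIntegral, ← neg_smul, neg_sub]
  congr 1
  have h1 := intervalIntegral.integral_comp_sub_left (a := 0) (b := 1)
    (fun t : ℝ => g (z + t * (w - z))) 1
  rw [sub_self, sub_zero] at h1
  rw [← h1]
  refine intervalIntegral.integral_congr fun t _ => ?_
  congr 1
  push_cast
  ring

theorem segmentIntegral_horizontal (g : ℂ → E) (x x' y : ℝ) :
    segmentIntegral g (x + y * Complex.I) (x' + y * Complex.I) =
      ∫ s : ℝ in x..x', g (s + y * Complex.I) := by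
  have h1 := intervalIntegral.smul_integral_comp_mul_add (a := 0) (b := 1)
    (fun s : ℝ => g (s + y * Complex.I)) (x' - x) x
  rw [mul_zero, zero_add, mul_one, sub_add_cancel] at h1
  rw [← h1, segmentIntegral, ← Complex.coe_smul]
  congr 1
  · push_cast; ring
  · refine intervalIntegral.integral_congr fun t _ => ?_
    congr 1
    push_cast
    ring

theorem segmentIntegral_vertical (g : ℂ → E) (x y y' : ℝ) :
    segmentIntegral g (x + y * Complex.I) (x + y' * Complex.I) =
      Complex.I • ∫ s : ℝ in y..y', g (x + s * Complex.I) := by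
  have h1 := intervalIntegral.smul_integral_comp_mul_add (a := 0) (b := 1)
    (fun s : ℝ => g (x + s * Complex.I)) (y' - y) y
  rw [mul_zero, zero_add, mul_one, sub_add_cancel] at h1
  rw [← h1, segmentIntegral, ← Complex.coe_smul, smul_smul]
  congr 1
  · push_cast; ring
  · refine intervalIntegral.integral_congr fun t _ => ?_
    congr 1
    push_cast
    ring

theorem gridPoint_eq (z₀ : ℂ) (h : ℝ) (a b : ℤ) : gridPoint z₀ h a b =
    ((z₀.re + h * a : ℝ) : ℂ) + ((z₀.im + h * b : ℝ) : ℂ) * Complex.I := by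
  apply Complex.ext <;> simp [gridPoint]

/-- Cauchy's theorem for one grid square. -/
theorem gridSquare_boundary_eq_zero [CompleteSpace E] {g : ℂ → E} {z₀ : ℂ} {h : ℝ} (hh : 0 < h)
    (c : ℤ × ℤ) (hg : DifferentiableOn ℂ g (gridSquare z₀ h c)) :
    segmentIntegral g (gridPoint z₀ h c.1 c.2) (gridPoint z₀ h (c.1 + 1) c.2) +
      segmentIntegral g (gridPoint z₀ h (c.1 + 1) c.2) (gridPoint z₀ h (c.1 + 1) (c.2 + 1)) +
      segmentIntegral g (gridPoint z₀ h (c.1 + 1) (c.2 + 1)) (gridPoint z₀ h c.1 (c.2 + 1)) +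
      segmentIntegral g (gridPoint z₀ h c.1 (c.2 + 1)) (gridPoint z₀ h c.1 c.2) = 0 := by
  have h1 := Complex.integral_boundary_rect_eq_zero_of_differentiableOn g
    (gridPoint z₀ h c.1 c.2) (gridPoint z₀ h (c.1 + 1) (c.2 + 1)) (hg.mono ?_)
  · rw [segmentIntegral_symm g (gridPoint z₀ h c.1 (c.2 + 1)) (gridPoint z₀ h (c.1 + 1) (c.2 + 1)),
      segmentIntegral_symm g (gridPoint z₀ h c.1 c.2) (gridPoint z₀ h c.1 (c.2 + 1))]
    simp only [gridPoint_re, gridPoint_im] at h1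
    simp only [gridPoint_eq, segmentIntegral_horizontal, segmentIntegral_vertical]
    rw [← h1]
    abel
  · intro z hz
    rw [Complex.mem_reProdIm, gridPoint_re, gridPoint_re, gridPoint_im, gridPoint_im,
      Set.uIcc_of_le (by push_cast; linarith), Set.uIcc_of_le (by push_cast; linarith)] at hz
    rw [mem_gridSquare]
    obtain ⟨⟨h1, h2⟩, h3, h4⟩ := hz
    push_cast at h2 h4
    exact ⟨⟨h1, h2⟩, h3, h4⟩

open Classical in
/-- The contributions of the edges shared by two squares of the family cancel. -/
theorem sum_shared_edges_eq_zero {A : Type*} [AddCommGroup A] (F : Finset (ℤ × ℤ))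
    (e : ℤ × ℤ ≃ ℤ × ℤ) {f f' : ℤ × ℤ → A}
    (hf : ∀ c, f' (e c) = -f c) :
    ∑ c ∈ F, (if e c ∈ F then f c else 0) + ∑ c ∈ F, (if e.symm c ∈ F then f' c else 0) = 0 := by
  rw [← Finset.sum_filter, ← Finset.sum_filter, add_eq_zero_iff_eq_neg, ← Finset.sum_neg_distrib]
  refine Finset.sum_nbij' e e.symm ?_ ?_ ?_ ?_ ?_
  · intro c hc
    simp only [Finset.mem_filter, Equiv.symm_apply_apply] at hc ⊢
    exact hc.symm
  · intro c hc
    simp only [Finset.mem_filter, Equiv.apply_symm_apply] at hc ⊢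
    exact hc.symm
  · simp
  · simp
  · intro c _
    rw [hf, neg_neg]

/-- Cauchy's theorem: the contour integral of a function that is holomorphic on the region
vanishes. -/
theorem boundaryIntegral_eq_zero [CompleteSpace E] {g : ℂ → E} {z₀ : ℂ} {h : ℝ} (hh : 0 < h)
    {F : Finset (ℤ × ℤ)} (hg : DifferentiableOn ℂ g (gridRegion z₀ h F)) :
    boundaryIntegral g z₀ h F = 0 := by
  classical
  let bot : ℤ × ℤ → E := fun c =>
    segmentIntegral g (gridPoint z₀ h c.1 c.2) (gridPoint z₀ h (c.1 + 1) c.2)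
  let rgt : ℤ × ℤ → E := fun c =>
    segmentIntegral g (gridPoint z₀ h (c.1 + 1) c.2) (gridPoint z₀ h (c.1 + 1) (c.2 + 1))
  let top : ℤ × ℤ → E := fun c =>
    segmentIntegral g (gridPoint z₀ h (c.1 + 1) (c.2 + 1)) (gridPoint z₀ h c.1 (c.2 + 1))
  let lft : ℤ × ℤ → E := fun c =>
    segmentIntegral g (gridPoint z₀ h c.1 (c.2 + 1)) (gridPoint z₀ h c.1 c.2)
  have h0 : ∑ c ∈ F, (bot c + rgt c + top c + lft c) = 0 :=
    Finset.sum_eq_zero fun c hc => gridSquare_boundary_eq_zero hh c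
      (hg.mono fun z hz => Set.mem_iUnion₂.2 ⟨c, hc, hz⟩)
  let south : ℤ × ℤ ≃ ℤ × ℤ := (Equiv.refl ℤ).prodCongr (Equiv.subRight 1)
  let west : ℤ × ℤ ≃ ℤ × ℤ := (Equiv.subRight (1 : ℤ)).prodCongr (Equiv.refl ℤ)
  have h1 := sum_shared_edges_eq_zero F south (f := bot) (f' := top) fun c => by
    change segmentIntegral g (gridPoint z₀ h (c.1 + 1) (c.2 - 1 + 1))
      (gridPoint z₀ h c.1 (c.2 - 1 + 1)) = -bot c
    rw [sub_add_cancel]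
    exact segmentIntegral_symm _ _ _
  have h2 := sum_shared_edges_eq_zero F west (f := lft) (f' := rgt) fun c => by
    change segmentIntegral g (gridPoint z₀ h (c.1 - 1 + 1) c.2)
      (gridPoint z₀ h (c.1 - 1 + 1) (c.2 + 1)) = -lft c
    rw [sub_add_cancel]
    exact segmentIntegral_symm _ _ _
  have key : ∀ (q : Prop) [Decidable q] (x : E), (if q then 0 else x) = x - if q then x else 0 := by
    intro q _ x
    split_ifs <;> simp
  have h3 : boundaryIntegral g z₀ h F = ∑ c ∈ F, (bot c + rgt c + top c + lft c) -
      ((∑ c ∈ F, (if south c ∈ F then bot c else 0) +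
        ∑ c ∈ F, (if south.symm c ∈ F then top c else 0)) +
      (∑ c ∈ F, (if west c ∈ F then lft c else 0) +
        ∑ c ∈ F, (if west.symm c ∈ F then rgt c else 0))) := by
    rw [← Finset.sum_add_distrib, ← Finset.sum_add_distrib, ← Finset.sum_add_distrib,
      ← Finset.sum_sub_distrib, boundaryIntegral]
    refine Finset.sum_congr rfl fun c _ => ?_
    rw [key, key, key, key]
    change bot c - (if south c ∈ F then bot c else 0) +
      (rgt c - if west.symm c ∈ F then rgt c else 0) +
      (top c - if south.symm c ∈ F then top c else 0) +
      (lft c - if west c ∈ F then lft c else 0) = _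
    abel
  rw [h3, h0, h1, h2]
  simp

end Contour

/-! ### Resolvents of matrices of operators -/

section MatrixResolvent

/-- If `[X, K] = K M K`, where `X`, `X + M K` and `X - K M` are invertible, then
`[X⁻¹, K] = K M' K` with `M' = -(X + M K)⁻¹ M (X - K M)⁻¹`. -/
theorem exists_commutator_inv {A : Type*} [Ring A] {K X R M : A} (hXR : X * R = 1)
    (hRX : R * X = 1) (h : X * K - K * X = K * M * K) (hu : IsUnit (X + M * K))
    (hv : IsUnit (X - K * M)) : ∃ M', R * K - K * R = K * M' * K := by
  obtain ⟨u, hu⟩ := hu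
  obtain ⟨v, hv⟩ := hv
  have e1 : R * K = K * ↑u⁻¹ := by
    have : X * K = K * u := by rw [hu, mul_add, ← mul_assoc, ← h]; abel
    calc R * K = R * (K * u) * ↑u⁻¹ := by rw [mul_assoc, mul_assoc, u.mul_inv, mul_one]
      _ = K * ↑u⁻¹ := by rw [← this, ← mul_assoc, hRX, one_mul]
  have e2 : K * R = ↑v⁻¹ * K := by
    have : K * X = v * K := by rw [hv, sub_mul, ← h]; abel
    calc K * R = ↑v⁻¹ * (v * K) * R := by rw [← mul_assoc (↑v⁻¹ : A) (↑v : A) K, v.inv_mul, one_mul]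
      _ = ↑v⁻¹ * K := by rw [← this, mul_assoc, mul_assoc, hXR, mul_one]
  refine ⟨-(↑u⁻¹ * M * ↑v⁻¹), ?_⟩
  have e3 : R * K - K * R = -(R * (X * K - K * X) * R) := by
    rw [mul_sub, sub_mul, ← mul_assoc R X, hRX, one_mul, mul_assoc R, mul_assoc K, hXR, mul_one]
    abel
  rw [e3, h]
  calc -(R * (K * M * K) * R) = -((R * K) * M * (K * R)) := by simp only [mul_assoc]
    _ = _ := by rw [e1, e2]; simp only [mul_assoc, mul_neg, neg_mul]

section Banach

attribute [local instance] Matrix.linftyOpNormedRing Matrix.linftyOpNormedAlgebra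

variable {ι : Type*} [Fintype ι] [DecidableEq ι]
variable {A : Type*} [NormedRing A]

theorem norm_entry_le_linftyOp (X : Matrix ι ι A) (i j : ι) : ‖X i j‖ ≤ ‖X‖ := by
  rw [Matrix.linfty_opNorm_def]
  have h1 : ‖X i j‖₊ ≤ ∑ j, ‖X i j‖₊ :=
    Finset.single_le_sum (f := fun j => ‖X i j‖₊) (fun _ _ => zero_le) (Finset.mem_univ j)
  have h2 : ∑ j, ‖X i j‖₊ ≤ Finset.univ.sup fun i => ∑ j, ‖X i j‖₊ :=
    Finset.le_sup (f := fun i => ∑ j, ‖X i j‖₊) (Finset.mem_univ i)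
  exact_mod_cast h1.trans h2

/-- Completeness of the matrix algebra for the uniformity of the `ℓ∞`-`ℓ¹` operator norm. -/
theorem completeSpace_linftyOp [CompleteSpace A] :
    @CompleteSpace (Matrix ι ι A)
      (Matrix.linftyOpNormedRing (n := ι) (α := A)).toMetricSpace.toUniformSpace :=
  inferInstanceAs (CompleteSpace (ι → ι → A))

variable [NormedAlgebra ℂ A] [CompleteSpace A]

theorem continuousOn_resolvent_entry (X : Matrix ι ι A) (i j : ι) :
    ContinuousOn (fun z => resolvent X z i j) (resolventSet ℂ X) := by
  have := completeSpace_linftyOp (ι := ι) (A := A)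
  let L : Matrix ι ι A →ₗ[ℂ] A := Matrix.entryLinearMap ℂ A i j
  have hL : Continuous L := (L.mkContinuous 1 fun Y => by
    rw [one_mul]; exact norm_entry_le_linftyOp Y i j).continuous
  intro z hz
  exact (hL.continuousAt.comp (f := fun z => resolvent X z)
    (spectrum.hasDerivAt_resolvent_const_left hz).continuousAt).continuousWithinAt

/-- Units of the matrix algebra are stable under small perturbations by a bounded family. -/
theorem exists_forall_isUnit_add_smul {X : Matrix ι ι A} (hX : IsUnit X) (c : ℝ) :
    ∃ ε : ℝ, 0 < ε ∧ ∀ Y : Matrix ι ι A, ‖Y‖ ≤ c → IsUnit (X + (ε : ℂ) • Y) := by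
  have := completeSpace_linftyOp (ι := ι) (A := A)
  obtain ⟨r, hr, hball⟩ := Metric.isOpen_iff.1 Units.isOpen X hX
  have hc : 0 < |c| + 1 := by positivity
  refine ⟨r / (|c| + 1), by positivity, fun Y hY => hball ?_⟩
  rw [mem_ball_iff_norm, add_sub_cancel_left, norm_smul, Complex.norm_real, Real.norm_eq_abs,
    abs_of_pos (by positivity), div_mul_eq_mul_div, div_lt_iff₀ hc]
  refine mul_lt_mul_of_pos_left ?_ hr
  have := le_abs_self c
  linarith

end Banach

theorem resolvent_eq_of_mul_eq_one {A : Type*} [Ring A] [Algebra ℂ A] {X R : A} {z : ℂ}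
    (h1 : (algebraMap ℂ A z - X) * R = 1) (h2 : R * (algebraMap ℂ A z - X) = 1) :
    z ∈ resolventSet ℂ X ∧ resolvent X z = R := by
  let u : Aˣ := ⟨algebraMap ℂ A z - X, R, h1, h2⟩
  exact ⟨⟨u, rfl⟩, Ring.inverse_unit u⟩

theorem mul_resolvent {A : Type*} [Ring A] [Algebra ℂ A] {X : A} {z : ℂ}
    (hz : z ∈ resolventSet ℂ X) : (algebraMap ℂ A z - X) * resolvent X z = 1 :=
  Ring.mul_inverse_cancel _ hz

theorem resolvent_mul {A : Type*} [Ring A] [Algebra ℂ A] {X : A} {z : ℂ}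
    (hz : z ∈ resolventSet ℂ X) : resolvent X z * (algebraMap ℂ A z - X) = 1 :=
  Ring.inverse_mul_cancel _ hz

/-- The expansion `(z - X)⁻¹ = z⁻¹ + z⁻² X + X (z⁻² (z - X)⁻¹) X`. -/
theorem resolvent_expansion {A : Type*} [Ring A] [Algebra ℂ A] {X : A} {z : ℂ} (hz0 : z ≠ 0)
    (hz : z ∈ resolventSet ℂ X) : resolvent X z =
      z⁻¹ • (1 : A) + z⁻¹ ^ 2 • X + X * (z⁻¹ ^ 2 • resolvent X z) * X := by
  have h1 := mul_resolvent hz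
  have h2 := resolvent_mul hz
  set R := resolvent X z
  rw [Algebra.algebraMap_eq_smul_one, sub_mul, smul_mul_assoc, one_mul, sub_eq_iff_eq_add] at h1
  rw [Algebra.algebraMap_eq_smul_one, mul_sub, mul_smul_comm, mul_one, sub_eq_iff_eq_add] at h2
  have e1 : R = z⁻¹ • (1 + X * R) := by rw [← h1, inv_smul_smul₀ hz0]
  have e2 : R = z⁻¹ • (1 + R * X) := by rw [← h2, inv_smul_smul₀ hz0]
  conv_lhs => rw [e1]; rw [e2]
  simp only [smul_add, mul_add, mul_smul_comm, smul_mul_assoc, mul_one, smul_smul, sq, mul_assoc,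
    add_assoc]

end MatrixResolvent

/-! ### Entries of resolvents: membership in the von Neumann algebra, and derivatives -/

section Entries

variable {H : Type*} [NormedAddCommGroup H] [InnerProductSpace ℂ H] [CompleteSpace H]
variable {N : VonNeumannAlgebra H} {D : H →ₗ.[ℂ] H}
variable {ι : Type*} [Fintype ι] [DecidableEq ι]

/-- The entries of the inverse commute with the commutant of `N`, since the inverse commutes with
the scalar matrices over the commutant. -/
theorem entry_inv_mem_vonNeumann {X R : Matrix ι ι (H →L[ℂ] H)} (hX : ∀ i j, X i j ∈ N)
    (h1 : X * R = 1) (h2 : R * X = 1) (i j : ι) : R i j ∈ N := by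
  refine mem_of_forall_commute fun z hz => ?_
  let Z : Matrix ι ι (H →L[ℂ] H) := Matrix.diagonal fun _ => z
  have h3 : Z * X = X * Z := by
    ext1 i j
    rw [Matrix.diagonal_mul, Matrix.mul_diagonal]
    exact commute_of_mem_commutant (hX i j) hz
  have h4 : Z * R = R * Z := by
    calc Z * R = R * X * (Z * R) := by rw [h2, one_mul]
      _ = R * (Z * X) * R := by rw [h3]; simp only [mul_assoc]
      _ = R * Z := by rw [mul_assoc, mul_assoc, h1, mul_one]
  have h5 := congrArg (fun M : Matrix ι ι (H →L[ℂ] H) => M i j) h4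
  simp only [Z, Matrix.diagonal_mul, Matrix.mul_diagonal] at h5
  exact h5

/-- The bounded form of `S = [|D|, X]` for matrices, with the resolvent of `|D|` on the diagonal. -/
theorem isDelta_matrix_iff (hD : IsSelfAdjoint D) {ε : ℝ} (hε : 0 < ε)
    {X S : Matrix ι ι (H →L[ℂ] H)} : (∀ i j, IsDelta D (X i j) (S i j)) ↔
      X * Matrix.diagonal (fun _ => absResolvent D ε) -
        Matrix.diagonal (fun _ => absResolvent D ε) * X =
      Matrix.diagonal (fun _ => absResolvent D ε) * ((ε : ℂ) • S) *
        Matrix.diagonal (fun _ => absResolvent D ε) := by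
  rw [← Matrix.ext_iff]
  refine forall₂_congr fun i j => ?_
  rw [isDelta_iff hD hε, Matrix.sub_apply, Matrix.mul_diagonal, Matrix.diagonal_mul,
    Matrix.mul_diagonal, Matrix.diagonal_mul, Matrix.smul_apply, mul_smul_comm, smul_mul_assoc,
    Complex.coe_smul]

section Banach

attribute [local instance] Matrix.linftyOpNormedRing Matrix.linftyOpNormedAlgebra

/-- The inverse of a matrix with entries in the domain of `δ` has entries in the domain of `δ`,
and `δ(X⁻¹) = -X⁻¹ δ(X) X⁻¹`. -/
theorem isDelta_matrix_inv (hD : IsSelfAdjoint D) {X R S : Matrix ι ι (H →L[ℂ] H)}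
    (hXR : X * R = 1) (hRX : R * X = 1) (hS : ∀ i j, IsDelta D (X i j) (S i j)) (i j : ι) :
    IsDelta D (R i j) ((-(R * S * R)) i j) := by
  have hX : IsUnit X := ⟨⟨X, R, hXR, hRX⟩, rfl⟩
  obtain ⟨ε, hε, hu⟩ := exists_forall_isUnit_add_smul hX ‖S‖
  set K : Matrix ι ι (H →L[ℂ] H) := Matrix.diagonal fun _ => absResolvent D ε with hK
  have hKn : ‖K‖ ≤ 1 := by
    rw [hK, Matrix.linfty_opNorm_diagonal, pi_norm_le_iff_of_nonneg zero_le_one]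
    exact fun _ => norm_absResolvent_le hD hε
  have h1 := (isDelta_matrix_iff hD hε).1 hS
  rw [← hK] at h1
  obtain ⟨M', hM'⟩ := exists_commutator_inv hXR hRX h1 (by
      rw [smul_mul_assoc]
      refine hu _ ((norm_mul_le _ _).trans ?_)
      exact mul_le_of_le_one_right (norm_nonneg _) hKn) (by
      rw [mul_smul_comm, sub_eq_add_neg, ← smul_neg]
      refine hu _ ?_
      rw [norm_neg]
      exact (norm_mul_le _ _).trans (mul_le_of_le_one_left (norm_nonneg _) hKn))
  have hεc : (ε : ℂ) ≠ 0 := by exact_mod_cast hε.ne'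
  have h2 : ∀ i j, IsDelta D (R i j) (((ε : ℂ)⁻¹ • M') i j) := by
    rw [isDelta_matrix_iff hD hε, smul_inv_smul₀ hεc]
    exact hM'
  -- The value of `δ(X⁻¹)` follows from the Leibniz rule for `X X⁻¹ = 1`.
  have h3 := commutator_mul h1 hM'
  have h4 : ∀ i j, IsDelta D ((X * R) i j) (((ε : ℂ)⁻¹ • (X * M' + (ε : ℂ) • S * R)) i j) := by
    rw [isDelta_matrix_iff hD hε, smul_inv_smul₀ hεc]
    exact h3
  have h5 : (ε : ℂ)⁻¹ • (X * M' + (ε : ℂ) • S * R) = 0 := by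
    ext1 i j
    refine (h4 i j).unique hD ?_
    rw [hXR, Matrix.one_apply, Matrix.zero_apply]
    split_ifs
    · exact isDelta_one hD
    · exact isDelta_zero hD
  have h6 : (ε : ℂ)⁻¹ • M' = -(R * S * R) := by
    rw [smul_add, smul_mul_assoc, inv_smul_smul₀ hεc, ← mul_smul_comm] at h5
    have h7 := congrArg (R * ·) (eq_neg_of_add_eq_zero_left h5)
    simp only [← mul_assoc, hRX, one_mul, mul_neg] at h7
    exact h7
  rw [← h6]
  exact h2 i j

end Banach

theorem isDelta_resolvent (hD : IsSelfAdjoint D) {X S : Matrix ι ι (H →L[ℂ] H)}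
    (hS : ∀ i j, IsDelta D (X i j) (S i j)) {z : ℂ} (hz : z ∈ resolventSet ℂ X) (i j : ι) :
    IsDelta D (resolvent X z i j) ((resolvent X z * S * resolvent X z) i j) := by
  have h1 : ∀ i j, IsDelta D ((algebraMap ℂ (Matrix ι ι (H →L[ℂ] H)) z - X) i j) ((-S) i j) := by
    intro i j
    have h2 : IsDelta D ((algebraMap ℂ (Matrix ι ι (H →L[ℂ] H)) z) i j) 0 := by
      rw [Algebra.algebraMap_eq_smul_one, Matrix.smul_apply, Matrix.one_apply]
      have h3 : IsDelta D (if i = j then (1 : H →L[ℂ] H) else 0) 0 := by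
        split_ifs
        · exact isDelta_one hD
        · exact isDelta_zero hD
      simpa using h3.smul hD z
    have h4 := h2.add hD ((hS i j).smul hD (-1))
    rwa [neg_one_smul, neg_one_smul, zero_add, ← sub_eq_add_neg] at h4
  have h5 := isDelta_matrix_inv hD (mul_resolvent hz) (resolvent_mul hz) h1 i j
  rwa [mul_neg, neg_mul, neg_neg] at h5

theorem isDelta_boundaryIntegral (hD : IsSelfAdjoint D) {g g' : ℂ → (H →L[ℂ] H)} {z₀ : ℂ} {h : ℝ}
    (hh : 0 < h) {F : Finset (ℤ × ℤ)} (hg : ContinuousOn g (gridContour z₀ h F))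
    (hg' : ContinuousOn g' (gridContour z₀ h F))
    (hd : ∀ z ∈ gridContour z₀ h F, IsDelta D (g z) (g' z)) :
    IsDelta D (boundaryIntegral g z₀ h F) (boundaryIntegral g' z₀ h F) := by
  let m := ContinuousLinearMap.mul ℂ (H →L[ℂ] H)
  let K := absResolvent D 1
  have h1 := ContinuousLinearMap.map_boundaryIntegral (m.flip K - m K) hh hg
  have h2 := ContinuousLinearMap.map_boundaryIntegral ((m.flip K).comp (m K)) hh hg'
  have h3 : boundaryIntegral (fun z => (m.flip K - m K) (g z)) z₀ h F =
      boundaryIntegral (fun z => ((m.flip K).comp (m K)) (g' z)) z₀ h F := by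
    refine boundaryIntegral_congr hh fun z hz => ?_
    have h4 := (isDelta_iff hD one_pos).1 (hd z hz)
    rwa [one_smul] at h4
  rw [isDelta_iff hD one_pos, one_smul]
  exact h1.trans (h3.trans h2.symm)

theorem boundaryIntegral_mem_vonNeumann {g : ℂ → (H →L[ℂ] H)} {z₀ : ℂ} {h : ℝ}
    (hh : 0 < h) {F : Finset (ℤ × ℤ)} (hg : ContinuousOn g (gridContour z₀ h F))
    (hN : ∀ z ∈ gridContour z₀ h F, g z ∈ N) : boundaryIntegral g z₀ h F ∈ N := by
  refine mem_of_forall_commute fun c hc => ?_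
  let m := ContinuousLinearMap.mul ℂ (H →L[ℂ] H)
  have h1 := ContinuousLinearMap.map_boundaryIntegral (m c) hh hg
  have h2 := ContinuousLinearMap.map_boundaryIntegral (m.flip c) hh hg
  refine h1.trans (Eq.trans ?_ h2.symm)
  exact boundaryIntegral_congr hh fun z hz => commute_of_mem_commutant (hN z hz) hc

end Entries

/-! ### Stability under the holomorphic functional calculus -/

section Stability

theorem boundaryIntegral_sum {E : Type*} [NormedAddCommGroup E] [NormedSpace ℂ E] [CompleteSpace E]
    {κ : Type*} (s : Finset κ) {g : κ → ℂ → E} {z₀ : ℂ} {h : ℝ} (hh : 0 < h) {F : Finset (ℤ × ℤ)}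
    (hg : ∀ k, ContinuousOn (g k) (gridContour z₀ h F)) :
    boundaryIntegral (fun z => ∑ k ∈ s, g k z) z₀ h F = ∑ k ∈ s, boundaryIntegral (g k) z₀ h F := by
  classical
  induction s using Finset.induction_on with
  | empty =>
    simp only [Finset.sum_empty]
    exact boundaryIntegral_eq_zero hh (differentiableOn_const 0)
  | insert a s ha ih =>
    simp only [Finset.sum_insert ha]
    rw [← ih, ← boundaryIntegral_add hh (hg a) (continuousOn_finsetSum _ fun k _ => hg k)]

variable {H : Type*} [NormedAddCommGroup H] [InnerProductSpace ℂ H] [CompleteSpace H]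
variable {N : VonNeumannAlgebra H} {τ : (H →L[ℂ] H) → ℝ≥0∞} {D : H →ₗ.[ℂ] H} {p : ℝ}
variable {ι : Type} [Fintype ι] [DecidableEq ι]

theorem Surrounds.contour_subset {K U : Set ℂ} {z₀ : ℂ} {h : ℝ} {F : Finset (ℤ × ℤ)}
    (hs : Surrounds K U z₀ h F) : gridContour z₀ h F ⊆ U ∩ Kᶜ :=
  fun _ hz => ⟨hs.2.2 hz.1, fun hK => hz.2 (hs.2.1 hK)⟩

namespace IsProjective

theorem sum_mem_B1 (h : IsProjective N τ D p) {κ : Type*} (s : Finset κ) {T : κ → (H →L[ℂ] H)}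
    (hT : ∀ k, T k ∈ B1 N τ D p) : ∑ k ∈ s, T k ∈ B1 N τ D p := by
  classical
  induction s using Finset.induction_on with
  | empty => exact h.zero_mem_B1
  | insert a s ha ih => rw [Finset.sum_insert ha]; exact h.add_mem_B1 (hT a) ih

theorem resolvent_mem_vonNeumann (h : IsProjective N τ D p) {X : Matrix ι ι (H →L[ℂ] H)}
    (hX : ∀ i j, X i j ∈ B1 N τ D p) {z : ℂ} (hz : z ∈ resolventSet ℂ X) (i j : ι) :
    resolvent X z i j ∈ N := by
  refine entry_inv_mem_vonNeumann (fun i j => ?_) (mul_resolvent hz) (resolvent_mul hz) i j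
  rw [Algebra.algebraMap_eq_smul_one, Matrix.sub_apply, Matrix.smul_apply, Matrix.one_apply]
  refine sub_mem (smul_mem_vonNeumann z ?_) (h.mem_vonNeumann_of_mem_B1 (hX i j))
  split_ifs
  · exact one_mem N
  · exact zero_mem N

/-- If `B₁` does not contain the unit, no matrix over `B₁` is invertible: `1 = X X⁻² X` would have
entries in `B₁ N B₁`. -/
theorem zero_mem_spectrum (h : IsProjective N τ D p) {X : Matrix ι ι (H →L[ℂ] H)}
    (hX : ∀ i j, X i j ∈ B1 N τ D p) (h1 : (1 : H →L[ℂ] H) ∉ B1 N τ D p) (i : ι) :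
    (0 : ℂ) ∈ spectrum ℂ X := by
  by_contra h0
  have hz : (0 : ℂ) ∈ resolventSet ℂ X := not_not.1 h0
  have e1 := mul_resolvent hz
  have e2 := resolvent_mul hz
  have hR := h.resolvent_mem_vonNeumann hX hz
  set R := resolvent X (0 : ℂ)
  rw [map_zero, zero_sub, neg_mul] at e1
  rw [map_zero, zero_sub, mul_neg] at e2
  have e3 : (1 : Matrix ι ι (H →L[ℂ] H)) = X * (R * R) * X := by
    calc (1 : Matrix ι ι (H →L[ℂ] H)) = -(X * R) * -(R * X) := by rw [e1, e2, one_mul]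
      _ = X * (R * R) * X := by rw [neg_mul_neg]; simp only [mul_assoc]
  have e4 := congrArg (fun M : Matrix ι ι (H →L[ℂ] H) => M i i) e3
  simp only [Matrix.one_apply_eq] at e4
  refine h1 ?_
  rw [e4, Matrix.mul_apply]
  refine h.sum_mem_B1 _ fun b => ?_
  rw [Matrix.mul_apply, Finset.sum_mul]
  refine h.sum_mem_B1 _ fun a => h.mul_mul_mem_B1 (hX i a) ?_ (hX b i)
  rw [Matrix.mul_apply]
  exact sum_mem fun c _ => MulMemClass.mul_mem (hR a c) (hR c b)

theorem boundaryIntegral_resolvent_mem_B1 (h : IsProjective N τ D p)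
    {X : Matrix ι ι (H →L[ℂ] H)} (hX : ∀ i j, X i j ∈ B1 N τ D p) {f : ℂ → ℂ} {U : Set ℂ}
    (hU : IsOpen U) (hf : DifferentiableOn ℂ f U) {z₀ : ℂ} {r : ℝ} {F : Finset (ℤ × ℤ)}
    (hs : Surrounds (spectrum ℂ X) U z₀ r F)
    (h1 : (1 : H →L[ℂ] H) ∈ B1 N τ D p ∨ f 0 = 0) (i j : ι) :
    boundaryIntegral (fun z => f z • resolvent X z i j) z₀ r F ∈ B1 N τ D p := by
  have hC := hs.contour_subset
  have hr := hs.1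
  have hfC : ContinuousOn f (gridContour z₀ r F) :=
    hf.continuousOn.mono fun z hz => (hC hz).1
  have hres : ∀ z ∈ gridContour z₀ r F, z ∈ resolventSet ℂ X := fun z hz => not_not.1 (hC hz).2
  have hRC : ∀ i j, ContinuousOn (fun z => resolvent X z i j) (gridContour z₀ r F) :=
    fun i j => (continuousOn_resolvent_entry X i j).mono hres
  have hN : ∀ g : ℂ → ℂ, ContinuousOn g (gridContour z₀ r F) → ∀ i j,
      boundaryIntegral (fun z => g z • resolvent X z i j) z₀ r F ∈ N := fun g hg i j =>
    boundaryIntegral_mem_vonNeumann hr (hg.smul (hRC i j)) fun z hz =>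
      smul_mem_vonNeumann _ (h.resolvent_mem_vonNeumann hX (hres z hz) i j)
  -- If `B₁` contains the unit, it contains `1 N 1 = N`.
  by_cases hone : (1 : H →L[ℂ] H) ∈ B1 N τ D p
  · simpa using h.mul_mul_mem_B1 hone (hN f hfC i j) hone
  have hf0 : f 0 = 0 := h1.resolve_left hone
  have h0 : (0 : ℂ) ∈ interior (gridRegion z₀ r F) := hs.2.1 (h.zero_mem_spectrum hX hone i)
  have hz0 : ∀ z ∈ gridContour z₀ r F, z ≠ 0 := fun z hz hz' => hz.2 (hz' ▸ h0)
  have hinv : ContinuousOn (fun z : ℂ => f z * z⁻¹ ^ 2) (gridContour z₀ r F) :=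
    hfC.mul ((continuousOn_id.inv₀ hz0).pow 2)
  set g : ℂ → ℂ := fun z => f z * z⁻¹ ^ 2
  -- The term `f(z) / z` of the expansion is holomorphic inside the contour because `f 0 = 0`.
  have hslope : DifferentiableOn ℂ (dslope f 0) U :=
    (Complex.differentiableOn_dslope (hU.mem_nhds (hs.2.2 (interior_subset h0)))).2 hf
  have hd1 : DifferentiableOn ℂ (fun z => dslope f 0 z • (1 : Matrix ι ι (H →L[ℂ] H)) i j)
      (gridRegion z₀ r F) := (hslope.mono hs.2.2).smul_const _
  have hc2 : ContinuousOn (fun z => g z • X i j) (gridContour z₀ r F) :=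
    hinv.smul continuousOn_const
  have hc3 : ∀ q : ι × ι, ContinuousOn
      (fun z => X i q.1 * (g z • resolvent X z q.1 q.2) * X q.2 j) (gridContour z₀ r F) :=
    fun q => (continuousOn_const.mul (hinv.smul (hRC q.1 q.2))).mul continuousOn_const
  have hc4 : ContinuousOn (fun z => ∑ q : ι × ι,
      X i q.1 * (g z • resolvent X z q.1 q.2) * X q.2 j) (gridContour z₀ r F) :=
    continuousOn_finsetSum _ fun q _ => hc3 q
  have hc24 : ContinuousOn (fun z => g z • X i j + ∑ q : ι × ι,
      X i q.1 * (g z • resolvent X z q.1 q.2) * X q.2 j) (gridContour z₀ r F) := hc2.add hc4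
  have e1 : boundaryIntegral (fun z => f z • resolvent X z i j) z₀ r F =
      boundaryIntegral (fun z => dslope f 0 z • (1 : Matrix ι ι (H →L[ℂ] H)) i j +
        (g z • X i j + ∑ q : ι × ι, X i q.1 * (g z • resolvent X z q.1 q.2) * X q.2 j))
          z₀ r F := by
    refine boundaryIntegral_congr hr fun z hz => ?_
    have hzz := hz0 z hz
    have hds : dslope f 0 z = f z * z⁻¹ := by
      rw [dslope_of_ne _ hzz, slope_def_field, hf0, sub_zero, sub_zero, div_eq_mul_inv]
    have e2 := congrArg (fun M : Matrix ι ι (H →L[ℂ] H) => f z • M i j)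
      (resolvent_expansion hzz (hres z hz))
    simp only [Matrix.add_apply, smul_add] at e2
    rw [e2, hds, add_assoc, Matrix.smul_apply, Matrix.smul_apply, smul_smul, smul_smul]
    refine congrArg₂ _ rfl (congrArg₂ _ rfl ?_)
    rw [Fintype.sum_prod_type_right, Matrix.mul_apply, Finset.smul_sum]
    refine Finset.sum_congr rfl fun b _ => ?_
    rw [Matrix.mul_apply, Finset.sum_mul, Finset.smul_sum]
    refine Finset.sum_congr rfl fun a _ => ?_
    rw [Matrix.smul_apply, ← smul_mul_assoc, ← mul_smul_comm, smul_smul]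
  rw [e1, boundaryIntegral_add hr (hd1.continuousOn.mono fun z hz => hz.1) hc24,
    boundaryIntegral_add hr hc2 hc4, boundaryIntegral_eq_zero hr hd1, zero_add,
    boundaryIntegral_sum _ hr hc3]
  refine h.add_mem_B1 ?_ (h.sum_mem_B1 _ fun q => ?_)
  · have e3 := ContinuousLinearMap.map_boundaryIntegral
      (ContinuousLinearMap.toSpanSingleton ℂ (X i j)) hr hinv
    simp only [ContinuousLinearMap.toSpanSingleton_apply] at e3
    rw [← e3]
    exact h.smul_mem_B1 _ (hX i j)
  · let m := ContinuousLinearMap.mul ℂ (H →L[ℂ] H)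
    have e3 := ContinuousLinearMap.map_boundaryIntegral ((m.flip (X q.2 j)).comp (m (X i q.1))) hr
      (hinv.smul (hRC q.1 q.2))
    have e4 : boundaryIntegral (fun z => X i q.1 * (g z • resolvent X z q.1 q.2) * X q.2 j) z₀ r F =
        X i q.1 * boundaryIntegral (fun z => g z • resolvent X z q.1 q.2) z₀ r F * X q.2 j :=
      e3.symm
    rw [e4]
    exact h.mul_mul_mem_B1 (hX i q.1) (hN g hinv q.1 q.2) (hX q.2 j)

end IsProjective

/-- The resolvent of the block matrix `[[X, S], [0, X]]` has the off-diagonal block `R S R`. -/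
theorem resolvent_fromBlocks {A : Type*} [Ring A] [Algebra ℂ A] {X S : Matrix ι ι A} {z : ℂ}
    (hz : z ∈ resolventSet ℂ X) :
    z ∈ resolventSet ℂ (Matrix.fromBlocks X S 0 X) ∧
      resolvent (Matrix.fromBlocks X S 0 X) z =
        Matrix.fromBlocks (resolvent X z) (resolvent X z * S * resolvent X z) 0
          (resolvent X z) := by
  have h1 := mul_resolvent hz
  have h2 := resolvent_mul hz
  have e : algebraMap ℂ (Matrix (ι ⊕ ι) (ι ⊕ ι) A) z - Matrix.fromBlocks X S 0 X =
      Matrix.fromBlocks (algebraMap ℂ (Matrix ι ι A) z - X) (-S) 0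
        (algebraMap ℂ (Matrix ι ι A) z - X) := by
    rw [Algebra.algebraMap_eq_smul_one, Algebra.algebraMap_eq_smul_one, ← Matrix.fromBlocks_one,
      Matrix.fromBlocks_smul, sub_eq_add_neg, Matrix.fromBlocks_neg, Matrix.fromBlocks_add,
      smul_zero, zero_add, neg_zero, add_zero, ← sub_eq_add_neg]
  refine resolvent_eq_of_mul_eq_one ?_ ?_
  · rw [e, Matrix.fromBlocks_multiply, ← Matrix.fromBlocks_one]
    simp only [Matrix.mul_zero, Matrix.zero_mul, add_zero, zero_add, h1, Matrix.mul_assoc]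
    rw [← Matrix.mul_assoc _ (resolvent X z), h1, Matrix.one_mul, Matrix.neg_mul, add_neg_cancel]
  · rw [e, Matrix.fromBlocks_multiply, ← Matrix.fromBlocks_one]
    simp only [Matrix.mul_zero, Matrix.zero_mul, add_zero, zero_add, h2, Matrix.mul_assoc]
    rw [Matrix.mul_one, Matrix.mul_neg, neg_add_cancel]

/-- The function `f` of a matrix over `B₁^k` has entries in `B₁^k`. In the step from `k` to `k + 1`
the matrix `[[X, δ(X)], [0, X]]` has entries in `B₁^k`, and `δ(f(X))` is the off-diagonal block
of its image under `f`. -/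
theorem IsProjective.boundaryIntegral_resolvent_mem_B1Smooth (h : IsProjective N τ D p)
    (hD : IsSelfAdjoint D) {f : ℂ → ℂ} {U : Set ℂ} (hU : IsOpen U) (hf : DifferentiableOn ℂ f U)
    {z₀ : ℂ} {r : ℝ} {F : Finset (ℤ × ℤ)} (h1 : (1 : H →L[ℂ] H) ∈ B1 N τ D p ∨ f 0 = 0) (k : ℕ) :
    ∀ {ι : Type} [Fintype ι] [DecidableEq ι] {X : Matrix ι ι (H →L[ℂ] H)},
      (∀ i j, X i j ∈ B1Smooth N τ D p (k : ℕ∞)) → Surrounds (spectrum ℂ X) U z₀ r F →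
      ∀ i j, boundaryIntegral (fun z => f z • resolvent X z i j) z₀ r F ∈
        B1Smooth N τ D p (k : ℕ∞) := by
  induction k with
  | zero =>
    intro ι _ _ X hX hs i j
    exact mem_B1Smooth_zero.2 (h.boundaryIntegral_resolvent_mem_B1
      (fun i j => mem_B1Smooth_zero.1 (hX i j)) hU hf hs h1 i j)
  | succ k ih =>
    intro ι _ _ X hX hs i j
    have hC := hs.contour_subset
    have hfC : ContinuousOn f (gridContour z₀ r F) :=
      hf.continuousOn.mono fun z hz => (hC hz).1
    have hres : ∀ z ∈ gridContour z₀ r F, z ∈ resolventSet ℂ X := fun z hz => not_not.1 (hC hz).2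
    let S : Matrix ι ι (H →L[ℂ] H) := X.map (delta D)
    have hS : ∀ i j, IsDelta D (X i j) (S i j) := fun i j =>
      isDelta_delta (mem_B1Smooth_succ.1 (hX i j)).1
    have hX2 : ∀ a b, Matrix.fromBlocks X S 0 X a b ∈ B1Smooth N τ D p (k : ℕ∞) := by
      have hXk : ∀ i j, X i j ∈ B1Smooth N τ D p (k : ℕ∞) := fun i j =>
        B1Smooth_mono (by exact_mod_cast k.le_succ) (hX i j)
      rintro (a | a) (b | b)
      · exact hXk a b
      · exact (mem_B1Smooth_succ.1 (hX a b)).2.2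
      · exact h.zero_mem_B1Smooth hD k
      · exact hXk a b
    have hs2 : Surrounds (spectrum ℂ (Matrix.fromBlocks X S 0 X)) U z₀ r F :=
      ⟨hs.1, fun z hz => hs.2.1 fun hz' => hz (resolvent_fromBlocks hz').1, hs.2.2⟩
    -- The diagonal and the off-diagonal block of `f` applied to the block matrix.
    have hY := ih hX2 hs2 (Sum.inl i) (Sum.inl j)
    have hW := ih hX2 hs2 (Sum.inl i) (Sum.inr j)
    have eY : boundaryIntegral (fun z => f z • resolvent (Matrix.fromBlocks X S 0 X) z
        (Sum.inl i) (Sum.inl j)) z₀ r F =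
        boundaryIntegral (fun z => f z • resolvent X z i j) z₀ r F :=
      boundaryIntegral_congr hs.1 fun z hz => by
        rw [(resolvent_fromBlocks (hres z hz)).2, Matrix.fromBlocks_apply₁₁]
    rw [eY] at hY
    have hδ : IsDelta D (boundaryIntegral (fun z => f z • resolvent X z i j) z₀ r F)
        (boundaryIntegral (fun z => f z • resolvent (Matrix.fromBlocks X S 0 X) z
          (Sum.inl i) (Sum.inr j)) z₀ r F) := by
      refine isDelta_boundaryIntegral hD hs.1
        (hfC.smul ((continuousOn_resolvent_entry X i j).mono hres))
        (hfC.smul ((continuousOn_resolvent_entry _ _ _).mono fun z hz =>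
          (resolvent_fromBlocks (hres z hz)).1)) fun z hz => ?_
      rw [(resolvent_fromBlocks (hres z hz)).2, Matrix.fromBlocks_apply₁₂]
      exact (isDelta_resolvent hD hS (hres z hz) i j).smul hD (f z)
    refine mem_B1Smooth_succ.2 ⟨hδ.mem_deltaDomain, mem_B1_of_mem_B1Smooth hY, ?_⟩
    rw [hδ.delta_eq hD]
    exact hW

theorem IsProjective.stableHolomorphic (h : IsProjective N τ D p) (hD : IsSelfAdjoint D) (l : ℕ∞)
    (m : ℕ) : StableHolomorphic (B1Smooth N τ D p l) m := by
  rintro X Y f U hX ⟨hU, hf, z₀, r, F, hs, hY⟩ h1 i j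
  rw [hY i j]
  refine (h.frechetData_B1Smooth hD l).smul_mem _ _ (mem_B1Smooth_iff.2 fun k hk => ?_)
  exact h.boundaryIntegral_resolvent_mem_B1Smooth hD hU hf (h1.imp_left mem_B1_of_mem_B1Smooth) k
    (fun i j => mem_B1Smooth_iff.1 (hX i j) k hk) hs i j

end Stability

end WeightIntegration

theorem mainTheorem9 {H : Type*} [NormedAddCommGroup H] [InnerProductSpace ℂ H] [CompleteSpace H]
    [TopologicalSpace.SeparableSpace H]
    (N : VonNeumannAlgebra H) (τ : (H →L[ℂ] H) → ENNReal)
    (hτ : WeightIntegration.IsFaithfulNormalSemifiniteTrace N τ)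
    (D : H →ₗ.[ℂ] H) (hD : IsSelfAdjoint D) (hDN : WeightIntegration.IsAffiliated N D)
    (p : ℝ) (hp : 1 ≤ p) :
    WeightIntegration.IsFrechetStarSubalgebra (WeightIntegration.B2 N τ D p)
        (WeightIntegration.normQ τ D p) ∧
      ∀ l : ℕ∞,
        WeightIntegration.IsFrechetStarSubalgebra (WeightIntegration.B1Smooth N τ D p l)
            (fun i : WeightIntegration.SmoothIndex l =>
              WeightIntegration.normPSmooth N τ D p i.1 i.2) ∧
          ∀ m : ℕ,
            WeightIntegration.IsFrechetStarSubalgebra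
                (WeightIntegration.matricesOver (WeightIntegration.B1Smooth N τ D p l) m)
                (WeightIntegration.matrixSeminorm
                  (fun i : WeightIntegration.SmoothIndex l =>
                    WeightIntegration.normPSmooth N τ D p i.1 i.2) m) ∧
              WeightIntegration.StableHolomorphic (WeightIntegration.B1Smooth N τ D p l) m := by
  have hp0 : 0 ≤ p := zero_le_one.trans hp
  have h := WeightIntegration.isProjective hτ hD hDN hp0
  refine ⟨(WeightIntegration.frechetData_B2 hτ hD hDN hp0).isFrechetStarSubalgebra, fun l => ?_⟩
  have hl := h.frechetData_B1Smooth hD l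
  exact ⟨hl.isFrechetStarSubalgebra, fun m =>
    ⟨(hl.matricesOver m).isFrechetStarSubalgebra, h.stableHolomorphic hD l m⟩⟩
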